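/- **Conventions.** $\mathbf{CAT}$ is the 2-category of locally small categories, functors and natural transformations, $\mathbf{Cat}$ its full sub-2-category on the small categories, and $J\colon\mathbf{Cat}\to\mathbf{CAT}$ the inclusion. A relative pseudomonad $T$ over $J$ consists of objects $TX$, morphisms $i_X\colon JX\to TX$, functors $(-)^*\colon \mathbf{CAT}[JX,TY]\to\mathbf{CAT}[TX,TY]$ and natural families of invertible 2-cells $\mu_{f,g}\colon (g^*f)^*\Rightarrow g^*f^*$, $\eta_f\colon f\Rightarrow f^*i_X$, $\theta_X\colon i_X^*\Rightarrow 1_{TX}$, subject to the associativity and the unit coherence axioms. The relative pseudomonad of presheaves $P\colon\mathbf{Cat}\to\mathbf{CAT}$ is given by $PX=[X^{\mathrm{op}},\mathbf{Set}]$, with $i_X=\mathrm y_X$ the Yoneda embedding, $f^*$ the left Kan extension of $f$ along $\mathrm y_X$, $\eta_f$ its unit, and $\mu,\theta$ the canonical isomorphisms determined by the universal property of left Kan extensions. For a 2-monad $S$ on $\mathbf{CAT}$, a strict $S$-algebra is small if its underlying category is small. A pseudomorphism of strict algebras $(A,a)\to(B,b)$ is a functor $f\colon A\to B$ with an invertible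 natural transformation $b\,S(f)\cong f\,a$ compatible with the unit and the multiplication of $S$; an algebra 2-cell is a natural transformation compatible with these isomorphisms. **Theorem.** Let $S\colon\mathbf{CAT}\to\mathbf{CAT}$ be the 2-monad for monoidal categories, or for symmetric monoidal categories, or for monoidal categories in which the unit is a terminal object, or for symmetric monoidal categories in which the unit is a terminal object; that is, $SX$ is the free such category on $X$. Then the relative pseudomonad of presheaves $P$ has a lifting to strict $S$-algebras, that is, there are - a strict $S$-algebra structure on $PA$, for every small strict $S$-algebra $A$; - a pseudomorphism structure on $f^*\colon PA\to PB$, for all small strict $S$-algebras $A$, $B$ and every pseudomorphism $f\colon A\to PB$, such that $\alpha^*$ is an algebra 2-cell whenever $\alpha\colon f\Rightarrow f'$ is one; - a pseudomorphism structure on $\mathrm y_A\colon A\to PA$, for every small strict $S$-algebra $A$; such that $\mu_{f,g}$, $\eta_f$ and $\theta_A$ are algebra 2-cells for all small strict $S$-algebras $A,B,C$ and all pseudomorphisms $f\colon A\to PB$ and $g\colon B\to PC$. Moreover, this lifting can be chosen so that, for every small strict $S$-algebra $A$: 1. the tensor product of $PA$ is Day convolution: there are natural transformations $F(x)\times G(y)\to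 (F\,\hat\otimes\, G)(x\otimes y)$ of functors of $(x,y)\in A^{\mathrm{op}}\times A^{\mathrm{op}}$, natural in $F,G\in PA$, that exhibit $F\,\hat\otimes\, G$ as the left Kan extension of $(x,y)\mapsto F(x)\times G(y)$ along $\otimes\colon A^{\mathrm{op}}\times A^{\mathrm{op}}\to A^{\mathrm{op}}$; 2. $PA$ is monoidally cocomplete, i.e. it has small colimits and its tensor product preserves small colimits in each variable; and for every monoidally cocomplete (locally small) strict $S$-algebra $B$, restriction along the pseudomorphism $\mathrm y_A$ is an equivalence from the category of pseudomorphisms $PA\to B$ that preserve small colimits (and algebra 2-cells) to the category of all pseudomorphisms $A\to B$ (and algebra 2-cells). -/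

import Mathlib

open CategoryTheory

namespace PshLift
section Generic

open Bicategory

universe w v u w' v' u'

/-- A relative pseudomonad over a pseudofunctor `J : C → D`: objects `T X`, extension functors
`(-)^* = ext X Y`, units `i_X = unit X`, and natural families of invertible 2-cells
`mu f g : (g^* f)^* ≅ g^* f^*`, `eta f : f ≅ f^* i_X`, `theta X : i_X^* ≅ 1`, subject to the
associativity and the unit coherence axioms. Composition is written in diagrammatic order:
`f ≫ g` is "`f`, then `g`". -/
structure RelPseudomonad {C : Type u} [Bicategory.{w, v} C] {D : Type u'} [Bicategory.{w', v'} D]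
    (J : Pseudofunctor C D) where
  obj : C → D
  ext (X Y : C) : (J.obj X ⟶ obj Y) ⥤ (obj X ⟶ obj Y)
  unit (X : C) : J.obj X ⟶ obj X
  mu {X Y Z : C} (f : J.obj X ⟶ obj Y) (g : J.obj Y ⟶ obj Z) :
    (ext X Z).obj (f ≫ (ext Y Z).obj g) ≅ (ext X Y).obj f ≫ (ext Y Z).obj g
  mu_natural {X Y Z : C} {f f' : J.obj X ⟶ obj Y} {g g' : J.obj Y ⟶ obj Z}
    (φ : f ⟶ f') (ψ : g ⟶ g') :
    (ext X Z).map (φ ▷ (ext Y Z).obj g ≫ f' ◁ (ext Y Z).map ψ) ≫ (mu f' g').hom =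
      (mu f g).hom ≫ (ext X Y).map φ ▷ (ext Y Z).obj g ≫ (ext X Y).obj f' ◁ (ext Y Z).map ψ
  eta {X Y : C} (f : J.obj X ⟶ obj Y) : f ≅ unit X ≫ (ext X Y).obj f
  eta_natural {X Y : C} {f f' : J.obj X ⟶ obj Y} (φ : f ⟶ f') :
    φ ≫ (eta f').hom = (eta f).hom ≫ unit X ◁ (ext X Y).map φ
  theta (X : C) : (ext X X).obj (unit X) ≅ 𝟙 (obj X)
  assoc_coh {X Y Z V : C} (f : J.obj X ⟶ obj Y) (g : J.obj Y ⟶ obj Z) (h : J.obj Z ⟶ obj V) :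
    (ext X V).map (f ◁ (mu g h).hom) ≫
        (ext X V).map (α_ f ((ext Y Z).obj g) ((ext Z V).obj h)).inv ≫
        (mu (f ≫ (ext Y Z).obj g) h).hom ≫ (mu f g).hom ▷ (ext Z V).obj h ≫
        (α_ ((ext X Y).obj f) ((ext Y Z).obj g) ((ext Z V).obj h)).hom =
      (mu f (g ≫ (ext Z V).obj h)).hom ≫ (ext X Y).obj f ◁ (mu g h).hom
  unit_coh {X Y : C} (f : J.obj X ⟶ obj Y) :
    (ext X Y).map (eta f).hom ≫ (mu (unit X) f).hom ≫ (theta X).hom ▷ (ext X Y).obj f =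
      (λ_ ((ext X Y).obj f)).inv

/-- Data which determines a relative pseudomonad by universal properties: every `ext f` is a left
extension of `f` along `unit X` with invertible unit 2-cell `eta f`, `ext f ≫ ext g` is a left
extension of `f ≫ ext g` along `unit X`, and the identity of `obj X` is a left extension of
`unit X` along itself. -/
structure LeftKanData {C : Type u} [Bicategory.{w, v} C] {D : Type u'} [Bicategory.{w', v'} D]
    (J : Pseudofunctor C D) where
  obj : C → D
  unit (X : C) : J.obj X ⟶ obj X
  ext {X Y : C} (f : J.obj X ⟶ obj Y) : obj X ⟶ obj Y
  eta {X Y : C} (f : J.obj X ⟶ obj Y) : f ≅ unit X ≫ ext f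
  lan {X Y : C} (f : J.obj X ⟶ obj Y) {K : obj X ⟶ obj Y} (σ : f ⟶ unit X ≫ K) :
    ∃! τ : ext f ⟶ K, (eta f).hom ≫ unit X ◁ τ = σ
  lan_comp {X Y Z : C} (f : J.obj X ⟶ obj Y) (g : J.obj Y ⟶ obj Z) {K : obj X ⟶ obj Z}
    (σ : f ≫ ext g ⟶ unit X ≫ K) :
    ∃! τ : ext f ≫ ext g ⟶ K,
      (eta f).hom ▷ ext g ≫ (α_ (unit X) (ext f) (ext g)).hom ≫ unit X ◁ τ = σ
  lan_id {X : C} {K : obj X ⟶ obj X} (σ : unit X ⟶ unit X ≫ K) :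
    ∃! τ : 𝟙 (obj X) ⟶ K, (ρ_ (unit X)).inv ≫ unit X ◁ τ = σ

namespace LeftKanData

variable {C : Type u} [Bicategory.{w, v} C] {D : Type u'} [Bicategory.{w', v'} D]
  {J : Pseudofunctor C D} (T : LeftKanData J)

/-- The 2-cell out of the left extension `ext f` induced by `σ`. -/
noncomputable def desc {X Y : C} (f : J.obj X ⟶ T.obj Y) {K : T.obj X ⟶ T.obj Y}
    (σ : f ⟶ T.unit X ≫ K) : T.ext f ⟶ K := (T.lan f σ).choose

lemma fac {X Y : C} (f : J.obj X ⟶ T.obj Y) {K : T.obj X ⟶ T.obj Y}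
    (σ : f ⟶ T.unit X ≫ K) : (T.eta f).hom ≫ T.unit X ◁ T.desc f σ = σ :=
  (T.lan f σ).choose_spec.1

lemma hom_ext {X Y : C} {f : J.obj X ⟶ T.obj Y} {K : T.obj X ⟶ T.obj Y}
    {τ τ' : T.ext f ⟶ K}
    (h : (T.eta f).hom ≫ T.unit X ◁ τ = (T.eta f).hom ≫ T.unit X ◁ τ') : τ = τ' :=
  (T.lan f ((T.eta f).hom ≫ T.unit X ◁ τ')).unique h rfl

/-- The action of the extension on 2-cells. -/
noncomputable def extMap {X Y : C} {f f' : J.obj X ⟶ T.obj Y} (φ : f ⟶ f') :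
    T.ext f ⟶ T.ext f' := T.desc f (φ ≫ (T.eta f').hom)

lemma eta_natural {X Y : C} {f f' : J.obj X ⟶ T.obj Y} (φ : f ⟶ f') :
    φ ≫ (T.eta f').hom = (T.eta f).hom ≫ T.unit X ◁ T.extMap φ :=
  (T.fac f _).symm

/-- The extension functors of the relative pseudomonad. -/
noncomputable def extFunctor (X Y : C) : (J.obj X ⟶ T.obj Y) ⥤ (T.obj X ⟶ T.obj Y) where
  obj f := T.ext f
  map φ := T.extMap φ
  map_id f := T.hom_ext (by rw [← T.eta_natural]; simp)
  map_comp {f f' f''} φ ψ := T.hom_ext (by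
    rw [← T.eta_natural, whiskerLeft_comp, ← reassoc_of% T.eta_natural φ, ← T.eta_natural ψ,
      Category.assoc])

/-- The comparison `(g^* f)^* → g^* f^*`, induced by `eta f`. -/
noncomputable def muHom {X Y Z : C} (f : J.obj X ⟶ T.obj Y) (g : J.obj Y ⟶ T.obj Z) :
    T.ext (f ≫ T.ext g) ⟶ T.ext f ≫ T.ext g :=
  T.desc _ ((T.eta f).hom ▷ T.ext g ≫ (α_ (T.unit X) (T.ext f) (T.ext g)).hom)

lemma eta_mu {X Y Z : C} (f : J.obj X ⟶ T.obj Y) (g : J.obj Y ⟶ T.obj Z) :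
    (T.eta (f ≫ T.ext g)).hom ≫ T.unit X ◁ T.muHom f g =
      (T.eta f).hom ▷ T.ext g ≫ (α_ (T.unit X) (T.ext f) (T.ext g)).hom :=
  T.fac _ _

/-- The comparison `(g^* f)^* ≅ g^* f^*`; it is invertible since both sides are left extensions of
`f ≫ ext g`. -/
noncomputable def mu {X Y Z : C} (f : J.obj X ⟶ T.obj Y) (g : J.obj Y ⟶ T.obj Z) :
    T.ext (f ≫ T.ext g) ≅ T.ext f ≫ T.ext g where
  hom := T.muHom f g
  inv := (T.lan_comp f g (T.eta (f ≫ T.ext g)).hom).choose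
  hom_inv_id := T.hom_ext (by
    have h := (T.lan_comp f g (T.eta (f ≫ T.ext g)).hom).choose_spec.1
    rw [whiskerLeft_comp, ← Category.assoc, T.eta_mu, Category.assoc, h]
    simp)
  inv_hom_id := by
    have h := (T.lan_comp f g (T.eta (f ≫ T.ext g)).hom).choose_spec.1
    refine (T.lan_comp f g ((T.eta f).hom ▷ T.ext g ≫
      (α_ (T.unit X) (T.ext f) (T.ext g)).hom)).unique ?_ (by simp)
    rw [whiskerLeft_comp, reassoc_of% h, T.eta_mu]

/-- The comparison `i_X^* ≅ 1`; it is invertible since both sides are left extensions of `i_X`. -/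
noncomputable def theta (X : C) : T.ext (T.unit X) ≅ 𝟙 (T.obj X) where
  hom := T.desc _ (ρ_ (T.unit X)).inv
  inv := (T.lan_id (T.eta (T.unit X)).hom).choose
  hom_inv_id := T.hom_ext (by
    have h := (T.lan_id (T.eta (T.unit X)).hom).choose_spec.1
    rw [whiskerLeft_comp, ← Category.assoc, T.fac, h]
    simp)
  inv_hom_id := by
    have h := (T.lan_id (T.eta (T.unit X)).hom).choose_spec.1
    refine (T.lan_id ((ρ_ (T.unit X)).inv)).unique ?_ (by simp)
    rw [whiskerLeft_comp, reassoc_of% h, T.fac]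

lemma eta_theta (X : C) :
    (T.eta (T.unit X)).hom ≫ T.unit X ◁ (T.theta X).hom = (ρ_ (T.unit X)).inv :=
  T.fac _ _

lemma mu_natural {X Y Z : C} {f f' : J.obj X ⟶ T.obj Y} {g g' : J.obj Y ⟶ T.obj Z}
    (φ : f ⟶ f') (ψ : g ⟶ g') :
    T.extMap (φ ▷ T.ext g ≫ f' ◁ T.extMap ψ) ≫ T.muHom f' g' =
      T.muHom f g ≫ T.extMap φ ▷ T.ext g ≫ T.ext f' ◁ T.extMap ψ := T.hom_ext (by
  have h1 := T.eta_mu f g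
  have h2 := T.eta_mu f' g'
  have h3 := T.eta_natural (φ ▷ T.ext g ≫ f' ◁ T.extMap ψ)
  have h4 := congrArg (fun t => t ▷ T.ext g) (T.eta_natural φ)
  have h5 := whisker_exchange (T.eta f').hom (T.extMap ψ)
  simp only [comp_whiskerRight] at h4
  rw [whiskerLeft_comp, ← reassoc_of% h3, h2, whiskerLeft_comp, reassoc_of% h1]
  rw [reassoc_of% h5, reassoc_of% h4]
  simp)

lemma assoc_coh {X Y Z V : C} (f : J.obj X ⟶ T.obj Y) (g : J.obj Y ⟶ T.obj Z)
    (h : J.obj Z ⟶ T.obj V) :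
    T.extMap (f ◁ T.muHom g h) ≫ T.extMap (α_ f (T.ext g) (T.ext h)).inv ≫
        T.muHom (f ≫ T.ext g) h ≫ T.muHom f g ▷ T.ext h ≫
        (α_ (T.ext f) (T.ext g) (T.ext h)).hom =
      T.muHom f (g ≫ T.ext h) ≫ T.ext f ◁ T.muHom g h := T.hom_ext (by
  have h1 := T.eta_mu (f ≫ T.ext g) h
  have h2 := T.eta_mu f (g ≫ T.ext h)
  have h3 := T.eta_natural (f ◁ T.muHom g h)
  have h4 := T.eta_natural (α_ f (T.ext g) (T.ext h)).inv
  have h5 := congrArg (fun t => t ▷ T.ext h) (T.eta_mu f g)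
  have h6 := whisker_exchange (T.eta f).hom (T.muHom g h)
  simp only [comp_whiskerRight, whisker_assoc] at h5
  simp only [whiskerLeft_comp]
  rw [← reassoc_of% h3, ← reassoc_of% h4, reassoc_of% h1, reassoc_of% h2]
  have h7 := congr($h5 ≫ (α_ (T.unit X) (T.ext f ≫ T.ext g) (T.ext h)).hom ≫
    T.unit X ◁ (α_ (T.ext f) (T.ext g) (T.ext h)).hom)
  simp only [Category.assoc, Iso.inv_hom_id_assoc] at h7
  rw [h7]
  have h8 := congr($h6 ≫ (α_ (T.unit X) (T.ext f) (T.ext g ≫ T.ext h)).hom)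
  simp only [Category.assoc, comp_whiskerLeft, Iso.inv_hom_id, Category.comp_id] at h8
  rw [← h8]
  simp)

lemma unit_coh {X Y : C} (f : J.obj X ⟶ T.obj Y) :
    T.extMap (T.eta f).hom ≫ T.muHom (T.unit X) f ≫ (T.theta X).hom ▷ T.ext f =
      (λ_ (T.ext f)).inv := T.hom_ext (by
  have h1 := T.eta_natural (T.eta f).hom
  have h2 := T.eta_mu (T.unit X) f
  have h3 := congrArg (fun t => t ▷ T.ext f) (T.eta_theta X)
  simp only [comp_whiskerRight, whisker_assoc] at h3
  simp only [whiskerLeft_comp]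
  rw [← reassoc_of% h1, reassoc_of% h2]
  have h4 := congrArg (fun t => t ≫ (α_ (T.unit X) (𝟙 _) (T.ext f)).hom) h3
  simp at h4
  rw [h4])

/-- The relative pseudomonad whose 2-cells `mu`, `eta`, `theta` are the canonical comparisons. -/
noncomputable def toRelPseudomonad : RelPseudomonad J where
  obj := T.obj
  ext := T.extFunctor
  unit := T.unit
  mu := T.mu
  mu_natural φ ψ := T.mu_natural φ ψ
  eta := T.eta
  eta_natural := T.eta_natural
  theta := T.theta
  assoc_coh f g h := T.assoc_coh f g h
  unit_coh f := T.unit_coh f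

end LeftKanData

end Generic

section TwoMonads

open Bicategory
universe w v u
/-- A 2-monad on a strict bicategory (2-category) `D`: a 2-functor `S : D → D` with strictly
2-natural transformations `m : S S → S` and `e : 1 → S` that satisfy the monad laws strictly. -/
structure TwoMonad (D : Type u) [Bicategory.{w, v} D] [Strict D] extends
    StrictPseudofunctor D D where
  m (X : D) : obj (obj X) ⟶ obj X
  e (X : D) : X ⟶ obj X
  m_natural {X Y : D} (f : X ⟶ Y) : map (map f) ≫ m Y = m X ≫ map f
  m_natural₂ {X Y : D} {f g : X ⟶ Y} (η : f ⟶ g) :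
    map₂ (map₂ η) ▷ m Y =
      eqToHom (m_natural f) ≫ m X ◁ map₂ η ≫ eqToHom (m_natural g).symm
  e_natural {X Y : D} (f : X ⟶ Y) : f ≫ e Y = e X ≫ map f
  e_natural₂ {X Y : D} {f g : X ⟶ Y} (η : f ⟶ g) :
    η ▷ e Y = eqToHom (e_natural f) ≫ e X ◁ map₂ η ≫ eqToHom (e_natural g).symm
  assoc (X : D) : map (m X) ≫ m X = m (obj X) ≫ m X
  left_unit (X : D) : e (obj X) ≫ m X = 𝟙 (obj X)
  right_unit (X : D) : map (e X) ≫ m X = 𝟙 (obj X)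

variable {D : Type u} [Bicategory.{w, v} D] [Strict D] (S : TwoMonad D)

/-- The structure of a strict `S`-algebra on the object `X`. -/
structure StrictAlg (X : D) where
  str : S.obj X ⟶ X
  assoc : S.map str ≫ str = S.m X ≫ str
  unit : S.e X ≫ str = 𝟙 X

attribute [local simp] Strict.leftUnitor_eqToIso Strict.rightUnitor_eqToIso
  Strict.associator_eqToIso PrelaxFunctor.map₂_eqToHom

variable {S}

lemma pm_eq_unit {X Y : D} (A : StrictAlg S X) (B : StrictAlg S Y) (f : X ⟶ Y) :
    S.e X ≫ S.map f ≫ B.str = S.e X ≫ A.str ≫ f := by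
  rw [← Strict.assoc, ← S.e_natural, Strict.assoc, B.unit, ← Strict.assoc, A.unit,
    Strict.id_comp, Strict.comp_id]

lemma pm_eq_mul₁ {X Y : D} (B : StrictAlg S Y) (f : X ⟶ Y) :
    S.m X ≫ S.map f ≫ B.str = S.map (S.map f ≫ B.str) ≫ B.str := by
  rw [← Strict.assoc, ← S.m_natural, Strict.assoc, ← B.assoc, ← Strict.assoc, S.map_comp]

lemma pm_eq_mul₂ {X Y : D} (A : StrictAlg S X) (B : StrictAlg S Y) (f : X ⟶ Y) :
    S.map (A.str ≫ f) ≫ B.str = S.map A.str ≫ S.map f ≫ B.str := by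
  rw [S.map_comp, Strict.assoc]

lemma pm_eq_mul₃ {X Y : D} (A : StrictAlg S X) (f : X ⟶ Y) :
    S.map A.str ≫ A.str ≫ f = S.m X ≫ A.str ≫ f := by
  rw [← Strict.assoc, A.assoc, Strict.assoc]

/-- The structure of a pseudomorphism of strict algebras on `f : X ⟶ Y`: an invertible 2-cell
between `S f` followed by the structure map of `Y` and the structure map of `X` followed by `f`,
compatible with the unit and the multiplication of `S`. The `eqToHom`s are identity 2-cells
between 1-cells that are equal. -/
structure PsMorStr {X Y : D} (A : StrictAlg S X) (B : StrictAlg S Y) (f : X ⟶ Y) where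
  iso : S.map f ≫ B.str ≅ A.str ≫ f
  unit_coh : S.e X ◁ iso.hom = eqToHom (pm_eq_unit A B f)
  mul_coh : S.m X ◁ iso.hom =
    eqToHom (pm_eq_mul₁ B f) ≫ S.map₂ iso.hom ▷ B.str ≫ eqToHom (pm_eq_mul₂ A B f) ≫
      S.map A.str ◁ iso.hom ≫ eqToHom (pm_eq_mul₃ A f)

/-- The 2-cell `α` between (the underlying 1-cells of) two pseudomorphisms is an algebra 2-cell. -/
def IsAlg2Cell {X Y : D} {A : StrictAlg S X} {B : StrictAlg S Y} {f g : X ⟶ Y}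
    (F : PsMorStr A B f) (G : PsMorStr A B g) (α : f ⟶ g) : Prop :=
  S.map₂ α ▷ B.str ≫ G.iso.hom = F.iso.hom ≫ A.str ◁ α

namespace PsMorStr

lemma of_conj {E : Type*} [Category E] {a b c d : E} {x : b ⟶ c} {y : a ⟶ d} {p : a = b}
    {q : c = d} (h : y = eqToHom p ≫ x ≫ eqToHom q) :
    x = eqToHom p.symm ≫ y ≫ eqToHom q.symm := by
  subst p q; simpa using h.symm

lemma whiskerLeft_congr {X Y Z : D} {p q : X ⟶ Y} (h : p = q) {f g : Y ⟶ Z} (η : f ⟶ g) :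
    p ◁ η = eqToHom (by rw [h]) ≫ q ◁ η ≫ eqToHom (by rw [h]) := by
  subst h; simp

lemma map₂_whiskerLeft' {X Y Z : D} (f : X ⟶ Y) {g h : Y ⟶ Z} (η : g ⟶ h) :
    S.map₂ (f ◁ η) = eqToHom (S.map_comp f g) ≫ S.map f ◁ S.map₂ η ≫
      eqToHom (S.map_comp f h).symm := by
  simp [S.map₂_whisker_left, S.mapComp_eq_eqToIso]

lemma map₂_whiskerRight' {X Y Z : D} {f g : X ⟶ Y} (η : f ⟶ g) (h : Y ⟶ Z) :
    S.map₂ (η ▷ h) = eqToHom (S.map_comp f h) ≫ S.map₂ η ▷ S.map h ≫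
      eqToHom (S.map_comp g h).symm := by
  simp [S.map₂_whisker_right, S.mapComp_eq_eqToIso]

/-- The identity pseudomorphism. -/
def id {X : D} (A : StrictAlg S X) : PsMorStr A A (𝟙 X) where
  iso := eqToIso (by rw [S.map_id, Strict.id_comp, Strict.comp_id])
  unit_coh := by simp
  mul_coh := by simp

/-- The composite of two pseudomorphisms. -/
def comp {X Y Z : D} {A : StrictAlg S X} {B : StrictAlg S Y} {E : StrictAlg S Z}
    {f : X ⟶ Y} {g : Y ⟶ Z} (F : PsMorStr A B f) (G : PsMorStr B E g) :
    PsMorStr A E (f ≫ g) where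
  iso := eqToIso (by rw [S.map_comp, Strict.assoc]) ≪≫ whiskerLeftIso (S.map f) G.iso ≪≫
    (α_ (S.map f) B.str g).symm ≪≫ whiskerRightIso F.iso g ≪≫ α_ A.str f g
  unit_coh := by
    have h1 : S.e X ◁ S.map f ◁ G.iso.hom =
        eqToHom (by rw [← Strict.assoc, ← S.e_natural, Strict.assoc, pm_eq_unit B E g,
          ← Strict.assoc, S.e_natural, Strict.assoc]) := by
      have := comp_whiskerLeft (S.e X) (S.map f) G.iso.hom
      rw [whiskerLeft_congr (S.e_natural f).symm, comp_whiskerLeft, G.unit_coh] at this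
      simp only [Strict.associator_eqToIso, eqToIso.hom, eqToIso.inv, whiskerLeft_eqToHom,
        eqToHom_trans] at this
      simp [of_conj this]
    have h2 : S.e X ◁ F.iso.hom ▷ g = eqToHom (by rw [← Strict.assoc, pm_eq_unit A B f,
          Strict.assoc]) := by
      have := whisker_assoc (S.e X) F.iso.hom g
      rw [F.unit_coh] at this
      simp only [Strict.associator_eqToIso, eqToIso.hom, eqToIso.inv, eqToHom_whiskerRight] at this
      simp [of_conj this]
    simp [h1, h2]
  mul_coh := by
    have h1 : S.m X ◁ S.map f ◁ G.iso.hom =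
        eqToHom (by rw [← Strict.assoc, ← S.m_natural, Strict.assoc, pm_eq_mul₁]) ≫
          S.map (S.map f) ◁ S.map₂ G.iso.hom ▷ E.str ≫
          eqToHom (by rw [pm_eq_mul₂]) ≫
          S.map (S.map f) ◁ S.map B.str ◁ G.iso.hom ≫
          eqToHom (by
            rw [pm_eq_mul₃, ← Strict.assoc, S.m_natural, Strict.assoc]) := by
      have := comp_whiskerLeft (S.m X) (S.map f) G.iso.hom
      rw [whiskerLeft_congr (S.m_natural f).symm, comp_whiskerLeft, G.mul_coh] at this
      simp only [Strict.associator_eqToIso, eqToIso.hom, eqToIso.inv, whiskerLeft_eqToHom,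
        eqToHom_trans, eqToHom_trans_assoc, whiskerLeft_comp, Category.assoc] at this
      simp [of_conj this]
    have h2 : S.m X ◁ F.iso.hom ▷ g =
        eqToHom (by rw [← Strict.assoc, pm_eq_mul₁, Strict.assoc]) ≫
          S.map₂ F.iso.hom ▷ (B.str ≫ g) ≫
          eqToHom (by rw [← Strict.assoc, pm_eq_mul₂]; simp only [Strict.assoc]) ≫
          S.map A.str ◁ F.iso.hom ▷ g ≫
          eqToHom (by
            rw [← Strict.assoc, pm_eq_mul₃, Strict.assoc]) := by
      have := whisker_assoc (S.m X) F.iso.hom g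
      rw [F.mul_coh] at this
      simp only [Strict.associator_eqToIso, eqToIso.hom, eqToIso.inv, eqToHom_whiskerRight,
        comp_whiskerRight, Category.assoc, whisker_assoc] at this
      simp [of_conj this]
    have h3 := whisker_exchange (S.map₂ F.iso.hom) G.iso.hom
    have h4 : S.map (S.map f) ◁ S.map B.str ◁ G.iso.hom =
        eqToHom (by rw [S.map_comp, Strict.assoc]) ≫ S.map (S.map f ≫ B.str) ◁ G.iso.hom ≫
          eqToHom (by rw [S.map_comp, Strict.assoc]) := by
      rw [whiskerLeft_congr (S.map_comp (S.map f) B.str)]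
      simp
    have h5 : S.map A.str ◁ S.map f ◁ G.iso.hom =
        eqToHom (by rw [S.map_comp, Strict.assoc]) ≫ S.map (A.str ≫ f) ◁ G.iso.hom ≫
          eqToHom (by rw [S.map_comp, Strict.assoc]) := by
      rw [whiskerLeft_congr (S.map_comp A.str f)]
      simp
    have h7 : S.map₂ F.iso.hom ▷ S.map g ▷ E.str =
        eqToHom (by rw [Strict.assoc]) ≫ S.map₂ F.iso.hom ▷ (S.map g ≫ E.str) ≫
          eqToHom (by rw [Strict.assoc]) := by simp
    simp [-whiskerRight_comp, S.mapComp_eq_eqToIso, h1, h2, h4, h5, h7]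
    rw [reassoc_of% h3]

end PsMorStr

/-- A pseudomorphism of strict algebras. -/
structure PsMor {X Y : D} (A : StrictAlg S X) (B : StrictAlg S Y) where
  hom : X ⟶ Y
  str : PsMorStr A B hom

namespace PsMor

/-- Algebra 2-cells between pseudomorphisms. -/
@[ext]
structure Cell {X Y : D} {A : StrictAlg S X} {B : StrictAlg S Y} (F G : PsMor A B) where
  cell : F.hom ⟶ G.hom
  isCell : IsAlg2Cell F.str G.str cell

/-- The category of pseudomorphisms and algebra 2-cells. -/
instance {X Y : D} (A : StrictAlg S X) (B : StrictAlg S Y) : Category (PsMor A B) where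
  Hom F G := Cell F G
  id F := ⟨𝟙 F.hom, by simp [IsAlg2Cell]⟩
  comp α β := ⟨α.cell ≫ β.cell, by
    have h1 := α.isCell
    have h2 := β.isCell
    simp only [IsAlg2Cell] at h1 h2 ⊢
    simp [h2, reassoc_of% h1]⟩
  id_comp α := Cell.ext (Category.id_comp α.cell)
  comp_id α := Cell.ext (Category.comp_id α.cell)
  assoc α β γ := Cell.ext (Category.assoc α.cell β.cell γ.cell)

/-- Restriction along a pseudomorphism `U`. -/
def precomp {X Y Z : D} {A : StrictAlg S X} {B : StrictAlg S Y} {E : StrictAlg S Z}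
    (U : PsMor A B) : PsMor B E ⥤ PsMor A E where
  obj G := ⟨U.hom ≫ G.hom, U.str.comp G.str⟩
  map {G G'} α := ⟨U.hom ◁ α.cell, by
    have h1 := α.isCell
    simp only [IsAlg2Cell] at h1 ⊢
    have h2 : S.map U.hom ◁ S.map₂ α.cell ▷ E.str ≫ S.map U.hom ◁ G'.str.iso.hom =
      S.map U.hom ◁ G.str.iso.hom ≫ S.map U.hom ◁ B.str ◁ α.cell := by
      rw [← whiskerLeft_comp, h1, whiskerLeft_comp]
    simp [PsMorStr.comp, S.mapComp_eq_eqToIso]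
    rw [reassoc_of% h2]
    have h3 := whisker_exchange U.str.iso.hom α.cell
    simp only [comp_whiskerLeft, Strict.associator_eqToIso, eqToIso.hom, eqToIso.inv,
      Category.assoc] at h3
    have h4 := congrArg
      (fun t => eqToHom (Strict.assoc (S.map U.hom) B.str G.hom).symm ≫ t) h3
    simp only [eqToHom_trans_assoc, eqToHom_refl, Category.id_comp] at h4
    rw [reassoc_of% h4]
    simp⟩
  map_id G := Cell.ext (whiskerLeft_id U.hom G.hom)
  map_comp α β := Cell.ext (whiskerLeft_comp U.hom α.cell β.cell)

end PsMor

/-- A lifting of the relative pseudomonad `T` to strict `S`-algebras: a strict algebra structure on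
`T X` for every strict algebra structure on `J X`, a pseudomorphism structure on `f^*` for every
pseudomorphism `f`, and a pseudomorphism structure on every unit, such that the 2-cells `mu`,
`eta`, `theta` are algebra 2-cells. The extension also takes algebra 2-cells to algebra 2-cells,
so that it is a functor on the categories of pseudomorphisms. -/
structure Lifting {C : Type*} [Bicategory C] {J : Pseudofunctor C D} (T : RelPseudomonad J)
    (S : TwoMonad D) where
  alg {X : C} (A : StrictAlg S (J.obj X)) : StrictAlg S (T.obj X)
  extStr {X Y : C} {A : StrictAlg S (J.obj X)} {B : StrictAlg S (J.obj Y)}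
    {f : J.obj X ⟶ T.obj Y} (F : PsMorStr A (alg B) f) :
    PsMorStr (alg A) (alg B) ((T.ext X Y).obj f)
  unitStr {X : C} (A : StrictAlg S (J.obj X)) : PsMorStr A (alg A) (T.unit X)
  extStr_map {X Y : C} {A : StrictAlg S (J.obj X)} {B : StrictAlg S (J.obj Y)}
    {f f' : J.obj X ⟶ T.obj Y} (F : PsMorStr A (alg B) f) (F' : PsMorStr A (alg B) f')
    (α : f ⟶ f') (hα : IsAlg2Cell F F' α) :
    IsAlg2Cell (extStr F) (extStr F') ((T.ext X Y).map α)
  mu_cell {X Y Z : C} {A : StrictAlg S (J.obj X)} {B : StrictAlg S (J.obj Y)}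
    {E : StrictAlg S (J.obj Z)} {f : J.obj X ⟶ T.obj Y} {g : J.obj Y ⟶ T.obj Z}
    (F : PsMorStr A (alg B) f) (G : PsMorStr B (alg E) g) :
    IsAlg2Cell (extStr (F.comp (extStr G))) ((extStr F).comp (extStr G)) (T.mu f g).hom
  eta_cell {X Y : C} {A : StrictAlg S (J.obj X)} {B : StrictAlg S (J.obj Y)}
    {f : J.obj X ⟶ T.obj Y} (F : PsMorStr A (alg B) f) :
    IsAlg2Cell F ((unitStr A).comp (extStr F)) (T.eta f).hom
  theta_cell {X : C} (A : StrictAlg S (J.obj X)) :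
    IsAlg2Cell (extStr (unitStr A)) (PsMorStr.id (alg A)) (T.theta X).hom

end TwoMonads

section FreeCat
open MonoidalCategory Limits
universe v u v' u'

/-- The four kinds of monoidal categories considered here: with or without a symmetry, and with or
without the condition that the unit object be terminal. -/
structure Variant where
  symmetric : Bool
  terminalUnit : Bool

/-- A monoidal category of the given kind: it is equipped with a symmetry if `κ.symmetric`, and its
unit object is terminal if `κ.terminalUnit`. -/
class VMonoidal (κ : Variant) (D : Type u) [Category.{v} D] extends MonoidalCategory D where
  symm (h : κ.symmetric = true) : SymmetricCategory D
  term (h : κ.terminalUnit = true) : IsTerminal (𝟙_ D)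

/-- Formal tensor products of objects of `C`. -/
inductive FreeMon (κ : Variant) (C : Type u) : Type u
  | of (x : C) : FreeMon κ C
  | unit : FreeMon κ C
  | tensor (X Y : FreeMon κ C) : FreeMon κ C

/-- Formal morphisms, generated by the morphisms of `C` and the structure morphisms of a monoidal
category of kind `κ`. -/
inductive FreeHom (κ : Variant) (C : Type u) [Category.{v} C] :
    FreeMon κ C → FreeMon κ C → Type (max u v)
  | of {x y : C} (f : x ⟶ y) : FreeHom κ C (.of x) (.of y)
  | id (X : FreeMon κ C) : FreeHom κ C X X
  | comp {X Y Z : FreeMon κ C} (f : FreeHom κ C X Y) (g : FreeHom κ C Y Z) : FreeHom κ C X Z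
  | tensor {X X' Y Y' : FreeMon κ C} (f : FreeHom κ C X X') (g : FreeHom κ C Y Y') :
      FreeHom κ C (.tensor X Y) (.tensor X' Y')
  | assocHom (X Y Z : FreeMon κ C) :
      FreeHom κ C (.tensor (.tensor X Y) Z) (.tensor X (.tensor Y Z))
  | assocInv (X Y Z : FreeMon κ C) :
      FreeHom κ C (.tensor X (.tensor Y Z)) (.tensor (.tensor X Y) Z)
  | leftHom (X : FreeMon κ C) : FreeHom κ C (.tensor .unit X) X
  | leftInv (X : FreeMon κ C) : FreeHom κ C X (.tensor .unit X)
  | rightHom (X : FreeMon κ C) : FreeHom κ C (.tensor X .unit) X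
  | rightInv (X : FreeMon κ C) : FreeHom κ C X (.tensor X .unit)
  | braid (h : κ.symmetric = true) (X Y : FreeMon κ C) : FreeHom κ C (.tensor X Y) (.tensor Y X)
  | toUnit (h : κ.terminalUnit = true) (X : FreeMon κ C) : FreeHom κ C X .unit

/-- The congruence on formal morphisms generated by the axioms of a monoidal category of kind `κ`
and by the requirement that the inclusion of `C` be a functor. -/
inductive FreeRel (κ : Variant) (C : Type u) [Category.{v} C] :
    ∀ {X Y : FreeMon κ C}, FreeHom κ C X Y → FreeHom κ C X Y → Prop
  | refl {X Y} (f : FreeHom κ C X Y) : FreeRel κ C f f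
  | symm {X Y} {f g : FreeHom κ C X Y} : FreeRel κ C f g → FreeRel κ C g f
  | trans {X Y} {f g h : FreeHom κ C X Y} :
      FreeRel κ C f g → FreeRel κ C g h → FreeRel κ C f h
  | comp {X Y Z} {f f' : FreeHom κ C X Y} {g g' : FreeHom κ C Y Z} :
      FreeRel κ C f f' → FreeRel κ C g g' → FreeRel κ C (f.comp g) (f'.comp g')
  | tensor {X X' Y Y'} {f f' : FreeHom κ C X X'} {g g' : FreeHom κ C Y Y'} :
      FreeRel κ C f f' → FreeRel κ C g g' → FreeRel κ C (f.tensor g) (f'.tensor g')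
  -- the axioms of a category
  | id_comp {X Y} (f : FreeHom κ C X Y) : FreeRel κ C ((FreeHom.id X).comp f) f
  | comp_id {X Y} (f : FreeHom κ C X Y) : FreeRel κ C (f.comp (FreeHom.id Y)) f
  | assoc {X Y Z W} (f : FreeHom κ C X Y) (g : FreeHom κ C Y Z) (h : FreeHom κ C Z W) :
      FreeRel κ C ((f.comp g).comp h) (f.comp (g.comp h))
  -- the inclusion of `C` is a functor
  | of_id (x : C) : FreeRel κ C (FreeHom.of (𝟙 x)) (FreeHom.id (.of x))
  | of_comp {x y z : C} (f : x ⟶ y) (g : y ⟶ z) :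
      FreeRel κ C (FreeHom.of (f ≫ g)) ((FreeHom.of f).comp (FreeHom.of g))
  -- the tensor product is a functor
  | tensor_id (X Y) :
      FreeRel κ C ((FreeHom.id X).tensor (FreeHom.id Y)) (FreeHom.id (.tensor X Y))
  | tensor_comp {X X' X'' Y Y' Y''} (f : FreeHom κ C X X') (f' : FreeHom κ C X' X'')
      (g : FreeHom κ C Y Y') (g' : FreeHom κ C Y' Y'') :
      FreeRel κ C ((f.comp f').tensor (g.comp g')) ((f.tensor g).comp (f'.tensor g'))
  -- the associator and the unitors are natural isomorphisms
  | assoc_hom_inv (X Y Z) :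
      FreeRel κ C ((FreeHom.assocHom X Y Z).comp (FreeHom.assocInv X Y Z)) (FreeHom.id _)
  | assoc_inv_hom (X Y Z) :
      FreeRel κ C ((FreeHom.assocInv X Y Z).comp (FreeHom.assocHom X Y Z)) (FreeHom.id _)
  | assoc_natural {X X' Y Y' Z Z'} (f : FreeHom κ C X X') (g : FreeHom κ C Y Y')
      (h : FreeHom κ C Z Z') :
      FreeRel κ C (((f.tensor g).tensor h).comp (FreeHom.assocHom X' Y' Z'))
        ((FreeHom.assocHom X Y Z).comp (f.tensor (g.tensor h)))
  | left_hom_inv (X) :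
      FreeRel κ C ((FreeHom.leftHom X).comp (FreeHom.leftInv X)) (FreeHom.id _)
  | left_inv_hom (X) :
      FreeRel κ C ((FreeHom.leftInv X).comp (FreeHom.leftHom X)) (FreeHom.id _)
  | left_natural {X X'} (f : FreeHom κ C X X') :
      FreeRel κ C (((FreeHom.id .unit).tensor f).comp (FreeHom.leftHom X'))
        ((FreeHom.leftHom X).comp f)
  | right_hom_inv (X) :
      FreeRel κ C ((FreeHom.rightHom X).comp (FreeHom.rightInv X)) (FreeHom.id _)
  | right_inv_hom (X) :
      FreeRel κ C ((FreeHom.rightInv X).comp (FreeHom.rightHom X)) (FreeHom.id _)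
  | right_natural {X X'} (f : FreeHom κ C X X') :
      FreeRel κ C ((f.tensor (FreeHom.id .unit)).comp (FreeHom.rightHom X'))
        ((FreeHom.rightHom X).comp f)
  -- the pentagon and triangle axioms
  | pentagon (W X Y Z) :
      FreeRel κ C
        (((FreeHom.assocHom W X Y).tensor (FreeHom.id Z)).comp
          ((FreeHom.assocHom W (.tensor X Y) Z).comp
            ((FreeHom.id W).tensor (FreeHom.assocHom X Y Z))))
        ((FreeHom.assocHom (.tensor W X) Y Z).comp (FreeHom.assocHom W X (.tensor Y Z)))
  | triangle (X Y) :
      FreeRel κ C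
        ((FreeHom.assocHom X .unit Y).comp ((FreeHom.id X).tensor (FreeHom.leftHom Y)))
        ((FreeHom.rightHom X).tensor (FreeHom.id Y))
  -- in the symmetric variants: the symmetry, with its naturality, involutivity and hexagon
  | braid_natural (h : κ.symmetric = true) {X X' Y Y'} (f : FreeHom κ C X X')
      (g : FreeHom κ C Y Y') :
      FreeRel κ C ((f.tensor g).comp (FreeHom.braid h X' Y'))
        ((FreeHom.braid h X Y).comp (g.tensor f))
  | braid_braid (h : κ.symmetric = true) (X Y) :
      FreeRel κ C ((FreeHom.braid h X Y).comp (FreeHom.braid h Y X)) (FreeHom.id _)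
  | hexagon (h : κ.symmetric = true) (X Y Z) :
      FreeRel κ C
        ((FreeHom.assocHom X Y Z).comp
          ((FreeHom.braid h X (.tensor Y Z)).comp (FreeHom.assocHom Y Z X)))
        (((FreeHom.braid h X Y).tensor (FreeHom.id Z)).comp
          ((FreeHom.assocHom Y X Z).comp ((FreeHom.id Y).tensor (FreeHom.braid h X Z))))
  -- in the variants with terminal unit: every morphism to the unit is the canonical one
  | toUnit_unique (h : κ.terminalUnit = true) {X} (f : FreeHom κ C X .unit) :
      FreeRel κ C f (FreeHom.toUnit h X)

variable {κ : Variant} {C : Type u} [Category.{v} C]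


/-- The free monoidal category of kind `κ` on `C`, by generators and relations. -/
instance : Category.{max u v} (FreeMon κ C) where
  Hom X Y := Quot (FreeRel κ C (X := X) (Y := Y))
  id X := Quot.mk _ (FreeHom.id X)
  comp := Quot.map₂ FreeHom.comp (fun f _ _ h => FreeRel.comp (FreeRel.refl f) h)
    (fun _ _ g h => FreeRel.comp h (FreeRel.refl g))
  id_comp := by rintro X Y ⟨f⟩; exact Quot.sound (FreeRel.id_comp f)
  comp_id := by rintro X Y ⟨f⟩; exact Quot.sound (FreeRel.comp_id f)
  assoc := by rintro X Y Z W ⟨f⟩ ⟨g⟩ ⟨h⟩; exact Quot.sound (FreeRel.assoc f g h)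

namespace FreeMon

/-- The morphism represented by a formal morphism. -/
def homMk {X Y : FreeMon κ C} (f : FreeHom κ C X Y) :
    X ⟶ Y := Quot.mk _ f

lemma homMk_sound {X Y : FreeMon κ C} {f g : FreeHom κ C X Y} (h : FreeRel κ C f g) :
    homMk f = homMk g := Quot.sound h

variable (κ C) in
/-- The inclusion of the generators. -/
def incl : C ⥤ FreeMon κ C where
  obj x := FreeMon.of x
  map f := homMk (FreeHom.of f)
  map_id x := homMk_sound (FreeRel.of_id x)
  map_comp f g := homMk_sound (FreeRel.of_comp f g)

/-- The tensor product of morphisms. -/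
def tensorMap {X X' Y Y' : FreeMon κ C} (f : X ⟶ X')
    (g : Y ⟶ Y') :
    FreeMon.tensor X Y ⟶ FreeMon.tensor X' Y' :=
  Quot.map₂ FreeHom.tensor (fun f _ _ h => FreeRel.tensor (FreeRel.refl f) h)
    (fun _ _ g h => FreeRel.tensor h (FreeRel.refl g)) f g

instance : MonoidalCategoryStruct (FreeMon κ C) where
  tensorObj X Y := FreeMon.tensor X Y
  tensorUnit := FreeMon.unit
  tensorHom f g := tensorMap f g
  whiskerLeft X _ _ f := tensorMap (homMk (FreeHom.id X)) f
  whiskerRight f Y := tensorMap f (homMk (FreeHom.id Y))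
  associator X Y Z := ⟨homMk (.assocHom X Y Z), homMk (.assocInv X Y Z),
    homMk_sound (FreeRel.assoc_hom_inv X Y Z), homMk_sound (FreeRel.assoc_inv_hom X Y Z)⟩
  leftUnitor X := ⟨homMk (.leftHom X), homMk (.leftInv X),
    homMk_sound (FreeRel.left_hom_inv X), homMk_sound (FreeRel.left_inv_hom X)⟩
  rightUnitor X := ⟨homMk (.rightHom X), homMk (.rightInv X),
    homMk_sound (FreeRel.right_hom_inv X), homMk_sound (FreeRel.right_inv_hom X)⟩

instance : MonoidalCategory (FreeMon κ C) := MonoidalCategory.ofTensorHom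
  (id_tensorHom_id := fun X Y => homMk_sound (FreeRel.tensor_id X Y))
  (id_tensorHom := fun _ _ _ _ => rfl)
  (tensorHom_id := fun _ _ => rfl)
  (tensorHom_comp_tensorHom := by
    rintro X₁ Y₁ Z₁ X₂ Y₂ Z₂ ⟨f₁⟩ ⟨f₂⟩ ⟨g₁⟩ ⟨g₂⟩
    exact homMk_sound (FreeRel.symm (FreeRel.tensor_comp f₁ g₁ f₂ g₂)))
  (associator_naturality := by
    rintro X₁ X₂ X₃ Y₁ Y₂ Y₃ ⟨f⟩ ⟨g⟩ ⟨h⟩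
    exact homMk_sound (FreeRel.assoc_natural f g h))
  (leftUnitor_naturality := by
    rintro X Y ⟨f⟩
    exact homMk_sound (FreeRel.left_natural f))
  (rightUnitor_naturality := by
    rintro X Y ⟨f⟩
    exact homMk_sound (FreeRel.right_natural f))
  (pentagon := fun W X Y Z => homMk_sound (FreeRel.pentagon W X Y Z))
  (triangle := fun X Y => homMk_sound (FreeRel.triangle X Y))

/-- The symmetry of the free symmetric monoidal category. -/
def braiding (h : κ.symmetric = true) (X Y : FreeMon κ C) : X ⊗ Y ≅ Y ⊗ X :=
  ⟨homMk (.braid h X Y), homMk (.braid h Y X),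
    homMk_sound (.braid_braid h X Y), homMk_sound (.braid_braid h Y X)⟩

/-- The symmetric monoidal structure, for the symmetric kinds. -/
abbrev symmetricCategory (h : κ.symmetric = true) : SymmetricCategory (FreeMon κ C) where
  braiding X Y := braiding h X Y
  braiding_naturality_right := by
    rintro X Y Z ⟨f⟩; exact homMk_sound (.braid_natural h (.id X) f)
  braiding_naturality_left := by
    rintro X Y ⟨f⟩ Z; exact homMk_sound (.braid_natural h f (.id Z))
  hexagon_forward X Y Z := homMk_sound (.hexagon h X Y Z)
  hexagon_reverse X Y Z := by
    have key : α_ Z X Y ≪≫ braiding h Z (X ⊗ Y) ≪≫ α_ X Y Z =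
        whiskerRightIso (braiding h Z X) Y ≪≫ α_ X Z Y ≪≫ whiskerLeftIso X (braiding h Z Y) :=
      Iso.ext (homMk_sound (.hexagon h Z X Y))
    have h1 := congrArg Iso.inv key
    simp only [Iso.trans_inv, Category.assoc] at h1
    exact h1
  symmetry X Y := homMk_sound (.braid_braid h X Y)

instance : VMonoidal κ (FreeMon κ C) where
  symm h := symmetricCategory h
  term h := IsTerminal.ofUniqueHom (fun X => homMk (.toUnit h X))
    (by rintro X ⟨f⟩; exact homMk_sound (.toUnit_unique h f))

section Lift

variable {D : Type u'} [Category.{v'} D] [VMonoidal κ D]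

variable (κ) in
/-- The extension of a function on generating objects to formal tensor products. -/
def liftObj (F : C → D) : FreeMon κ C → D
  | .of x => F x
  | .unit => 𝟙_ D
  | .tensor X Y => liftObj F X ⊗ liftObj F Y

variable (F : C ⥤ D)

/-- The extension of `F` to formal morphisms. -/
def liftHom : ∀ {X Y : FreeMon κ C}, FreeHom κ C X Y → (liftObj κ F.obj X ⟶ liftObj κ F.obj Y)
  | _, _, .of f => F.map f
  | _, _, .id _ => 𝟙 _
  | _, _, .comp f g => liftHom f ≫ liftHom g
  | _, _, .tensor f g => liftHom f ⊗ₘ liftHom g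
  | _, _, .assocHom _ _ _ => (α_ _ _ _).hom
  | _, _, .assocInv _ _ _ => (α_ _ _ _).inv
  | _, _, .leftHom _ => (λ_ _).hom
  | _, _, .leftInv _ => (λ_ _).inv
  | _, _, .rightHom _ => (ρ_ _).hom
  | _, _, .rightInv _ => (ρ_ _).inv
  | _, _, .braid h X Y => ((VMonoidal.symm h).braiding (liftObj κ F.obj X) (liftObj κ F.obj Y)).hom
  | _, _, .toUnit h _ => (VMonoidal.term h).from _

lemma liftHom_rel {X Y : FreeMon κ C} {f g : FreeHom κ C X Y} (r : FreeRel κ C f g) :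
    liftHom F f = liftHom F g := by
  induction r with
  | refl f => rfl
  | symm _ ih => exact ih.symm
  | trans _ _ ih ih' => exact ih.trans ih'
  | comp _ _ ih ih' => exact congr($ih ≫ $ih')
  | tensor _ _ ih ih' => exact congr($ih ⊗ₘ $ih')
  | pentagon => simp [liftHom, liftObj]
  | triangle => simp [liftHom, liftObj]
  | hexagon h X Y Z =>
    let _ : SymmetricCategory D := VMonoidal.symm h
    have := BraidedCategory.hexagon_forward (liftObj κ F.obj X) (liftObj κ F.obj Y)
      (liftObj κ F.obj Z)
    rw [← tensorHom_id, ← id_tensorHom] at this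
    exact this
  | braid_natural h f g =>
    let _ : SymmetricCategory D := VMonoidal.symm h
    exact BraidedCategory.braiding_naturality (liftHom F f) (liftHom F g)
  | braid_braid h X Y =>
    exact (VMonoidal.symm h : SymmetricCategory D).symmetry _ _
  | toUnit_unique h f => exact (VMonoidal.term h).hom_ext _ _
  | tensor_comp f f' g g' =>
    exact (tensorHom_comp_tensorHom (liftHom F f) (liftHom F g) (liftHom F f') (liftHom F g')).symm
  | assoc_natural f g h =>
    exact associator_naturality (liftHom F f) (liftHom F g) (liftHom F h)
  | left_natural f => 
    have := leftUnitor_naturality (liftHom F f)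
    rw [← id_tensorHom] at this
    exact this
  | right_natural f => 
    have := rightUnitor_naturality (liftHom F f)
    rw [← tensorHom_id] at this
    exact this
  | _ => simp [liftHom, liftObj]

/-- The universal property of the free monoidal category of kind `κ`: the strict structure
preserving functor `FreeMon κ C ⥤ D` that extends `F : C ⥤ D`. -/
def lift : FreeMon κ C ⥤ D where
  obj := liftObj κ F.obj
  map := Quot.lift (liftHom F) (fun _ _ r => liftHom_rel F r)
  map_id _ := rfl
  map_comp := by rintro X Y Z ⟨f⟩ ⟨g⟩; rfl

lemma lift_map_tensorMap {X X' Y Y' : FreeMon κ C} (f : X ⟶ X') (g : Y ⟶ Y') :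
    (lift F).map (tensorMap f g) = (lift F).map f ⊗ₘ (lift F).map g := by
  obtain ⟨f⟩ := f
  obtain ⟨g⟩ := g
  rfl

lemma incl_lift : incl κ C ⋙ lift (κ := κ) F = F := rfl

/-- The components of `liftNat`. -/
def liftNatApp {F G : C ⥤ D} (τ : F ⟶ G) : ∀ X : FreeMon κ C, (lift F).obj X ⟶ (lift G).obj X
  | .of x => τ.app x
  | .unit => 𝟙 (𝟙_ D)
  | .tensor X Y => liftNatApp τ X ⊗ₘ liftNatApp τ Y

lemma liftNat_naturality {F G : C ⥤ D} (τ : F ⟶ G) {X Y : FreeMon κ C} (f : FreeHom κ C X Y) :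
    (lift F).map (homMk f) ≫ liftNatApp τ Y = liftNatApp τ X ≫ (lift G).map (homMk f) := by
  induction f with
  | of f => exact τ.naturality f
  | id X => exact (Category.id_comp _).trans (Category.comp_id _).symm
  | @comp X Y Z f g ihf ihg =>
    change ((lift F).map (homMk f) ≫ (lift F).map (homMk g)) ≫ _ =
      _ ≫ (lift G).map (homMk f) ≫ (lift G).map (homMk g)
    rw [Category.assoc, ihg, reassoc_of% ihf]
  | @tensor X X' Y Y' f g ihf ihg =>
    change ((lift F).map (homMk f) ⊗ₘ (lift F).map (homMk g)) ≫
      (liftNatApp τ _ ⊗ₘ liftNatApp τ _) = (liftNatApp τ _ ⊗ₘ liftNatApp τ _) ≫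
      ((lift G).map (homMk f) ⊗ₘ (lift G).map (homMk g))
    rw [tensorHom_comp_tensorHom, tensorHom_comp_tensorHom, ihf, ihg]
  | assocHom X Y Z => exact (associator_naturality (liftNatApp τ X) (liftNatApp τ Y)
      (liftNatApp τ Z)).symm
  | assocInv X Y Z => exact (associator_inv_naturality (liftNatApp τ X) (liftNatApp τ Y)
      (liftNatApp τ Z)).symm
  | leftHom X =>
    exact (leftUnitor_naturality (liftNatApp τ X)).symm.trans (by rw [← id_tensorHom]; rfl)
  | leftInv X =>
    have h := (leftUnitor_inv_naturality (liftNatApp τ X)).symm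
    rw [← id_tensorHom] at h
    exact h
  | rightHom X =>
    exact (rightUnitor_naturality (liftNatApp τ X)).symm.trans (by rw [← tensorHom_id]; rfl)
  | rightInv X =>
    have h := (rightUnitor_inv_naturality (liftNatApp τ X)).symm
    rw [← tensorHom_id] at h
    exact h
  | braid h X Y =>
    let _ : SymmetricCategory D := VMonoidal.symm h
    exact (BraidedCategory.braiding_naturality (liftNatApp τ X) (liftNatApp τ Y)).symm
  | toUnit h X => exact (VMonoidal.term h).hom_ext _ _

/-- The monoidal natural transformation that extends `τ : F ⟶ G`. -/
def liftNat {F G : C ⥤ D} (τ : F ⟶ G) : lift (κ := κ) F ⟶ lift G where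
  app := liftNatApp τ
  naturality := by rintro X Y ⟨f⟩; exact liftNat_naturality τ f

lemma liftNat_id (F : C ⥤ D) : liftNat (κ := κ) (𝟙 F) = 𝟙 (lift F) := by
  ext X
  induction X with
  | of x => rfl
  | unit => rfl
  | tensor X Y ihX ihY =>
    change ((liftNat (𝟙 F)).app X ⊗ₘ (liftNat (𝟙 F)).app Y) = 𝟙 ((lift F).obj X ⊗ (lift F).obj Y)
    rw [ihX, ihY]
    exact id_tensorHom_id _ _

lemma liftNat_comp {F G H : C ⥤ D} (σ : F ⟶ G) (τ : G ⟶ H) :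
    liftNat (κ := κ) (σ ≫ τ) = liftNat σ ≫ liftNat τ := by
  ext X
  induction X with
  | of x => rfl
  | unit => exact (Category.comp_id (𝟙 (𝟙_ D))).symm
  | tensor X Y ihX ihY =>
    change ((liftNat (σ ≫ τ)).app X ⊗ₘ (liftNat (σ ≫ τ)).app Y) =
      ((liftNat σ).app X ⊗ₘ (liftNat σ).app Y) ≫ ((liftNat τ).app X ⊗ₘ (liftNat τ).app Y)
    rw [ihX, ihY]
    exact (tensorHom_comp_tensorHom _ _ _ _).symm

end Lift

section Laws

variable {E : Type u'} [Category.{v'} E]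

lemma heq_comp {X X' Y Y' Z Z' : E} (hX : X = X') (hY : Y = Y') (hZ : Z = Z')
    {f : X ⟶ Y} {f' : X' ⟶ Y'} {g : Y ⟶ Z} {g' : Y' ⟶ Z'} (hf : HEq f f') (hg : HEq g g') :
    HEq (f ≫ g) (f' ≫ g') := by
  subst hX hY hZ; cases hf; cases hg; rfl

lemma heq_id {X X' : E} (hX : X = X') : HEq (𝟙 X) (𝟙 X') := by
  subst hX; rfl

lemma heq_tensor [MonoidalCategory E] {X X' Y Y' Z Z' W W' : E} (hX : X = X') (hY : Y = Y')
    (hZ : Z = Z') (hW : W = W') {f : X ⟶ Y} {f' : X' ⟶ Y'} {g : Z ⟶ W} {g' : Z' ⟶ W'}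
    (hf : HEq f f') (hg : HEq g g') : HEq (f ⊗ₘ g) (f' ⊗ₘ g') := by
  subst hX hY hZ hW; cases hf; cases hg; rfl

variable [VMonoidal κ E]

/-- A functor out of the free category that preserves all the structure on the nose. -/
structure IsStrict (H : FreeMon κ C ⥤ E) : Prop where
  obj_unit : H.obj .unit = 𝟙_ E
  obj_tensor (X Y : FreeMon κ C) : H.obj (X.tensor Y) = H.obj X ⊗ H.obj Y
  tensor {X X' Y Y' : FreeMon κ C} (f : FreeHom κ C X X') (g : FreeHom κ C Y Y') :
    HEq (H.map (homMk (f.tensor g))) (H.map (homMk f) ⊗ₘ H.map (homMk g))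
  assocHom (X Y Z : FreeMon κ C) :
    HEq (H.map (homMk (.assocHom X Y Z))) (α_ (H.obj X) (H.obj Y) (H.obj Z)).hom
  assocInv (X Y Z : FreeMon κ C) :
    HEq (H.map (homMk (.assocInv X Y Z))) (α_ (H.obj X) (H.obj Y) (H.obj Z)).inv
  leftHom (X : FreeMon κ C) : HEq (H.map (homMk (.leftHom X))) (λ_ (H.obj X)).hom
  leftInv (X : FreeMon κ C) : HEq (H.map (homMk (.leftInv X))) (λ_ (H.obj X)).inv
  rightHom (X : FreeMon κ C) : HEq (H.map (homMk (.rightHom X))) (ρ_ (H.obj X)).hom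
  rightInv (X : FreeMon κ C) : HEq (H.map (homMk (.rightInv X))) (ρ_ (H.obj X)).inv
  braid (h : κ.symmetric = true) (X Y : FreeMon κ C) :
    HEq (H.map (homMk (.braid h X Y)))
      ((VMonoidal.symm (D := E) h).braiding (H.obj X) (H.obj Y)).hom
  toUnit (h : κ.terminalUnit = true) (X : FreeMon κ C) :
    HEq (H.map (homMk (.toUnit h X))) ((VMonoidal.term (D := E) h).from (H.obj X))

lemma IsStrict.hom_ext {H K : FreeMon κ C ⥤ E} (hH : IsStrict H) (hK : IsStrict K)
    (h : incl κ C ⋙ H = incl κ C ⋙ K) : H = K := by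
  have ho (X : FreeMon κ C) : H.obj X = K.obj X := by
    induction X with
    | of x => exact Functor.congr_obj h x
    | unit => exact hH.obj_unit.trans hK.obj_unit.symm
    | tensor X Y ihX ihY => rw [hH.obj_tensor, hK.obj_tensor, ihX, ihY]
  suffices hm : ∀ {X Y : FreeMon κ C} (f : FreeHom κ C X Y),
      HEq (H.map (homMk f)) (K.map (homMk f)) by
    refine Functor.hext ho ?_
    rintro X Y ⟨f⟩
    exact hm f
  intro X Y f
  induction f with
  | @of x y f => exact congr_arg_heq (fun G : C ⥤ E => G.map f) h
  | id X =>
    change HEq (H.map (𝟙 X)) (K.map (𝟙 X))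
    rw [H.map_id, K.map_id, ho X]
  | comp f g ihf ihg =>
    change HEq (H.map (homMk f ≫ homMk g)) (K.map (homMk f ≫ homMk g))
    rw [H.map_comp, K.map_comp]
    exact heq_comp (ho _) (ho _) (ho _) ihf ihg
  | tensor f g ihf ihg =>
    exact (hH.tensor f g).trans ((heq_tensor (ho _) (ho _) (ho _) (ho _) ihf ihg).trans
      (hK.tensor f g).symm)
  | assocHom X Y Z =>
    exact (hH.assocHom X Y Z).trans (by rw [ho, ho, ho]; exact (hK.assocHom X Y Z).symm)
  | assocInv X Y Z =>
    exact (hH.assocInv X Y Z).trans (by rw [ho, ho, ho]; exact (hK.assocInv X Y Z).symm)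
  | leftHom X => exact (hH.leftHom X).trans (by rw [ho]; exact (hK.leftHom X).symm)
  | leftInv X => exact (hH.leftInv X).trans (by rw [ho]; exact (hK.leftInv X).symm)
  | rightHom X => exact (hH.rightHom X).trans (by rw [ho]; exact (hK.rightHom X).symm)
  | rightInv X => exact (hH.rightInv X).trans (by rw [ho]; exact (hK.rightInv X).symm)
  | braid h X Y => exact (hH.braid h X Y).trans (by rw [ho, ho]; exact (hK.braid h X Y).symm)
  | toUnit h X => exact (hH.toUnit h X).trans (by rw [ho]; exact (hK.toUnit h X).symm)

lemma lift_incl : lift (incl κ C) = 𝟭 (FreeMon κ C) :=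
  IsStrict.hom_ext
    ⟨rfl, fun _ _ => rfl, fun _ _ => HEq.rfl, fun _ _ _ => HEq.rfl, fun _ _ _ => HEq.rfl,
      fun _ => HEq.rfl, fun _ => HEq.rfl, fun _ => HEq.rfl, fun _ => HEq.rfl,
      fun _ _ _ => HEq.rfl, fun _ _ => HEq.rfl⟩
    ⟨rfl, fun _ _ => rfl, fun _ _ => HEq.rfl, fun _ _ _ => HEq.rfl, fun _ _ _ => HEq.rfl,
      fun _ => HEq.rfl, fun _ => HEq.rfl, fun _ => HEq.rfl, fun _ => HEq.rfl,
      fun _ _ _ => HEq.rfl, fun _ _ => HEq.rfl⟩ rfl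

lemma lift_comp_lift {C' : Type*} [Category* C'] (F : C ⥤ FreeMon κ C') (G : C' ⥤ E) :
    lift (κ := κ) F ⋙ lift (κ := κ) G = lift (κ := κ) (F ⋙ lift G) :=
  IsStrict.hom_ext
    ⟨rfl, fun _ _ => rfl, fun f g => heq_of_eq
      (lift_map_tensorMap G ((lift F).map (homMk f)) ((lift F).map (homMk g))), fun _ _ _ => HEq.rfl, fun _ _ _ => HEq.rfl,
      fun _ => HEq.rfl, fun _ => HEq.rfl, fun _ => HEq.rfl, fun _ => HEq.rfl,
      fun _ _ _ => HEq.rfl, fun _ _ => HEq.rfl⟩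
    ⟨rfl, fun _ _ => rfl, fun _ _ => HEq.rfl, fun _ _ _ => HEq.rfl, fun _ _ _ => HEq.rfl,
      fun _ => HEq.rfl, fun _ => HEq.rfl, fun _ => HEq.rfl, fun _ => HEq.rfl,
      fun _ _ _ => HEq.rfl, fun _ _ => HEq.rfl⟩ rfl

lemma map_liftNat_heq {C' : Type*} [Category* C'] {F F' : C ⥤ FreeMon κ C'} (τ : F ⟶ F')
    (G : C' ⥤ E) (X : FreeMon κ C) :
    HEq ((lift G).map ((liftNat τ).app X))
      ((liftNat (κ := κ) (Functor.whiskerRight τ (lift G))).app X) := by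
  have o (F : C ⥤ FreeMon κ C') (X : FreeMon κ C) := Functor.congr_obj (lift_comp_lift F G) X
  induction X with
  | of x => rfl
  | unit => exact heq_of_eq ((lift G).map_id _)
  | tensor X Y ihX ihY =>
    exact (heq_of_eq (lift_map_tensorMap G ((liftNat τ).app X) ((liftNat τ).app Y))).trans (heq_tensor (o _ _) (o _ _) (o _ _) (o _ _) ihX ihY)

lemma liftNat_obj_heq {C' : Type*} [Category* C'] (F : C ⥤ FreeMon κ C') {G G' : C' ⥤ E}
    (τ : G ⟶ G') (X : FreeMon κ C) :
    HEq ((liftNat τ).app ((lift F).obj X))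
      ((liftNat (κ := κ) (Functor.whiskerLeft F (liftNat τ))).app X) := by
  have o (G : C' ⥤ E) (X : FreeMon κ C) := Functor.congr_obj (lift_comp_lift F G) X
  induction X with
  | of x => rfl
  | unit => rfl
  | tensor X Y ihX ihY => exact heq_tensor (o _ _) (o _ _) (o _ _) (o _ _) ihX ihY

end Laws

section Small

universe w

/-- A tuple of morphisms of `C`, one for each leaf, between two objects of the same shape. -/
def Tup : FreeMon κ C → FreeMon κ C → Type v
  | .of x, .of y => x ⟶ y
  | .unit, .unit => PUnit
  | .tensor X Y, .tensor X' Y' => Tup X X' × Tup Y Y'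
  | _, _ => PEmpty

/-- The tensor product of a tuple of morphisms. -/
def Tup.eval : ∀ {X Y : FreeMon κ C}, Tup X Y → (X ⟶ Y)
  | .of _, .of _, f => homMk (.of f)
  | .unit, .unit, _ => 𝟙 _
  | .tensor _ _, .tensor _ _, t => tensorMap (eval t.1) (eval t.2)

lemma Tup.small [LocallySmall.{w} C] : ∀ X Y : FreeMon κ C, Small.{w} (Tup X Y)
  | .of x, .of y => inferInstanceAs (Small.{w} (x ⟶ y))
  | .unit, .unit => inferInstanceAs (Small.{w} PUnit)
  | .tensor X Y, .tensor X' Y' =>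
    have := Tup.small X X'
    have := Tup.small Y Y'
    inferInstanceAs (Small.{w} (Tup X X' × Tup Y Y'))
  | .of _, .unit | .of _, .tensor _ _ | .unit, .of _ | .unit, .tensor _ _
  | .tensor _ _, .of _ | .tensor _ _, .unit => inferInstanceAs (Small.{w} PEmpty)

/-- Relabelling of the leaves. -/
abbrev relabel {I : Type w} (l : I → C) : FreeMon κ (Discrete I) ⥤ FreeMon κ C :=
  lift (Discrete.functor fun i => FreeMon.of (l i))

lemma exists_shift {B B' : FreeMon κ C} (h : FreeHom κ C B B') {I : Type w} (l : I → C)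
    (X : FreeMon κ (Discrete I)) (t : Tup ((relabel l).obj X) B) :
    ∃ (X' : FreeMon κ (Discrete I)) (c : X ⟶ X') (t' : Tup ((relabel l).obj X') B'),
      t.eval ≫ homMk h = (relabel l).map c ≫ t'.eval := by
  induction h generalizing X with
  | of f =>
    match X, t with
    | .of i, t => 
      exact ⟨.of i, 𝟙 _, (t ≫ f : l i.as ⟶ _), (homMk_sound (.symm (.of_comp t f))).trans
        (by rw [CategoryTheory.Functor.map_id]; exact (Category.id_comp _).symm)⟩
  | id B => exact ⟨X, 𝟙 _, t, by
      rw [CategoryTheory.Functor.map_id, Category.id_comp]; exact Category.comp_id _⟩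
  | comp f g ihf ihg =>
    obtain ⟨X', c, t', h⟩ := ihf X t
    obtain ⟨X'', c', t'', h'⟩ := ihg X' t'
    refine ⟨X'', c ≫ c', t'', ?_⟩
    change t.eval ≫ homMk f ≫ homMk g = _
    rw [reassoc_of% h, h', Functor.map_comp, Category.assoc]
  | tensor f g ihf ihg =>
    match X, t with
    | .tensor X Y, t =>
      obtain ⟨X', c, t', h⟩ := ihf X t.1
      obtain ⟨Y', d, s', h'⟩ := ihg Y t.2
      refine ⟨.tensor X' Y', tensorMap c d, (t', s'), ?_⟩
      rw [lift_map_tensorMap]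
      exact (tensorHom_comp_tensorHom _ _ _ _).trans
        (congr($h ⊗ₘ $h').trans (tensorHom_comp_tensorHom _ _ _ _).symm)
  | assocHom B₁ B₂ B₃ => 
    match X, t with
    | .tensor (.tensor X Y) Z, t =>
      exact ⟨.tensor X (.tensor Y Z), homMk (.assocHom X Y Z), (t.1.1, t.1.2, t.2),
        associator_naturality t.1.1.eval t.1.2.eval t.2.eval⟩
  | assocInv B₁ B₂ B₃ =>
    match X, t with
    | .tensor X (.tensor Y Z), t =>
      exact ⟨.tensor (.tensor X Y) Z, homMk (.assocInv X Y Z), ((t.1, t.2.1), t.2.2),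
        associator_inv_naturality t.1.eval t.2.1.eval t.2.2.eval⟩
  | leftHom B =>
    match X, t with
    | .tensor .unit X, t =>
      exact ⟨X, homMk (.leftHom X), t.2, leftUnitor_naturality t.2.eval⟩
  | leftInv B =>
    exact ⟨.tensor .unit X, homMk (.leftInv X), (PUnit.unit, t), leftUnitor_inv_naturality t.eval⟩
  | rightHom B =>
    match X, t with
    | .tensor X .unit, t =>
      exact ⟨X, homMk (.rightHom X), t.1, rightUnitor_naturality t.1.eval⟩
  | rightInv B =>
    exact ⟨.tensor X .unit, homMk (.rightInv X), (t, PUnit.unit),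
      rightUnitor_inv_naturality t.eval⟩
  | braid h B₁ B₂ =>
    match X, t with
    | .tensor X Y, t =>
      let _ : SymmetricCategory (FreeMon κ C) := VMonoidal.symm h
      exact ⟨.tensor Y X, homMk (.braid h X Y), (t.2, t.1),
        BraidedCategory.braiding_naturality t.1.eval t.2.eval⟩
  | toUnit h B =>
    exact ⟨.unit, homMk (.toUnit h X), PUnit.unit, (VMonoidal.term (κ := κ) h).hom_ext _ _⟩

lemma exists_skeleton (A : FreeMon κ C) : ∃ (I : Type w) (l : I → C),
    ∀ {J : Type w} (k : J → C) (φ : I → J), (∀ i, k (φ i) = l i) →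
      ∃ (X : FreeMon κ (Discrete J)) (t : Tup ((relabel k).obj X) A), IsIso t.eval := by
  induction A with
  | of x =>
    refine ⟨PUnit, fun _ => x, fun {J} k φ h => ?_⟩
    refine ⟨.of ⟨φ ⟨⟩⟩, eqToHom (h ⟨⟩), ?_⟩
    exact inferInstanceAs (IsIso ((incl κ C).map (eqToHom (h ⟨⟩))))
  | unit =>
    exact ⟨PEmpty, PEmpty.elim, fun _ _ _ => ⟨.unit, PUnit.unit, inferInstanceAs (IsIso (𝟙 _))⟩⟩
  | tensor A B ihA ihB =>
    obtain ⟨I, l, hA⟩ := ihA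
    obtain ⟨I', l', hB⟩ := ihB
    refine ⟨I ⊕ I', Sum.elim l l', fun {J} k φ h => ?_⟩
    obtain ⟨X, t, ht⟩ := hA k (φ ∘ Sum.inl) (fun i => h (.inl i))
    obtain ⟨Y, s, hs⟩ := hB k (φ ∘ Sum.inr) (fun i => h (.inr i))
    exact ⟨.tensor X Y, (t, s), inferInstanceAs (IsIso (t.eval ⊗ₘ s.eval))⟩

variable (κ C) in
/-- The free monoidal category on a locally small category is locally small. -/
theorem locallySmall [LocallySmall.{w} C] : LocallySmall.{w} (FreeMon κ C) := by
  refine ⟨fun A B => ?_⟩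
  obtain ⟨I, l, hA⟩ := exists_skeleton.{v, u, w} A
  obtain ⟨X, t, ht⟩ := hA l id (fun _ => rfl)
  have := fun Y : FreeMon κ (Discrete I) => Tup.small.{v, u, w} ((relabel l).obj Y) B
  refine small_of_surjective
    (f := fun p : Σ Y : FreeMon κ (Discrete I), (X ⟶ Y) × Tup ((relabel l).obj Y) B =>
      inv t.eval ≫ (relabel l).map p.2.1 ≫ p.2.2.eval) ?_
  rintro ⟨h⟩
  obtain ⟨Y, c, s, hs⟩ := exists_shift h l X t
  refine ⟨⟨Y, c, s⟩, ?_⟩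
  change inv t.eval ≫ (relabel l).map c ≫ s.eval = homMk h
  rw [← hs, IsIso.inv_hom_id_assoc]

/-- The free monoidal category on a small category has a small set of objects. -/
theorem small_obj (κ : Variant) (C : Type u) [Small.{w} C] : Small.{w} (FreeMon κ C) := by
  let f : FreeMon κ (Shrink.{w} C) → FreeMon κ C := fun X =>
    FreeMon.rec (fun x => .of ((equivShrink C).symm x)) .unit (fun _ _ X Y => .tensor X Y) X
  refine small_of_surjective (f := f) fun X => ?_
  induction X with
  | of x => exact ⟨.of (equivShrink C x), congrArg FreeMon.of ((equivShrink C).symm_apply_apply x)⟩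
  | unit => exact ⟨.unit, rfl⟩
  | tensor X Y ihX ihY =>
    obtain ⟨X', rfl⟩ := ihX
    obtain ⟨Y', rfl⟩ := ihY
    exact ⟨.tensor X' Y', rfl⟩

end Small

end FreeMon
end FreeCat

section TheTwoMonads

open Bicategory

universe u

/-- A locally small category. Small means `u`-small; objects may form a proper class. -/
structure LocSmallCat : Type (u + 2) where
  cat : Cat.{u + 1, u + 1}
  locallySmall : LocallySmall.{u} cat

/-- The 2-category of locally small categories, functors and natural transformations. -/
abbrev CAT : Type (u + 2) := InducedBicategory Cat.{u + 1, u + 1} LocSmallCat.cat.{u}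

namespace CAT

/-- The underlying category. -/
abbrev toCat (X : CAT.{u}) : Cat.{u + 1, u + 1} := LocSmallCat.cat X

instance (X : CAT.{u}) : LocallySmall.{u} X.toCat := LocSmallCat.locallySmall X

abbrev of (X : Type (u + 1)) [Category.{u + 1} X] [LocallySmall.{u} X] : CAT.{u} :=
  LocSmallCat.mk (Cat.of X) ‹_›

/-- The functor underlying a morphism of `CAT`. -/
abbrev functor {X Y : CAT.{u}} (f : X ⟶ Y) : X.toCat ⥤ Y.toCat := f.hom.toFunctor

/-- The natural transformation underlying a 2-cell of `CAT`. -/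
abbrev natTrans {X Y : CAT.{u}} {f g : X ⟶ Y} (α : f ⟶ g) : functor f ⟶ functor g :=
  α.hom.toNatTrans

/-- The morphism of `CAT` given by a functor. -/
abbrev homOf {X Y : CAT.{u}} (F : X.toCat ⥤ Y.toCat) : X ⟶ Y :=
  InducedBicategory.mkHom (F := LocSmallCat.cat) (Cat.Hom.ofFunctor F)

/-- The 2-cell of `CAT` given by a natural transformation. -/
abbrev cellOf {X Y : CAT.{u}} {f g : X ⟶ Y} (α : functor f ⟶ functor g) : f ⟶ g :=
  InducedBicategory.Hom₂.mk (Cat.Hom₂.ofNatTrans α)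

lemma hom_ext {X Y : CAT.{u}} {f g : X ⟶ Y} (h : functor f = functor g) : f = g :=
  InducedBicategory.hom_ext (Cat.ext h)

lemma cell_ext {X Y : CAT.{u}} {f g : X ⟶ Y} {α β : f ⟶ g}
    (h : ∀ x, (natTrans α).app x = (natTrans β).app x) : α = β :=
  InducedBicategory.hom₂_ext (Cat.Hom₂.ext (NatTrans.ext (funext h)))

lemma natTrans_eqToHom {X Y : CAT.{u}} {f g : X ⟶ Y} (h : f = g) (x : X.toCat) :
    (natTrans (eqToHom h)).app x = eqToHom (by rw [h]) := by
  subst h; rfl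

lemma cell_eq_of_heq {X Y : CAT.{u}} {f f' g g' : X ⟶ Y} {α : f ⟶ g} {β : f' ⟶ g'}
    (hf : f = f') (hg : g = g')
    (h : ∀ x, HEq ((natTrans α).app x) ((natTrans β).app x)) :
    α = eqToHom hf ≫ β ≫ eqToHom hg.symm := by
  subst hf hg
  refine cell_ext fun x => ?_
  simpa using eq_of_heq (h x)

end CAT

namespace FreeMon

universe v₁ u₁ v₂ u₂ v₃ u₃

variable (κ : Variant) {C : Type u₁} [Category.{v₁} C] {D : Type u₂} [Category.{v₂} D]
  {E : Type u₃} [Category.{v₃} E]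

/-- The action of the 2-monad on functors. -/
def mapFunctor (F : C ⥤ D) : FreeMon κ C ⥤ FreeMon κ D := lift (F ⋙ incl κ D)

/-- The action of the 2-monad on natural transformations. -/
def mapNat {F G : C ⥤ D} (τ : F ⟶ G) : mapFunctor κ F ⟶ mapFunctor κ G :=
  liftNat (Functor.whiskerRight τ (incl κ D))

variable (C) in
/-- The multiplication of the 2-monad: evaluate formal tensor products of formal tensor products. -/
def mult : FreeMon κ (FreeMon κ C) ⥤ FreeMon κ C := lift (𝟭 (FreeMon κ C))

lemma mapNat_id (F : C ⥤ D) : mapNat κ (𝟙 F) = 𝟙 (mapFunctor κ F) := by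
  rw [mapNat, Functor.whiskerRight_id']
  exact liftNat_id _

lemma mapNat_comp {F G H : C ⥤ D} (σ : F ⟶ G) (τ : G ⟶ H) :
    mapNat κ (σ ≫ τ) = mapNat κ σ ≫ mapNat κ τ := by
  rw [mapNat, Functor.whiskerRight_comp]
  exact liftNat_comp _ _

lemma mapFunctor_id : mapFunctor κ (𝟭 C) = 𝟭 (FreeMon κ C) := lift_incl

lemma mapFunctor_comp (F : C ⥤ D) (G : D ⥤ E) :
    mapFunctor κ (F ⋙ G) = mapFunctor κ F ⋙ mapFunctor κ G :=
  (lift_comp_lift (F ⋙ incl κ D) (G ⋙ incl κ E)).symm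

lemma mapNat_whiskerLeft (F : C ⥤ D) {G G' : D ⥤ E} (τ : G ⟶ G') (X : FreeMon κ C) :
    HEq ((mapNat κ (Functor.whiskerLeft F τ)).app X)
      ((mapNat κ τ).app ((mapFunctor κ F).obj X)) :=
  (liftNat_obj_heq (F ⋙ incl κ D) (Functor.whiskerRight τ (incl κ E)) X).symm

lemma mapNat_whiskerRight {F F' : C ⥤ D} (τ : F ⟶ F') (G : D ⥤ E) (X : FreeMon κ C) :
    HEq ((mapNat κ (Functor.whiskerRight τ G)).app X)
      ((mapFunctor κ G).map ((mapNat κ τ).app X)) :=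
  (map_liftNat_heq (Functor.whiskerRight τ (incl κ D)) (G ⋙ incl κ E) X).symm

lemma mult_natural (F : C ⥤ D) :
    mapFunctor κ (mapFunctor κ F) ⋙ mult κ D = mult κ C ⋙ mapFunctor κ F :=
  (lift_comp_lift (mapFunctor κ F ⋙ incl κ _) (𝟭 _)).trans
    (lift_comp_lift (𝟭 _) (F ⋙ incl κ D)).symm

lemma mult_natural₂ {F G : C ⥤ D} (τ : F ⟶ G) (X : FreeMon κ (FreeMon κ C)) :
    HEq ((mult κ D).map ((mapNat κ (mapNat κ τ)).app X)) ((mapNat κ τ).app ((mult κ C).obj X)) :=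
  (map_liftNat_heq (Functor.whiskerRight (mapNat κ τ) (incl κ _)) (𝟭 _) X).trans
    (liftNat_obj_heq (𝟭 _) (Functor.whiskerRight τ (incl κ D)) X).symm

lemma mult_assoc : mapFunctor κ (mult κ C) ⋙ mult κ C = mult κ (FreeMon κ C) ⋙ mult κ C :=
  (lift_comp_lift (mult κ C ⋙ incl κ _) (𝟭 _)).trans (lift_comp_lift (𝟭 _) (𝟭 _)).symm

lemma mult_map_unit : mapFunctor κ (incl κ C) ⋙ mult κ C = 𝟭 (FreeMon κ C) :=
  (lift_comp_lift (incl κ C ⋙ incl κ _) (𝟭 _)).trans lift_incl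

lemma mult_unit : incl κ (FreeMon κ C) ⋙ mult κ C = 𝟭 (FreeMon κ C) := rfl

lemma unit_natural (F : C ⥤ D) : F ⋙ incl κ D = incl κ C ⋙ mapFunctor κ F := rfl

end FreeMon

open FreeMon in
/-- The 2-functor that sends a category to the free monoidal category of kind `κ` on it. -/
def freePseudofunctor (κ : Variant) : StrictPseudofunctor CAT.{u} CAT.{u} :=
  StrictPseudofunctor.mk''
    { obj X := LocSmallCat.mk (Cat.of (FreeMon κ X.toCat)) (locallySmall κ X.toCat)
      map f := CAT.homOf (mapFunctor κ (CAT.functor f))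
      map₂ α := CAT.cellOf (mapNat κ (CAT.natTrans α))
      map₂_id f := CAT.cell_ext fun x => NatTrans.congr_app (mapNat_id κ _) x
      map₂_comp α β := CAT.cell_ext fun x => NatTrans.congr_app (mapNat_comp κ _ _) x
      map_id X := CAT.hom_ext (mapFunctor_id κ)
      map_comp f g := CAT.hom_ext (mapFunctor_comp κ _ _)
      map₂_whisker_left f g h η :=
        CAT.cell_eq_of_heq (CAT.hom_ext (mapFunctor_comp κ (CAT.functor f) (CAT.functor g)))
          (CAT.hom_ext (mapFunctor_comp κ (CAT.functor f) (CAT.functor h)))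
          fun x => mapNat_whiskerLeft κ _ _ x
      map₂_whisker_right {_ _ _ f g} η h :=
        CAT.cell_eq_of_heq (CAT.hom_ext (mapFunctor_comp κ (CAT.functor f) (CAT.functor h)))
          (CAT.hom_ext (mapFunctor_comp κ (CAT.functor g) (CAT.functor h)))
          fun x => mapNat_whiskerRight κ _ _ x }

open FreeMon in
/-- The 2-monad on `CAT` for monoidal categories of kind `κ`. Its strict algebras are the
locally small monoidal categories of kind `κ`, its pseudomorphisms the strong (symmetric) monoidal
functors, its algebra 2-cells the monoidal natural transformations. -/
def freeMonad (κ : Variant) : TwoMonad CAT.{u} where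
  toStrictPseudofunctor := freePseudofunctor κ
  m X := CAT.homOf (X := (freePseudofunctor κ).obj ((freePseudofunctor κ).obj X))
    (Y := (freePseudofunctor κ).obj X) (mult κ X.toCat)
  e X := CAT.homOf (Y := (freePseudofunctor κ).obj X) (incl κ X.toCat)
  m_natural f := CAT.hom_ext (mult_natural κ (CAT.functor f))
  m_natural₂ {_ _ f g} η := CAT.cell_eq_of_heq (CAT.hom_ext (mult_natural κ (CAT.functor f)))
    (CAT.hom_ext (mult_natural κ (CAT.functor g))) fun x => mult_natural₂ κ (CAT.natTrans η) x
  e_natural f := CAT.hom_ext (unit_natural κ (CAT.functor f))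
  e_natural₂ {_ _ f g} η := CAT.cell_eq_of_heq (CAT.hom_ext (unit_natural κ (CAT.functor f)))
    (CAT.hom_ext (unit_natural κ (CAT.functor g)))
    fun x => HEq.refl ((incl κ _).map ((CAT.natTrans η).app x))
  assoc X := CAT.hom_ext (mult_assoc κ)
  left_unit X := CAT.hom_ext (mult_unit κ)
  right_unit X := CAT.hom_ext (mult_map_unit κ)

end TheTwoMonads

section Presheaves

open Opposite Limits

universe u v₁ u₁ v₂ u₂ v₃ u₃

variable (X : Type u₁) [Category.{v₁} X] [LocallySmall.{u} X]

/-- The Yoneda embedding into presheaves of `u`-small sets. -/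
noncomputable abbrev yo : X ⥤ Xᵒᵖ ⥤ Type u := shrinkYoneda.{u}

variable [Small.{u} X]

instance locallySmall_presheaf : LocallySmall.{u} (Xᵒᵖ ⥤ Type u) where
  hom_small F G := by
    refine small_of_injective (β := ∀ x : Xᵒᵖ, (F.obj x → G.obj x)) (f := fun α x => α.app x) ?_
    intro α β h
    ext x t
    exact congrFun (congrFun h x) t

variable {X}

instance hasColimit_presheaf {E : Type u₂} [Category.{v₂} E] [HasColimitsOfSize.{u, u} E]
    (F : X ⥤ E) : (yo X).HasPointwiseLeftKanExtension F := fun p => by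
  have := essentiallySmall_of_small_of_locallySmall.{u} X
  have := hasColimitsOfShape_of_essentiallySmall (C := E) (CostructuredArrow (yo X) p)
  change HasColimit _
  infer_instance

lemma ι_natural {E : Type u₂} [Category.{v₂} E] {F : X ⥤ E} {p : Xᵒᵖ ⥤ Type u}
    (s : Cocone (CostructuredArrow.proj (yo X) p ⋙ F)) {x y : Xᵒᵖ} (f : x ⟶ y) (t : p.obj x) :
    s.ι.app (CostructuredArrow.mk (Y := y.unop) (shrinkYonedaEquiv.symm (p.map f t))) =
      F.map f.unop ≫
        s.ι.app (CostructuredArrow.mk (Y := x.unop) (shrinkYonedaEquiv.symm t)) := by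
  have e := shrinkYonedaEquiv_symm_map f t
  exact (s.w (CostructuredArrow.homMk (f := .mk (shrinkYonedaEquiv.symm (p.map f t)))
    (f' := .mk (shrinkYonedaEquiv.symm t)) f.unop e.symm)).symm

/-- The map out of `p` induced by a cocone over the representables mapping to `p`. -/
noncomputable def descYo {p : Xᵒᵖ ⥤ Type u}
    (s : Cocone (CostructuredArrow.proj (yo X) p ⋙ yo X)) : p ⟶ s.pt where
  app x := ↾fun t => shrinkYonedaEquiv (s.ι.app (CostructuredArrow.mk
    (Y := x.unop) (shrinkYonedaEquiv.symm t)))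
  naturality x y f := by
    ext t
    exact (congrArg shrinkYonedaEquiv (ι_natural s f t)).trans
      (shrinkYonedaEquiv_naturality _ f.unop).symm

lemma descYo_fac {p : Xᵒᵖ ⥤ Type u} (s : Cocone (CostructuredArrow.proj (yo X) p ⋙ yo X))
    (j : CostructuredArrow (yo X) p) : j.hom ≫ descYo s = s.ι.app j := by
  apply shrinkYonedaEquiv.injective
  rw [shrinkYonedaEquiv_comp]
  change shrinkYonedaEquiv (s.ι.app (CostructuredArrow.mk (shrinkYonedaEquiv.symm
    (shrinkYonedaEquiv j.hom)))) = _
  rw [Equiv.symm_apply_apply]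
  rfl

lemma descYo_uniq {p : Xᵒᵖ ⥤ Type u} (s : Cocone (CostructuredArrow.proj (yo X) p ⋙ yo X))
    (m : p ⟶ s.pt) (hm : ∀ j : CostructuredArrow (yo X) p, j.hom ≫ m = s.ι.app j) :
    m = descYo s := by
  ext x t
  have h1 := congrArg shrinkYonedaEquiv
    (hm (CostructuredArrow.mk (Y := x.unop) (shrinkYonedaEquiv.symm t)))
  have h2 := shrinkYonedaEquiv_comp (X := x.unop) (shrinkYonedaEquiv.symm t) m
  rw [Equiv.apply_symm_apply] at h2
  exact h2.symm.trans h1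

/-- Every presheaf is the canonical colimit of representables. -/
noncomputable def yoDense :
    (Functor.LeftExtension.mk _ (yo X).rightUnitor.inv).IsPointwiseLeftKanExtension := fun p =>
  { desc := fun s => descYo s
    fac := fun s j =>
      (congrArg (· ≫ descYo s) (Category.id_comp j.hom)).trans (descYo_fac s j)
    uniq := fun s m hm => descYo_uniq s m fun j =>
      (congrArg (· ≫ m) (Category.id_comp j.hom)).symm.trans (hm j) }

variable {E : Type u₂} [Category.{v₂} E] [LocallySmall.{u} E]

/-- The functor sending `e` to the presheaf `x ↦ E(F x, e)`. -/
noncomputable def nerve (F : X ⥤ E) : E ⥤ Xᵒᵖ ⥤ Type u :=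
  yo E ⋙ (Functor.whiskeringLeft _ _ _).obj F.op

section Adj

variable {F : X ⥤ E} (L : (Xᵒᵖ ⥤ Type u) ⥤ E) (α : F ⟶ yo X ⋙ L)

/-- The transpose of `g : L p ⟶ e`. -/
noncomputable def toNerve {p : Xᵒᵖ ⥤ Type u} {e : E} (g : L.obj p ⟶ e) :
    p ⟶ (nerve F).obj e where
  app x := ↾fun t => (shrinkYonedaObjObjEquiv.symm (α.app x.unop ≫
    L.map (shrinkYonedaEquiv.symm t) ≫ g) : ((yo E).obj e).obj (op (F.obj x.unop)))
  naturality x y f := by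
    ext t
    have h := shrinkYoneda_obj_map_shrinkYonedaObjObjEquiv_symm (F.op.map f)
      (α.app x.unop ≫ L.map (shrinkYonedaEquiv.symm t) ≫ g)
    refine Eq.trans ?_ h.symm
    change shrinkYonedaObjObjEquiv.symm (α.app y.unop ≫
      L.map (shrinkYonedaEquiv.symm (p.map f t)) ≫ g) = _
    rw [shrinkYonedaEquiv_symm_map, L.map_comp]
    have : F.map f.unop ≫ α.app _ = α.app _ ≫ L.map ((yo X).map f.unop) := α.naturality f.unop
    rw [Category.assoc, ← reassoc_of% this]
    rfl

lemma toNerve_map_comp {p q : Xᵒᵖ ⥤ Type u} {e : E} (f : p ⟶ q) (g : L.obj q ⟶ e) :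
    toNerve L α (L.map f ≫ g) = f ≫ toNerve L α g := by
  ext x t
  have h := shrinkYonedaEquiv_comp (X := x.unop) (shrinkYonedaEquiv.symm t) f
  rw [Equiv.apply_symm_apply] at h
  have h' : shrinkYonedaEquiv.symm (f.app x t) = shrinkYonedaEquiv.symm t ≫ f := by
    rw [Equiv.symm_apply_eq]; exact h.symm
  change shrinkYonedaObjObjEquiv.symm (α.app x.unop ≫ L.map (shrinkYonedaEquiv.symm t) ≫
    L.map f ≫ g) = shrinkYonedaObjObjEquiv.symm (α.app x.unop ≫
      L.map (shrinkYonedaEquiv.symm (f.app x t)) ≫ g)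
  rw [h', L.map_comp, Category.assoc]

/-- A map `p ⟶ E(F -, e)` as a cocone with vertex `e`. -/
noncomputable def nerveCocone {p : Xᵒᵖ ⥤ Type u} {e : E} (k : p ⟶ (nerve F).obj e) :
    Cocone (CostructuredArrow.proj (yo X) p ⋙ F) where
  pt := e
  ι :=
    { app a := (shrinkYonedaObjObjEquiv
        (k.app (op a.left) (shrinkYonedaEquiv a.hom) :
          ((yo E).obj e).obj (op (F.obj a.left))) : F.obj a.left ⟶ e)
      naturality a b f := by
        have h1 : p.map f.left.op (shrinkYonedaEquiv b.hom) = shrinkYonedaEquiv a.hom := by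
          rw [shrinkYonedaEquiv_naturality]
          exact congrArg shrinkYonedaEquiv (CostructuredArrow.w f)
        have h2 := NatTrans.naturality_apply k f.left.op (shrinkYonedaEquiv b.hom)
        have h3 := shrinkYonedaObjObjEquiv_obj_map (F.map f.left).op
          (k.app (op b.left) (shrinkYonedaEquiv b.hom) :
          ((yo E).obj e).obj (op (F.obj b.left)))
        refine Eq.trans ?_ (Category.comp_id _).symm
        refine h3.symm.trans ?_
        rw [h1] at h2
        exact congrArg shrinkYonedaObjObjEquiv h2.symm }

variable {L α}

/-- The bijection between maps `L p ⟶ e` and maps `p ⟶ E(F -, e)`. -/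
noncomputable def lanHomEquiv (hL : (Functor.LeftExtension.mk L α).IsPointwiseLeftKanExtension)
    (p : Xᵒᵖ ⥤ Type u) (e : E) : (L.obj p ⟶ e) ≃ (p ⟶ (nerve F).obj e) where
  toFun g := toNerve L α g
  invFun k := (hL p).desc (nerveCocone k)
  left_inv g := by
    refine ((hL p).uniq (nerveCocone (toNerve L α g)) g fun j => ?_).symm
    change (α.app j.left ≫ L.map j.hom) ≫ g = shrinkYonedaObjObjEquiv
      (shrinkYonedaObjObjEquiv.symm (α.app j.left ≫
        L.map (shrinkYonedaEquiv.symm (shrinkYonedaEquiv j.hom)) ≫ g))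
    rw [Equiv.apply_symm_apply, Equiv.symm_apply_apply, Category.assoc]
  right_inv k := by
    ext x t
    have := (hL p).fac (nerveCocone k) (CostructuredArrow.mk (Y := x.unop)
      (shrinkYonedaEquiv.symm t))
    change shrinkYonedaObjObjEquiv.symm (α.app x.unop ≫ L.map (shrinkYonedaEquiv.symm t) ≫
      (hL p).desc (nerveCocone k)) = _
    refine (congrArg shrinkYonedaObjObjEquiv.symm
      ((Category.assoc _ _ _).symm.trans this)).trans ?_
    refine (Equiv.symm_apply_apply shrinkYonedaObjObjEquiv _).trans ?_
    exact congrArg (k.app x) (shrinkYonedaEquiv.apply_symm_apply t)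

/-- A pointwise left Kan extension along the Yoneda embedding is left adjoint to `nerve F`. -/
noncomputable def lanAdjunction
    (hL : (Functor.LeftExtension.mk L α).IsPointwiseLeftKanExtension) : L ⊣ nerve F :=
  Adjunction.mkOfHomEquiv
    { homEquiv p e := lanHomEquiv hL p e
      homEquiv_naturality_left_symm {p q e} f k := by
        rw [Equiv.symm_apply_eq]
        exact (congrArg (f ≫ ·) ((lanHomEquiv hL q e).apply_symm_apply k)).symm.trans
          (toNerve_map_comp L α f _).symm
      homEquiv_naturality_right {p e e'} f g := by
        ext x t
        have := shrinkYoneda_map_app_shrinkYonedaObjObjEquiv_symm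
          (α.app x.unop ≫ L.map (shrinkYonedaEquiv.symm t) ≫ f) g
        refine Eq.trans ?_ this.symm
        change shrinkYonedaObjObjEquiv.symm (α.app x.unop ≫ L.map (shrinkYonedaEquiv.symm t) ≫
          f ≫ g) = _
        simp }

end Adj

variable [HasColimitsOfSize.{u, u} E]

/-- The left Kan extension of `F` along the Yoneda embedding. -/
noncomputable def yoExt (F : X ⥤ E) : (Xᵒᵖ ⥤ Type u) ⥤ E := (yo X).pointwiseLeftKanExtension F

/-- The unit of the left Kan extension. -/
noncomputable def yoExtUnit (F : X ⥤ E) : F ⟶ yo X ⋙ yoExt F :=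
  (yo X).pointwiseLeftKanExtensionUnit F

/-- The left Kan extension is pointwise. -/
noncomputable def yoExtIsPointwise (F : X ⥤ E) :
    (Functor.LeftExtension.mk (yoExt F) (yoExtUnit F)).IsPointwiseLeftKanExtension :=
  (yo X).pointwiseLeftKanExtensionIsPointwiseLeftKanExtension F

instance (F : X ⥤ E) : IsIso (yoExtUnit F) := (yoExtIsPointwise F).isIso_hom

/-- The unit is invertible, since the Yoneda embedding is fully faithful. -/
noncomputable def yoExtIso (F : X ⥤ E) : F ≅ yo X ⋙ yoExt F := asIso (yoExtUnit F)

instance (F : X ⥤ E) : (yoExt F).IsLeftAdjoint :=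
  (lanAdjunction (yoExtIsPointwise F)).isLeftAdjoint

lemma existsUnique_of_pointwise {A : Type u₁} [Category.{v₁} A] {B : Type u₂}
    [Category.{v₂} B] {H : Type u₃} [Category.{v₃} H] {L : A ⥤ B} {F : A ⥤ H}
    (M : L.LeftExtension F) (hM : M.IsPointwiseLeftKanExtension) (K : B ⥤ H) (σ : F ⟶ L ⋙ K) :
    ∃! τ : M.right ⟶ K, M.hom ≫ Functor.whiskerLeft L τ = σ := by
  have := hM.isLeftKanExtension
  refine ⟨M.right.descOfIsLeftKanExtension M.hom K σ,
    M.right.descOfIsLeftKanExtension_fac M.hom K σ, fun τ hτ => ?_⟩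
  refine M.right.hom_ext_of_isLeftKanExtension M.hom _ _ (hτ.trans ?_)
  exact (M.right.descOfIsLeftKanExtension_fac M.hom K σ).symm

lemma yoExt_lan (F : X ⥤ E) (K : (Xᵒᵖ ⥤ Type u) ⥤ E) (σ : F ⟶ yo X ⋙ K) :
    ∃! τ : yoExt F ⟶ K, yoExtUnit F ≫ Functor.whiskerLeft (yo X) τ = σ :=
  existsUnique_of_pointwise _ (yoExtIsPointwise F) K σ

lemma yoExt_lan_comp {E' : Type u₃} [Category.{v₃} E'] (F : X ⥤ E) (H : E ⥤ E')
    [PreservesColimitsOfSize.{u, u} H] (K : (Xᵒᵖ ⥤ Type u) ⥤ E') (σ : F ⋙ H ⟶ yo X ⋙ K) :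
    ∃! τ : yoExt F ⋙ H ⟶ K, Functor.whiskerRight (yoExtUnit F) H ≫
      ((yo X).associator (yoExt F) H).hom ≫ Functor.whiskerLeft (yo X) τ = σ := by
  have : H.PreservesPointwiseLeftKanExtension F (yo X) := fun p => by
    have := essentiallySmall_of_small_of_locallySmall.{u} X
    have := preservesColimitsOfShape_of_equiv
      (equivSmallModel.{u} (CostructuredArrow (yo X) p)).symm H
    infer_instance
  have h := existsUnique_of_pointwise _ ((yoExtIsPointwise F).postcompose H) K σ
  refine (existsUnique_congr fun τ => ?_).1 h
  rw [← Category.assoc]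
  refine Eq.congr_left (congrArg (· ≫ Functor.whiskerLeft (yo X) τ) ?_)
  ext x
  simp only [Functor.LeftExtension.postcompose₂]
  simp
  rfl

lemma yoExt_lan_id (K : (Xᵒᵖ ⥤ Type u) ⥤ Xᵒᵖ ⥤ Type u) (σ : yo X ⟶ yo X ⋙ K) :
    ∃! τ : 𝟭 (Xᵒᵖ ⥤ Type u) ⟶ K,
      (yo X).rightUnitor.inv ≫ Functor.whiskerLeft (yo X) τ = σ :=
  existsUnique_of_pointwise _ yoDense K σ

end Presheaves

section ThePseudomonad

open Bicategory

universe u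

/-- A small category. -/
structure SmallCat : Type (u + 2) where
  cat : CAT.{u}
  small : Small.{u} cat.toCat

/-- The full sub-2-category of `CAT` spanned by the small categories. -/
abbrev CatS : Type (u + 2) := InducedBicategory CAT.{u} SmallCat.cat.{u}

/-- The underlying locally small category. -/
abbrev CatS.toCAT (X : CatS.{u}) : CAT.{u} := SmallCat.cat X

instance (X : CatS.{u}) : Small.{u} X.toCAT.toCat := SmallCat.small X

/-- The inclusion `J` of the 2-category of small categories into `CAT`. -/
def inclusion : Pseudofunctor CatS.{u} CAT.{u} :=
  (InducedBicategory.forget (C := CAT.{u}) (F := SmallCat.cat.{u})).toPseudofunctor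

/-- The locally small category of presheaves of small sets on a small category. -/
noncomputable def psh (X : CatS.{u}) : CAT.{u} :=
  LocSmallCat.mk (Cat.of (X.toCAT.toCatᵒᵖ ⥤ Type u)) (locallySmall_presheaf X.toCAT.toCat)

lemma CAT.existsUnique_cell {X Y : CAT.{u}} {f g : X ⟶ Y} {P : (f ⟶ g) → Prop}
    {Q : (CAT.functor f ⟶ CAT.functor g) → Prop} (hQ : ∃! τ, Q τ)
    (h : ∀ τ : f ⟶ g, P τ ↔ Q (CAT.natTrans τ)) : ∃! τ, P τ := by
  obtain ⟨τ, h1, h2⟩ := hQ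
  refine ⟨CAT.cellOf τ, (h _).2 h1, fun τ' h' => ?_⟩
  have := h2 _ ((h τ').1 h')
  exact CAT.cell_ext fun x => by rw [this]

lemma CAT.cell_ext_iff {X Y : CAT.{u}} {f g : X ⟶ Y} {α β : f ⟶ g} :
    α = β ↔ CAT.natTrans α = CAT.natTrans β :=
  ⟨fun h => h ▸ rfl, fun h => InducedBicategory.hom₂_ext (Cat.Hom₂.ext h)⟩

/-- The functor underlying a morphism from a small category to a presheaf category. -/
noncomputable abbrev pshFunctor {X Y : CatS.{u}} (f : inclusion.obj X ⟶ psh Y) :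
    X.toCAT.toCat ⥤ Y.toCAT.toCatᵒᵖ ⥤ Type u := CAT.functor f

/-- The Yoneda embedding. -/
noncomputable def yoMor (X : CatS.{u}) : inclusion.obj X ⟶ psh X :=
  CAT.homOf (X := X.toCAT) (Y := psh X) (yo X.toCAT.toCat)

/-- The left Kan extension of `f` along the Yoneda embedding. -/
noncomputable def extMor {X Y : CatS.{u}} (f : inclusion.obj X ⟶ psh Y) : psh X ⟶ psh Y :=
  CAT.homOf (X := psh X) (Y := psh Y) (yoExt (E := Y.toCAT.toCatᵒᵖ ⥤ Type u) (pshFunctor f))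

/-- The unit of the left Kan extension. -/
noncomputable def etaMor {X Y : CatS.{u}} (f : inclusion.obj X ⟶ psh Y) :
    f ≅ yoMor X ≫ extMor f :=
  InducedBicategory.isoMk (f := f) (g := yoMor X ≫ extMor f)
    (Cat.Hom.isoMk (yoExtIso (E := Y.toCAT.toCatᵒᵖ ⥤ Type u) (pshFunctor f)))

/-- The presheaf construction with its left Kan extensions. -/
noncomputable def presheafData : LeftKanData inclusion.{u} where
  obj := psh
  unit := yoMor
  ext := extMor
  eta := etaMor
  lan {_ _} f {K} σ := CAT.existsUnique_cell
    (yoExt_lan (pshFunctor f) (CAT.functor K) (CAT.natTrans σ)) fun _ => CAT.cell_ext_iff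
  lan_comp {_ Y Z} f g {K} σ := by
    refine CAT.existsUnique_cell (yoExt_lan_comp (pshFunctor f)
      (yoExt (X := Y.toCAT.toCat) (E := Z.toCAT.toCatᵒᵖ ⥤ Type u) (pshFunctor g))
      (CAT.functor K) (CAT.natTrans σ)) fun τ => ?_
    exact CAT.cell_ext_iff
  lan_id {X K} σ := CAT.existsUnique_cell
    (yoExt_lan_id (X := X.toCAT.toCat) (CAT.functor K) (CAT.natTrans σ)) fun _ => CAT.cell_ext_iff

/-- The relative pseudomonad of presheaves: `P X` is the category of presheaves on the small category
`X`, the unit is the Yoneda embedding, `f^*` is the left Kan extension of `f` along the Yoneda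
embedding, and the 2-cells are the canonical ones. -/
noncomputable def presheafPseudomonad : RelPseudomonad inclusion.{u} :=
  presheafData.toRelPseudomonad

end ThePseudomonad

section Day

open Opposite Limits MonoidalCategory

universe u

variable {κ : Variant}

/-- The tensor product of a strict algebra `(B, b)`: `x ⊗ y` is the value of the structure functor
`b` at the formal tensor product of `x` and `y`. -/
def StrictAlg.tensorFunctor {B : CAT.{u}} (b : StrictAlg (freeMonad κ) B) :
    B.toCat ⥤ B.toCat ⥤ B.toCat :=
  FreeMon.incl κ B.toCat ⋙ curriedTensor (FreeMon κ B.toCat) ⋙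
    (Functor.whiskeringLeft _ _ _).obj (FreeMon.incl κ B.toCat) ⋙
    (Functor.whiskeringRight _ _ _).obj (CAT.functor b.str)

/-- The algebra `(B, b)` is monoidally cocomplete: `B` has small colimits and the tensor product
preserves them in each variable. -/
structure StrictAlg.MonoidallyCocomplete {B : CAT.{u}} (b : StrictAlg (freeMonad κ) B) :
    Prop where
  hasColimits : HasColimitsOfSize.{u, u} B.toCat
  left (x : B.toCat) : PreservesColimitsOfSize.{u, u} (b.tensorFunctor.obj x)
  right (y : B.toCat) : PreservesColimitsOfSize.{u, u} (b.tensorFunctor.flip.obj y)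

/-- The tensor product of a small algebra as a functor `Xᵒᵖ × Xᵒᵖ ⥤ Xᵒᵖ`. -/
def StrictAlg.tensorOp {X : CatS.{u}} (a : StrictAlg (freeMonad κ) (inclusion.obj X)) :
    X.toCAT.toCatᵒᵖ × X.toCAT.toCatᵒᵖ ⥤ X.toCAT.toCatᵒᵖ :=
  (prodOpEquiv X.toCAT.toCat).inverse ⋙ (Functor.uncurry.obj a.tensorFunctor).op

/-- The tensor product of a strict algebra structure on a category of presheaves. -/
noncomputable def StrictAlg.pshTensor {X : CatS.{u}} (p : StrictAlg (freeMonad κ) (psh X)) :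
    (X.toCAT.toCatᵒᵖ ⥤ Type u) × (X.toCAT.toCatᵒᵖ ⥤ Type u) ⥤ X.toCAT.toCatᵒᵖ ⥤ Type u :=
  Functor.uncurry.obj p.tensorFunctor

/-- The tensor product of `p` is the Day convolution of the tensor product of `a`: naturally in the
presheaves `F` and `G`, their tensor product is the left Kan extension of the presheaf
`(x, y) ↦ F x × G y` along the tensor product of `a`. -/
def IsDayConvolution {X : CatS.{u}} (a : StrictAlg (freeMonad κ) (inclusion.obj X))
    (p : StrictAlg (freeMonad κ) (psh X)) : Prop :=
  ∃ δ : externalProductBifunctor X.toCAT.toCatᵒᵖ X.toCAT.toCatᵒᵖ (Type u) ⟶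
      p.pshTensor ⋙ (Functor.whiskeringLeft _ _ _).obj a.tensorOp,
    ∀ F G : X.toCAT.toCatᵒᵖ ⥤ Type u,
      (p.pshTensor.obj (F, G)).IsLeftKanExtension (δ.app (F, G))

/-- The pseudomorphisms whose underlying functor preserves small colimits. -/
def IsCocontinuous {A B : CAT.{u}} {a : StrictAlg (freeMonad κ) A}
    {b : StrictAlg (freeMonad κ) B} : ObjectProperty (PsMor a b) :=
  fun F => PreservesColimitsOfSize.{u, u} (CAT.functor F.hom)

/-- `i : A → P` exhibits `P` as the free monoidally cocomplete category on `A`: for every monoidally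
cocomplete `B`, restriction along `i` is an equivalence from the category of cocontinuous
pseudomorphisms `P → B` to the category of pseudomorphisms `A → B`. -/
def IsFreeMonoidalCocompletion {A P : CAT.{u}} {a : StrictAlg (freeMonad κ) A}
    {p : StrictAlg (freeMonad κ) P} (i : PsMor a p) : Prop :=
  p.MonoidallyCocomplete ∧
    ∀ (B : CAT.{u}) (b : StrictAlg (freeMonad κ) B), b.MonoidallyCocomplete →
      ((IsCocontinuous (a := p) (b := b)).ι ⋙ PsMor.precomp i).IsEquivalence

end Day

end PshLift

universe u

/-! The argument has two halves: the 2-monad is eliminated, and then Day convolution is constructed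
from the density of the Yoneda embedding.

Elimination of the 2-monad. A strict action `a` on `X` makes `X` a monoidal category of kind `κ`:
every structure morphism of `X` is the value of `a` at the formal one, and every axiom is the image
of an axiom of the free category. Conversely `a` preserves this structure on the nose, so it is
evaluation of formal tensor products (`StrictAct.eq_lift`), and every strict algebra has the form
`algOf M` (`exists_eq_algOf`). The structure of a pseudomorphism is determined by its components at
the formal unit and at binary formal tensors, so it amounts to a strong monoidal structure
compatible with the symmetries (`PsMorStr.ofCore`, `PsMorStr.core`). A 2-cell is an algebra 2-cell
as soon as it respects the unit and binary tensors (`PsMorStr.isAlg2Cell_iff`). A terminal unit puts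
no further condition on functors, since a strong monoidal functor preserves the unit up to
isomorphism.

Density. The Yoneda embedding `y` is dense with essentially small comma categories. Hence a
cocontinuous functor on presheaves is the left Kan extension of its restriction along `y`, and
natural transformations out of it are the same as transformations out of the restriction
(`SmallDense.homBij`). The same holds for functors of two or three variables that are cocontinuous
in each (`SmallDense.homBij₂`, `SmallDense.homBij₃`). Once the tensor product of `A` is extended to
a separately cocontinuous bifunctor (`exists_tensorExtension`), the associator, the unitors and the
symmetry therefore extend too, and their axioms need only be checked on representables, where they
are the axioms of `A`. The object `y 𝟙_` is terminal if `𝟙_` is, because `y` is full and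
representables generate. This is `TensorExtension.exists_vmonoidal`.

By the same principle a cocontinuous functor on presheaves becomes strong monoidal once its
restriction is (`exists_isAlg2Cell`), and a 2-cell out of it is an algebra 2-cell once its
restriction is (`isAlg2Cell_of_whiskerLeft`). The structure on `f^*` is thus chosen so that `η_f` is
an algebra 2-cell. The cells `α^*`, `μ` and `θ` are defined by their composites with `η`, which are
visibly algebra 2-cells, so they are algebra 2-cells as well (`isAlg2Cell_of_eta`). Allowing an
arbitrary monoidally cocomplete target in the same two extension results gives the universal
property.

For Day convolution, elements of `F x` and `G y` are maps from representables. Tensoring them gives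
an element of `F ⊗ G` at `x ⊗ y`, and density in both variables says that these pairings are
universal (`isDayConvolution_algOf`). -/

namespace PshLift

/-! ### Closure properties of algebra 2-cells -/

section AlgebraCells

open Bicategory

universe w v
variable {D : Type u} [Bicategory.{w, v} D] [Strict D] {S : TwoMonad D}
  {X Y Z W : D} {A : StrictAlg S X} {B : StrictAlg S Y} {E : StrictAlg S Z} {H : StrictAlg S W}

attribute [local simp] Strict.leftUnitor_eqToIso Strict.rightUnitor_eqToIso
  Strict.associator_eqToIso PrelaxFunctor.map₂_eqToHom

namespace IsAlg2Cell

lemma comp {f g h : X ⟶ Y} {F : PsMorStr A B f} {G : PsMorStr A B g} {K : PsMorStr A B h}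
    {α : f ⟶ g} {β : g ⟶ h} (hα : IsAlg2Cell F G α) (hβ : IsAlg2Cell G K β) :
    IsAlg2Cell F K (α ≫ β) :=
  PsMor.Cell.isCell (CategoryStruct.comp (X := PsMor.mk f F) (Y := PsMor.mk g G)
    (Z := PsMor.mk h K) ⟨α, hα⟩ ⟨β, hβ⟩)

lemma inv {f g : X ⟶ Y} {F : PsMorStr A B f} {G : PsMorStr A B g} {α : f ≅ g}
    (hα : IsAlg2Cell F G α.hom) : IsAlg2Cell G F α.inv := by
  simp only [IsAlg2Cell] at hα ⊢
  have h1 : S.map₂ α.inv ▷ B.str ≫ S.map₂ α.hom ▷ B.str = 𝟙 _ := by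
    rw [← comp_whiskerRight, ← S.map₂_comp]; simp
  have h2 : A.str ◁ α.hom ≫ A.str ◁ α.inv = 𝟙 _ := by
    rw [← whiskerLeft_comp]; simp
  have h3 := congrArg (fun t => S.map₂ α.inv ▷ B.str ≫ t ≫ A.str ◁ α.inv) hα
  simp only [Category.assoc, h2, reassoc_of% h1, Category.comp_id] at h3
  exact h3.symm

lemma whiskerRight {f f' : X ⟶ Y} {F : PsMorStr A B f} {F' : PsMorStr A B f'} {α : f ⟶ f'}
    (hα : IsAlg2Cell F F' α) {g : Y ⟶ Z} (G : PsMorStr B E g) :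
    IsAlg2Cell (F.comp G) (F'.comp G) (α ▷ g) := by
  simp only [IsAlg2Cell] at hα ⊢
  have h1 := congrArg (fun t => t ▷ g) hα
  simp only [comp_whiskerRight] at h1
  have h2 := whisker_exchange (S.map₂ α) G.iso.hom
  simp [PsMorStr.comp, S.mapComp_eq_eqToIso] at h1 h2 ⊢
  -- The interchange law for `S α` and the structure cell of `g`, padded with the identity 2-cells
  -- that rebracket the composites and with the remaining factor of the structure of `f' ≫ g`.
  have h3 := congrArg (fun t => eqToHom (by rw [S.map_comp, Strict.assoc] :
    S.map (f ≫ g) ≫ E.str = S.map f ≫ S.map g ≫ E.str) ≫ t ≫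
      eqToHom (Strict.assoc (S.map f') B.str g).symm ≫ F'.iso.hom ▷ g ≫
        eqToHom (Strict.assoc A.str f' g)) h2
  simp [reassoc_of% h1] at h3
  rw [← h3]

/-- In a strict bicategory the associator is an identity 2-cell. Both bracketings paste the same
three structure cells, so they differ only by identity 2-cells. -/
lemma associator {f : X ⟶ Y} {g : Y ⟶ Z} {h : Z ⟶ W} (F : PsMorStr A B f)
    (G : PsMorStr B E g) (K : PsMorStr E H h) :
    IsAlg2Cell ((F.comp G).comp K) (F.comp (G.comp K)) (α_ f g h).hom := by
  simp [IsAlg2Cell, PsMorStr.comp, PsMorStr.whiskerLeft_congr (S.map_comp f g)]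

lemma rightUnitor_inv {f : X ⟶ Y} (F : PsMorStr A B f) :
    IsAlg2Cell F (F.comp (PsMorStr.id B)) (ρ_ f).inv := by
  simp [IsAlg2Cell, PsMorStr.comp, PsMorStr.id]

end IsAlg2Cell

end AlgebraCells

/-! ### Strict algebras are monoidal categories of kind `κ` -/

section StrictActions

open MonoidalCategory Limits

universe v

variable {κ : Variant} {X : Type u} [Category.{v} X]

/-- A strict action of the free monoidal category monad on a category. -/
structure StrictAct (a : FreeMon κ X ⥤ X) : Prop where
  incl_comp : FreeMon.incl κ X ⋙ a = 𝟭 X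
  map_comp : FreeMon.mapFunctor κ a ⋙ a = FreeMon.mult κ X ⋙ a

/-- The morphism `f` is the value of `a` at the formal morphism `φ`, up to equalities of objects. -/
structure Represents (a : FreeMon κ X ⥤ X) {T U : FreeMon κ X} (φ : T ⟶ U) {x y : X}
    (f : x ⟶ y) : Prop where
  src : a.obj T = x
  tgt : a.obj U = y
  heq : HEq (a.map φ) f

namespace StrictAct

variable {a : FreeMon κ X ⥤ X} (ha : StrictAct a)
include ha

lemma obj_of (x : X) : a.obj (.of x) = x := Functor.congr_obj ha.incl_comp x

/-- The law `map_comp` at the two-layer formal tensor of `T` and `U`: flattening it gives `T ⊗ U`,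
while evaluating the inner layer first gives the tensor of two generators. -/
lemma obj_tensor {T U : FreeMon κ X} {x y : X} (hT : a.obj T = x) (hU : a.obj U = y) :
    a.obj (.tensor T U) = a.obj (.tensor (.of x) (.of y)) := by
  subst hT hU
  exact (Functor.congr_obj ha.map_comp (.tensor (.of T) (.of U))).symm

lemma represents_of {x y : X} (f : x ⟶ y) : Represents a ((FreeMon.incl κ X).map f) f :=
  ⟨ha.obj_of x, ha.obj_of y, congr_arg_heq (fun G : X ⥤ X => G.map f) ha.incl_comp⟩

/-- The monoidal category structure underlying a strict action. -/
@[reducible]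
def monoidalStruct : MonoidalCategoryStruct X where
  tensorObj x y := a.obj (.tensor (.of x) (.of y))
  tensorUnit := a.obj .unit
  tensorHom f g := a.map (FreeMon.tensorMap ((FreeMon.incl κ X).map f) ((FreeMon.incl κ X).map g))
  whiskerLeft x _ _ g :=
    a.map (FreeMon.tensorMap ((FreeMon.incl κ X).map (𝟙 x)) ((FreeMon.incl κ X).map g))
  whiskerRight f y :=
    a.map (FreeMon.tensorMap ((FreeMon.incl κ X).map f) ((FreeMon.incl κ X).map (𝟙 y)))
  associator x y z :=
    eqToIso (ha.obj_tensor (T := .tensor (.of x) (.of y)) rfl (ha.obj_of z)).symm ≪≫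
      a.mapIso (α_ (FreeMon.of x) (FreeMon.of y) (FreeMon.of z)) ≪≫
      eqToIso (ha.obj_tensor (U := .tensor (.of y) (.of z)) (ha.obj_of x) rfl)
  leftUnitor x := eqToIso (ha.obj_tensor (T := .unit) rfl (ha.obj_of x)).symm ≪≫
      a.mapIso (λ_ (FreeMon.of x)) ≪≫ eqToIso (ha.obj_of x)
  rightUnitor x := eqToIso (ha.obj_tensor (U := .unit) (ha.obj_of x) rfl).symm ≪≫
      a.mapIso (ρ_ (FreeMon.of x)) ≪≫ eqToIso (ha.obj_of x)

end StrictAct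

namespace Represents

variable {a : FreeMon κ X ⥤ X}

/-- The transfer principle: an equation that holds between formal morphisms holds between the
morphisms they represent. All axioms of the structure on `X` are obtained in this way. -/
lemma unique {T U : FreeMon κ X} {φ ψ : T ⟶ U} {x y : X} {f g : x ⟶ y}
    (hf : Represents a φ f) (hg : Represents a ψ g) (h : φ = ψ) : f = g := by
  subst h
  exact eq_of_heq (hf.heq.symm.trans hg.heq)

lemma comp {T U V : FreeMon κ X} {φ : T ⟶ U} {ψ : U ⟶ V} {x y z : X} {f : x ⟶ y} {g : y ⟶ z}
    (hf : Represents a φ f) (hg : Represents a ψ g) : Represents a (φ ≫ ψ) (f ≫ g) :=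
  ⟨hf.src, hg.tgt, by
    rw [a.map_comp]; exact FreeMon.heq_comp hf.src hf.tgt hg.tgt hf.heq hg.heq⟩

lemma id {T : FreeMon κ X} {x : X} (h : a.obj T = x) : Represents a (𝟙 T) (𝟙 x) :=
  ⟨h, h, by subst h; simp⟩

lemma heq_conj {x y x' y' : X} (h : x = x') (h' : y' = y) (f : x' ⟶ y') :
    HEq f (eqToHom h ≫ f ≫ eqToHom h') := by
  subst h h'; simp

lemma iso_inv {T U : FreeMon κ X} {φ : T ≅ U} {x y : X} {f : x ≅ y}
    (hf : Represents a φ.hom f.hom) : Represents a φ.inv f.inv := by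
  obtain ⟨rfl, rfl, h⟩ := hf
  obtain rfl : a.mapIso φ = f := Iso.ext (eq_of_heq h)
  exact ⟨rfl, rfl, HEq.rfl⟩

variable (ha : StrictAct a)
include ha

/-- As in `obj_tensor`, now with `map_comp` applied to the two-layer tensor of the morphisms `φ` and
`ψ`. -/
lemma tensor {T U T' U' : FreeMon κ X} {φ : T ⟶ U} {ψ : T' ⟶ U'} {x y x' y' : X} {f : x ⟶ y}
    {g : x' ⟶ y'} (hf : Represents a φ f) (hg : Represents a ψ g) :
    Represents a (φ ⊗ₘ ψ) (ha.monoidalStruct.tensorHom f g) := by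
  obtain ⟨rfl, rfl, hf⟩ := hf
  obtain ⟨rfl, rfl, hg⟩ := hg
  cases hf
  cases hg
  exact ⟨ha.obj_tensor rfl rfl, ha.obj_tensor rfl rfl,
    (congr_arg_heq (fun G : FreeMon κ (FreeMon κ X) ⥤ X =>
      G.map (FreeMon.tensorMap ((FreeMon.incl κ _).map φ) ((FreeMon.incl κ _).map ψ)))
        ha.map_comp).symm⟩

/-- The associator of `X` is defined through generators only. The law `map_comp` at a two-layer
associator carries this over to arbitrary formal objects, and the `eqToHom`s in the definition
vanish up to `HEq`. The unitors are treated alike. -/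
lemma associator {T U V : FreeMon κ X} {x y z : X} (hT : a.obj T = x) (hU : a.obj U = y)
    (hV : a.obj V = z) :
    Represents a (α_ T U V).hom (ha.monoidalStruct.associator x y z).hom := by
  subst hT hU hV
  refine ⟨ha.obj_tensor (ha.obj_tensor rfl rfl) rfl, ha.obj_tensor rfl (ha.obj_tensor rfl rfl), ?_⟩
  exact (congr_arg_heq (fun G : FreeMon κ (FreeMon κ X) ⥤ X =>
      G.map (α_ (FreeMon.of T) (FreeMon.of U) (FreeMon.of V)).hom) ha.map_comp).symm.trans
    (heq_conj (ha.obj_tensor (T := .tensor (.of _) (.of _)) rfl (ha.obj_of _)).symm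
      (ha.obj_tensor (U := .tensor (.of _) (.of _)) (ha.obj_of _) rfl) _)

lemma leftUnitor {T : FreeMon κ X} {x : X} (hT : a.obj T = x) :
    Represents a (λ_ T).hom (ha.monoidalStruct.leftUnitor x).hom := by
  subst hT
  refine ⟨ha.obj_tensor (T := .unit) rfl rfl, rfl, ?_⟩
  exact (congr_arg_heq (fun G : FreeMon κ (FreeMon κ X) ⥤ X =>
      G.map (λ_ (FreeMon.of T)).hom) ha.map_comp).symm.trans
    (heq_conj (ha.obj_tensor (T := .unit) rfl (ha.obj_of _)).symm (ha.obj_of _) _)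

lemma rightUnitor {T : FreeMon κ X} {x : X} (hT : a.obj T = x) :
    Represents a (ρ_ T).hom (ha.monoidalStruct.rightUnitor x).hom := by
  subst hT
  refine ⟨ha.obj_tensor (U := .unit) rfl rfl, rfl, ?_⟩
  exact (congr_arg_heq (fun G : FreeMon κ (FreeMon κ X) ⥤ X =>
      G.map (ρ_ (FreeMon.of T)).hom) ha.map_comp).symm.trans
    (heq_conj (ha.obj_tensor (U := .unit) (ha.obj_of _) rfl).symm (ha.obj_of _) _)

end Represents

namespace StrictAct

variable {a : FreeMon κ X ⥤ X} (ha : StrictAct a)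
include ha

/-- The monoidal category underlying a strict action. -/
@[reducible]
def monoidal : MonoidalCategory X :=
  letI := ha.monoidalStruct
  MonoidalCategory.ofTensorHom
    -- Each axiom is proved by representing both sides by formal morphisms and quoting the same
    -- axiom in `FreeMon κ X`.
    (id_tensorHom_id := fun x y =>
      ((Represents.id (ha.obj_of x)).tensor ha (.id (ha.obj_of y))).unique
        (.id rfl) (id_tensorHom_id _ _))
    (id_tensorHom := fun _ _ _ _ => rfl)
    (tensorHom_id := fun _ _ => rfl)
    (tensorHom_comp_tensorHom := fun f₁ f₂ g₁ g₂ =>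
      (((ha.represents_of f₁).tensor ha (ha.represents_of f₂)).comp
        ((ha.represents_of g₁).tensor ha (ha.represents_of g₂))).unique
        (((ha.represents_of f₁).comp (ha.represents_of g₁)).tensor ha
          ((ha.represents_of f₂).comp (ha.represents_of g₂)))
        (tensorHom_comp_tensorHom _ _ _ _))
    (associator_naturality := fun f g h =>
      ((((ha.represents_of f).tensor ha (ha.represents_of g)).tensor ha
          (ha.represents_of h)).comp (.associator ha (ha.obj_of _) (ha.obj_of _)
            (ha.obj_of _))).unique
        ((Represents.associator ha (ha.obj_of _) (ha.obj_of _) (ha.obj_of _)).comp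
          ((ha.represents_of f).tensor ha ((ha.represents_of g).tensor ha (ha.represents_of h))))
        (associator_naturality _ _ _))
    (leftUnitor_naturality := fun f =>
      (((Represents.id (T := .unit) rfl).tensor ha (ha.represents_of f)).comp
        (.leftUnitor ha (ha.obj_of _))).unique
        ((Represents.leftUnitor ha (ha.obj_of _)).comp (ha.represents_of f))
        (leftUnitor_naturality (C := FreeMon κ X) ((FreeMon.incl κ X).map f)))
    (rightUnitor_naturality := fun f =>
      (((ha.represents_of f).tensor ha (Represents.id (T := .unit) rfl)).comp
        (.rightUnitor ha (ha.obj_of _))).unique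
        ((Represents.rightUnitor ha (ha.obj_of _)).comp (ha.represents_of f))
        (rightUnitor_naturality (C := FreeMon κ X) ((FreeMon.incl κ X).map f)))
    (pentagon := fun w x y z => by
      have hw := ha.obj_of w
      have hx := ha.obj_of x
      have hy := ha.obj_of y
      have hz := ha.obj_of z
      -- A tensor product in `X` has to be represented by a formal tensor here, not by a generator,
      -- so that the formal pentagon applies.
      have h (u v : X) : a.obj (FreeMon.of u ⊗ FreeMon.of v) = u ⊗ v := rfl
      exact (((Represents.associator ha hw hx hy).tensor ha (.id hz)).comp
        ((Represents.associator ha hw (h x y) hz).comp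
          ((Represents.id hw).tensor ha (.associator ha hx hy hz)))).unique
        ((Represents.associator ha (h w x) hy hz).comp (.associator ha hw hx (h y z)))
        (by simp))
    (triangle := fun x y => by
      have hx := ha.obj_of x
      have hy := ha.obj_of y
      exact ((Represents.associator ha hx (U := .unit) rfl hy).comp
        ((Represents.id hx).tensor ha (.leftUnitor ha hy))).unique
        ((Represents.rightUnitor ha hx).tensor ha (.id hy)) (by
          rw [id_tensorHom, tensorHom_id]; exact triangle _ _))

/-- The braiding of a strict action, for the symmetric kinds. -/
def braiding (h : κ.symmetric = true) (x y : X) :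
    ha.monoidalStruct.tensorObj x y ≅ ha.monoidalStruct.tensorObj y x :=
  a.mapIso (FreeMon.braiding h (.of x) (.of y))

lemma represents_braiding (h : κ.symmetric = true) {T U : FreeMon κ X} {x y : X}
    (hT : a.obj T = x) (hU : a.obj U = y) :
    Represents a (FreeMon.braiding h T U).hom (ha.braiding h x y).hom := by
  subst hT hU
  refine ⟨ha.obj_tensor rfl rfl, ha.obj_tensor rfl rfl, ?_⟩
  exact (congr_arg_heq (fun G : FreeMon κ (FreeMon κ X) ⥤ X =>
      G.map (FreeMon.braiding h (FreeMon.of T) (FreeMon.of U)).hom) ha.map_comp).symm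

/-- The symmetric monoidal category underlying a strict action, for the symmetric kinds. -/
@[reducible]
def symmetric (h : κ.symmetric = true) : @SymmetricCategory X _ ha.monoidal :=
  letI := ha.monoidal
  letI : SymmetricCategory (FreeMon κ X) := FreeMon.symmetricCategory h
  have B {T U : FreeMon κ X} {x y : X} (hT : a.obj T = x) (hU : a.obj U = y) :
      Represents a (β_ T U).hom (ha.braiding h x y).hom := ha.represents_braiding h hT hU
  have O := ha.obj_of
  have OO (u v : X) : a.obj (FreeMon.of u ⊗ FreeMon.of v) = u ⊗ v := rfl
  { braiding := ha.braiding h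
    braiding_naturality_right := fun x _ _ f =>
      (((Represents.id (O x)).tensor ha (ha.represents_of f)).comp (B (O _) (O _))).unique
        ((B (O _) (O _)).comp ((ha.represents_of f).tensor ha (.id (O x))))
        (BraidedCategory.braiding_naturality _ _)
    braiding_naturality_left := fun f x =>
      (((ha.represents_of f).tensor ha (.id (O x))).comp (B (O _) (O _))).unique
        ((B (O _) (O _)).comp ((Represents.id (O x)).tensor ha (ha.represents_of f)))
        (BraidedCategory.braiding_naturality _ _)
    hexagon_forward := fun x y z =>
      ((Represents.associator ha (O x) (O y) (O z)).comp
        ((B (O x) (OO y z)).comp (.associator ha (O y) (O z) (O x)))).unique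
        (((B (O x) (O y)).tensor ha (.id (O z))).comp
          ((Represents.associator ha (O y) (O x) (O z)).comp
            ((Represents.id (O y)).tensor ha (B (O x) (O z)))))
        (by simp)
    hexagon_reverse := fun x y z =>
      ((Represents.associator ha (O x) (O y) (O z)).iso_inv.comp
        ((B (OO x y) (O z)).comp (Represents.associator ha (O z) (O x) (O y)).iso_inv)).unique
        (((Represents.id (O x)).tensor ha (B (O y) (O z))).comp
          ((Represents.associator ha (O x) (O z) (O y)).iso_inv.comp
            ((B (O x) (O z)).tensor ha (.id (O y)))))
        (by simp)
    symmetry := fun x y =>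
      ((B (O x) (O y)).comp (B (O y) (O x))).unique (.id rfl) (by simp) }

lemma represents_toUnit (h : κ.terminalUnit = true) (x : X) :
    Represents a (FreeMon.homMk (.toUnit h (.of x)))
      (eqToHom (ha.obj_of x).symm ≫ a.map (FreeMon.homMk (.toUnit h (.of x)))) :=
  ⟨ha.obj_of x, rfl, by simp⟩

/-- Needed for the uniqueness of maps into the unit: a morphism `m` into `a.obj .unit` is
represented by a formal map into a generator, about which nothing is known. Composing it with this
representative of the identity gives a formal map into the formal unit, which is terminal. -/
lemma represents_toUnit_unit (h : κ.terminalUnit = true) :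
    Represents a (FreeMon.homMk (.toUnit h (.of (a.obj .unit)))) (𝟙 (a.obj .unit)) := by
  refine ⟨ha.obj_of _, rfl, ?_⟩
  refine (congr_arg_heq (fun G : FreeMon κ (FreeMon κ X) ⥤ X =>
      G.map (FreeMon.homMk (.toUnit h (FreeMon.of FreeMon.unit)))) ha.map_comp).trans
      (heq_of_eq ?_)
  -- Flattening turns the two-layer map into the canonical endomorphism of the formal unit, which is
  -- the identity by terminality.
  change a.map (FreeMon.homMk (.toUnit h .unit)) = _
  rw [← a.map_id]
  exact congrArg a.map ((VMonoidal.term (κ := κ) (D := FreeMon κ X) h).hom_ext _ _)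

/-- The monoidal category of kind `κ` underlying a strict action. -/
@[reducible]
def vmonoidal : VMonoidal κ X :=
  { ha.monoidal with
    symm := ha.symmetric
    term := fun h => IsTerminal.ofUniqueHom
      (fun x => eqToHom (ha.obj_of x).symm ≫ a.map (FreeMon.homMk (.toUnit h (.of x))))
      (fun x m => (Category.comp_id m).symm.trans
        (((ha.represents_of m).comp (ha.represents_toUnit_unit h)).unique
          (ha.represents_toUnit h x)
          ((VMonoidal.term (κ := κ) (D := FreeMon κ X) h).hom_ext _ _))) }

/-- The lemmas on `Represents` say that `a` preserves the structure on the nose. A functor with this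
property is determined by its restriction to the generators, which is the identity for both sides.
-/
lemma eq_lift : letI := ha.vmonoidal; a = FreeMon.lift (𝟭 X) := by
  let _ := ha.vmonoidal
  refine FreeMon.IsStrict.hom_ext (κ := κ) ?_
    ⟨rfl, fun _ _ => rfl, fun _ _ => HEq.rfl, fun _ _ _ => HEq.rfl, fun _ _ _ => HEq.rfl,
      fun _ => HEq.rfl, fun _ => HEq.rfl, fun _ => HEq.rfl, fun _ => HEq.rfl,
      fun _ _ _ => HEq.rfl, fun _ _ => HEq.rfl⟩ ha.incl_comp
  exact
    { obj_unit := rfl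
      obj_tensor := fun X Y => ha.obj_tensor rfl rfl
      tensor := fun f g => (Represents.tensor ha (φ := FreeMon.homMk f) (ψ := FreeMon.homMk g)
        ⟨rfl, rfl, HEq.rfl⟩ ⟨rfl, rfl, HEq.rfl⟩).heq
      assocHom := fun X Y Z => (Represents.associator ha rfl rfl rfl).heq
      assocInv := fun X Y Z => (Represents.associator ha rfl rfl rfl).iso_inv.heq
      leftHom := fun X => (Represents.leftUnitor ha rfl).heq
      leftInv := fun X => (Represents.leftUnitor ha rfl).iso_inv.heq
      rightHom := fun X => (Represents.rightUnitor ha rfl).heq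
      rightInv := fun X => (Represents.rightUnitor ha rfl).iso_inv.heq
      braid := fun h X Y => (ha.represents_braiding h rfl rfl).heq
      toUnit := fun h T =>
        heq_of_eq ((VMonoidal.term (κ := κ) (D := X) h).hom_ext _ _) }

end StrictAct
end StrictActions

section StrictAlgebras

variable {κ : Variant} {X : CAT.{u}}

/-- The strict algebra given by a monoidal structure of kind `κ`. -/
def algOf (M : VMonoidal κ X.toCat) : StrictAlg (freeMonad κ) X where
  str := CAT.homOf (X := (freePseudofunctor κ).obj X) (FreeMon.lift (𝟭 X.toCat))
  assoc := CAT.hom_ext ((FreeMon.lift_comp_lift _ _).trans (FreeMon.lift_comp_lift (𝟭 (FreeMon κ X.toCat)) (𝟭 X.toCat)).symm)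
  unit := CAT.hom_ext (FreeMon.incl_lift (κ := κ) (𝟭 X.toCat))

lemma StrictAlg.strictAct (A : StrictAlg (freeMonad κ) X) : StrictAct (CAT.functor A.str) where
  incl_comp := congrArg CAT.functor A.unit
  map_comp := congrArg CAT.functor A.assoc

/-- This turns every statement about strict algebras into one about monoidal categories; the
equality is strict, so `A` can be substituted away. -/
lemma exists_eq_algOf (A : StrictAlg (freeMonad κ) X) :
    ∃ M : VMonoidal κ X.toCat, A = algOf M := by
  refine ⟨A.strictAct.vmonoidal, ?_⟩
  have h : A.str = (algOf A.strictAct.vmonoidal).str := CAT.hom_ext A.strictAct.eq_lift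
  cases A
  generalize algOf _ = B at h
  cases B
  cases h
  rfl

end StrictAlgebras

/-! ### Strong monoidal functors and formal tensor products -/

section StrongFunctors

open MonoidalCategory

universe v v' u'

variable {κ : Variant} {C : Type u} [Category.{v} C] [VMonoidal κ C] {D : Type u'}
  [Category.{v'} D] [VMonoidal κ D] {F : C ⥤ D}

variable (κ) in
/-- Compatibility of a strong monoidal functor with the symmetries, for the symmetric kinds. -/
def PreservesBraiding (c : F.CoreMonoidal) : Prop :=
  ∀ (h : κ.symmetric = true) (x y : C),
    (c.μIso x y).hom ≫ F.map ((VMonoidal.symm (D := C) h).braiding x y).hom =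
      ((VMonoidal.symm (D := D) h).braiding (F.obj x) (F.obj y)).hom ≫ (c.μIso y x).hom

namespace FreeMon

variable (κ F) in
/-- Apply `F`, then evaluate. -/
def evalAfter : FreeMon κ C ⥤ D := mapFunctor κ F ⋙ lift (𝟭 D)

/-- The comparison of a strong monoidal functor on iterated tensor products. -/
def coreIso (c : F.CoreMonoidal) :
    ∀ T : FreeMon κ C, (evalAfter κ F).obj T ≅ F.obj ((lift (𝟭 C)).obj T)
  | .of _ => Iso.refl _
  | .unit => c.εIso
  | .tensor T U => (coreIso c T ⊗ᵢ coreIso c U) ≪≫ c.μIso _ _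

/-- Induction on the formal morphism: each generator contributes exactly one axiom of a strong
(symmetric) monoidal functor, except for the map to a terminal unit, where uniqueness suffices. -/
lemma coreIso_naturality (c : F.CoreMonoidal) (hc : PreservesBraiding κ c) {T U : FreeMon κ C}
    (φ : FreeHom κ C T U) :
    (evalAfter κ F).map (homMk φ) ≫ (coreIso c U).hom =
      (coreIso c T).hom ≫ F.map ((lift (𝟭 C)).map (homMk φ)) := by
  have hμ {x x' y y' : C} (f : x ⟶ x') (g : y ⟶ y') :
      (F.map f ⊗ₘ F.map g) ≫ (c.μIso x' y').hom = (c.μIso x y).hom ≫ F.map (f ⊗ₘ g) := by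
    rw [MonoidalCategory.tensorHom_def, MonoidalCategory.tensorHom_def, Category.assoc,
      c.μIso_hom_natural_right, c.μIso_hom_natural_left_assoc, F.map_comp]
  have assoc (X Y Z : FreeMon κ C) : (evalAfter κ F).map (α_ X Y Z).hom ≫
      (coreIso c (X ⊗ Y ⊗ Z)).hom = (coreIso c ((X ⊗ Y) ⊗ Z)).hom ≫
        F.map ((lift (𝟭 C)).map (α_ X Y Z).hom) := by
    have h := c.associativity ((lift (𝟭 C)).obj X) ((lift (𝟭 C)).obj Y) ((lift (𝟭 C)).obj Z)
    change (α_ _ _ _).hom ≫ ((coreIso c X).hom ⊗ₘ (((coreIso c Y).hom ⊗ₘ (coreIso c Z).hom) ≫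
      (c.μIso _ _).hom)) ≫ (c.μIso _ _).hom =
      ((((((coreIso c X).hom ⊗ₘ (coreIso c Y).hom) ≫ (c.μIso _ _).hom)) ⊗ₘ (coreIso c Z).hom) ≫
      (c.μIso _ _).hom) ≫ F.map (α_ _ _ _).hom
    rw [← tensorHom_comp_whiskerLeft, ← tensorHom_comp_whiskerRight]
    simp only [Category.assoc]
    rw [h, associator_naturality_assoc]
  have left (X : FreeMon κ C) : (evalAfter κ F).map (λ_ X).hom ≫
      (coreIso c X).hom = (coreIso c (𝟙_ _ ⊗ X)).hom ≫
        F.map ((lift (𝟭 C)).map (λ_ X).hom) := by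
    have h := c.left_unitality ((lift (𝟭 C)).obj X)
    change (λ_ _).hom ≫ _ = ((c.εIso.hom ⊗ₘ (coreIso c X).hom) ≫ (c.μIso _ _).hom) ≫
      F.map (λ_ _).hom
    rw [← leftUnitor_naturality, h, tensorHom_def', Category.assoc, Category.assoc]
  have right (X : FreeMon κ C) : (evalAfter κ F).map (ρ_ X).hom ≫
      (coreIso c X).hom = (coreIso c (X ⊗ 𝟙_ _)).hom ≫
        F.map ((lift (𝟭 C)).map (ρ_ X).hom) := by
    have h := c.right_unitality ((lift (𝟭 C)).obj X)
    change (ρ_ _).hom ≫ _ = (((coreIso c X).hom ⊗ₘ c.εIso.hom) ≫ (c.μIso _ _).hom) ≫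
      F.map (ρ_ _).hom
    rw [← rightUnitor_naturality, h, MonoidalCategory.tensorHom_def, Category.assoc,
      Category.assoc]
  -- Naturality at an isomorphism implies naturality at its inverse, which settles the inverse
  -- constraints.
  have inv {X Y : FreeMon κ C} (i : X ≅ Y) (h : (evalAfter κ F).map i.hom ≫ (coreIso c Y).hom =
      (coreIso c X).hom ≫ F.map ((lift (𝟭 C)).map i.hom)) :
      (evalAfter κ F).map i.inv ≫ (coreIso c X).hom =
        (coreIso c Y).hom ≫ F.map ((lift (𝟭 C)).map i.inv) := by
    rw [← cancel_epi ((evalAfter κ F).map i.hom), reassoc_of% h, ← Functor.map_comp_assoc]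
    simp [← Functor.map_comp]
  induction φ with
  | of f => exact (Category.comp_id _).trans (Category.id_comp _).symm
  | id X =>
    change (evalAfter κ F).map (𝟙 X) ≫ _ = _ ≫ F.map ((lift (𝟭 C)).map (𝟙 X))
    simp
  | @comp X Y Z f g ihf ihg =>
    change (evalAfter κ F).map (homMk f ≫ homMk g) ≫ _ =
      _ ≫ F.map ((lift (𝟭 C)).map (homMk f ≫ homMk g))
    rw [Functor.map_comp, Functor.map_comp, F.map_comp, Category.assoc, ihg, reassoc_of% ihf]
  | @tensor X X' Y Y' f g ihf ihg =>
    have h : (evalAfter κ F).map (homMk (f.tensor g)) =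
        (evalAfter κ F).map (homMk f) ⊗ₘ (evalAfter κ F).map (homMk g) :=
      (congrArg (lift (𝟭 D)).map (lift_map_tensorMap _ (homMk f) (homMk g))).trans
        (lift_map_tensorMap (𝟭 D) _ _)
    rw [h]
    change _ ≫ ((coreIso c _).hom ⊗ₘ (coreIso c _).hom) ≫ (c.μIso _ _).hom =
      (((coreIso c _).hom ⊗ₘ (coreIso c _).hom) ≫ (c.μIso _ _).hom) ≫
        F.map ((lift (𝟭 C)).map (homMk f) ⊗ₘ (lift (𝟭 C)).map (homMk g))
    rw [Category.assoc, ← hμ, tensorHom_comp_tensorHom_assoc, tensorHom_comp_tensorHom_assoc,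
      ihf, ihg]
  | assocHom X Y Z => exact assoc X Y Z
  | assocInv X Y Z => exact inv (α_ X Y Z) (assoc X Y Z)
  | leftHom X => exact left X
  | leftInv X => exact inv (λ_ X) (left X)
  | rightHom X => exact right X
  | rightInv X => exact inv (ρ_ X) (right X)
  | braid h X Y =>
    let _ : SymmetricCategory C := VMonoidal.symm h
    let _ : SymmetricCategory D := VMonoidal.symm h
    have h1 := hc h ((lift (𝟭 C)).obj X) ((lift (𝟭 C)).obj Y)
    have h2 := BraidedCategory.braiding_naturality (coreIso c X).hom (coreIso c Y).hom
    change (β_ _ _).hom ≫ (_ ⊗ₘ _) ≫ (c.μIso _ _).hom =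
      ((_ ⊗ₘ _) ≫ (c.μIso _ _).hom) ≫ F.map (β_ _ _).hom
    rw [Category.assoc]
    exact ((reassoc_of% h2) (c.μIso _ _).hom).symm.trans (congrArg (_ ≫ ·) h1.symm)
  | toUnit h X =>
    -- `F` sends the unit to an object isomorphic to the unit of `D`, so after this cancellation
    -- both sides end in a terminal object.
    rw [← cancel_mono (coreIso c unit).inv]
    exact (VMonoidal.term h).hom_ext _ _

/-- `coreIso` as a natural isomorphism. -/
def coreNatIso (c : F.CoreMonoidal) (hc : PreservesBraiding κ c) :
    mapFunctor κ F ⋙ lift (𝟭 D) ≅ lift (𝟭 C) ⋙ F :=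
  NatIso.ofComponents (coreIso c) (by rintro T U ⟨φ⟩; exact coreIso_naturality c hc φ)

omit [VMonoidal κ C] in
lemma eqToHom_tensorHom {x y x' y' : D} (h : x = y) (h' : x' = y') :
    eqToHom h ⊗ₘ eqToHom h' = eqToHom (by rw [h, h']) := by
  subst h h'; simp

/-- The pointwise form of the multiplication axiom of a pseudomorphism: the comparison on a
flattened formal tensor can be made in two stages, first inside each inner tensor and then on the
outer shape. The objects involved agree only by induction on `T`, hence the `HEq` and the `eqToHom`.
-/
lemma coreIso_mult (c : F.CoreMonoidal) (hc : PreservesBraiding κ c)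
    (T : FreeMon κ (FreeMon κ C)) (h : (lift (𝟭 D)).obj ((mapFunctor κ (lift (𝟭 C) ⋙ F)).obj T) =
      (evalAfter κ F).obj ((mapFunctor κ (lift (𝟭 C))).obj T)) :
    HEq (coreIso c ((mult κ C).obj T)).hom
      ((lift (𝟭 D)).map ((mapNat κ (coreNatIso c hc).hom).app T) ≫ eqToHom h ≫
        (coreIso c ((mapFunctor κ (lift (𝟭 C))).obj T)).hom) := by
  have o1 (T : FreeMon κ (FreeMon κ C)) : (evalAfter κ F).obj ((mult κ C).obj T) =
      (lift (𝟭 D)).obj ((mapFunctor κ (mapFunctor κ F ⋙ lift (𝟭 D))).obj T) := by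
    induction T with
    | of => rfl
    | unit => rfl
    | tensor _ _ ih ih' => exact congr($ih ⊗ $ih')
  have o2 (T : FreeMon κ (FreeMon κ C)) : (lift (𝟭 C)).obj ((mult κ C).obj T) =
      (lift (𝟭 C)).obj ((mapFunctor κ (lift (𝟭 C))).obj T) := by
    induction T with
    | of => rfl
    | unit => rfl
    | tensor _ _ ih ih' => exact congr($ih ⊗ $ih')
  have o3 (T : FreeMon κ (FreeMon κ C)) :
      (lift (𝟭 D)).obj ((mapFunctor κ (lift (𝟭 C) ⋙ F)).obj T) =
      (evalAfter κ F).obj ((mapFunctor κ (lift (𝟭 C))).obj T) := by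
    induction T with
    | of => rfl
    | unit => rfl
    | tensor _ _ ih ih' => exact congr($ih ⊗ $ih')
  induction T with
  | of T => exact heq_of_eq (((congrArg (_ ≫ ·) (Category.comp_id _)).trans
      (Category.comp_id _)).symm)
  | unit => exact heq_of_eq (((Category.id_comp _).trans (Category.id_comp _)).symm)
  | tensor T U ihT ihU =>
    have h1 := ihT (o3 T)
    have h2 := ihU (o3 U)
    have hm := lift_map_tensorMap (𝟭 D) ((mapNat κ (coreNatIso c hc).hom).app T)
      ((mapNat κ (coreNatIso c hc).hom).app U)
    -- Both comparisons at a tensor are the tensor product of the comparisons at the factors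
    -- followed by `μIso`. The first part is treated here, the second in `h4`.
    have h3 := heq_tensor (o1 T) (congrArg F.obj (o2 T)) (o1 U) (congrArg F.obj (o2 U)) h1 h2
    rw [← tensorHom_comp_tensorHom, ← tensorHom_comp_tensorHom, ← hm, eqToHom_tensorHom] at h3
    have h4 : HEq (c.μIso ((lift (𝟭 C)).obj ((mult κ C).obj T))
        ((lift (𝟭 C)).obj ((mult κ C).obj U))).hom
      (c.μIso ((lift (𝟭 C)).obj ((mapFunctor κ (lift (𝟭 C))).obj T))
        ((lift (𝟭 C)).obj ((mapFunctor κ (lift (𝟭 C))).obj U))).hom := by rw [o2 T, o2 U]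
    refine (heq_comp ?_ ?_ ?_ h3 h4).trans (heq_of_eq ?_)
    · exact congr($(o1 T) ⊗ $(o1 U))
    · exact congr(F.obj $(o2 T) ⊗ F.obj $(o2 U))
    · exact congr(F.obj ($(o2 T) ⊗ $(o2 U)))
    · exact (Category.assoc _ _ _).trans (congrArg (_ ≫ ·) (Category.assoc _ _ _))

end FreeMon

end StrongFunctors

/-! ### Pseudomorphisms are strong monoidal functors -/

section Pseudomorphisms

open MonoidalCategory Bicategory FreeMon

variable {κ : Variant} {X Y : CAT.{u}} {M : VMonoidal κ X.toCat} {N : VMonoidal κ Y.toCat}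
  {f : X ⟶ Y}

lemma heq_conj₃ {E : Type*} [Category E] {a b c d a' d' : E} (h : a' = a) (h' : d = d')
    (f : a ⟶ b) (e : b ⟶ c) (g : c ⟶ d) :
    HEq (f ≫ e ≫ g) (eqToHom h ≫ f ≫ e ≫ g ≫ eqToHom h') := by
  subst h h'; simp

lemma CAT.natTrans_conj_app {X Y : CAT.{u}} {f₀ f₁ f₂ f₃ f₄ f₅ : X ⟶ Y} (h : f₀ = f₁)
    (β : f₁ ⟶ f₂) (h' : f₂ = f₃) (γ : f₃ ⟶ f₄) (h'' : f₄ = f₅) (x : X.toCat) :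
    (CAT.natTrans (eqToHom h ≫ β ≫ eqToHom h' ≫ γ ≫ eqToHom h'')).app x =
      eqToHom (by rw [h]) ≫ (CAT.natTrans β).app x ≫ eqToHom (by rw [h']) ≫
        (CAT.natTrans γ).app x ≫ eqToHom (by rw [h'']) := by
  subst h h' h''
  simp
  rfl

/-- The pseudomorphism structure given by a strong monoidal structure. -/
def PsMorStr.ofCore (c : (CAT.functor f).CoreMonoidal) (hc : PreservesBraiding κ c) :
    PsMorStr (algOf M) (algOf N) f where
  iso := InducedBicategory.isoMk (Cat.Hom.isoMk (coreNatIso c hc))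
  unit_coh := CAT.cell_ext fun x => by
    rw [CAT.natTrans_eqToHom]
    rfl
  mul_coh := CAT.cell_ext fun T => by
    refine Eq.trans (eq_of_heq ((coreIso_mult c hc T ?_).trans ?_))
      (CAT.natTrans_conj_app _ _ _ _ _ T).symm
    · exact Functor.congr_obj (congrArg CAT.functor (pm_eq_mul₂ (algOf M) (algOf N) f)) T
    · exact heq_conj₃ _ _ _ _ _

namespace PsMorStr

variable (P : PsMorStr (algOf M) (algOf N) f)

/-- The components of a pseudomorphism structure. -/
def app (T : FreeMon κ X.toCat) : (evalAfter κ (CAT.functor f)).obj T ⟶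
    (CAT.functor f).obj ((FreeMon.lift (𝟭 X.toCat)).obj T) :=
  (CAT.natTrans P.iso.hom).app T

lemma of_app (x : X.toCat) : P.app (.of x) = 𝟙 ((CAT.functor f).obj x) := by
  have := congrArg (fun t => (CAT.natTrans t).app x) P.unit_coh
  exact this.trans (by rw [CAT.natTrans_eqToHom]; rfl)

/-- The multiplication axiom at the two-layer tensor of `T` and `U`. Together with `of_app` it
determines a pseudomorphism structure by its components at the formal unit and at tensors of two
generators. -/
lemma tensor_app (T U : FreeMon κ X.toCat) : P.app (.tensor T U) =
    (P.app T ⊗ₘ P.app U) ≫ P.app (.tensor (.of ((FreeMon.lift (𝟭 X.toCat)).obj T))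
      (.of ((FreeMon.lift (𝟭 X.toCat)).obj U))) := by
  have := congrArg (fun t => (CAT.natTrans t).app (FreeMon.tensor (FreeMon.of T) (FreeMon.of U))) P.mul_coh
  refine this.trans ((CAT.natTrans_conj_app _ _ _ _ _ _).trans ?_)
  -- At this formal object the sources and targets of the `eqToHom`s coincide definitionally, so
  -- these are identities.
  change 𝟙 _ ≫ (P.app T ⊗ₘ P.app U) ≫ 𝟙 _ ≫ P.app (.tensor (.of _) (.of _)) ≫ 𝟙 _ = _
  exact (Category.id_comp _).trans (congrArg (_ ≫ ·) ((Category.id_comp _).trans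
    (Category.comp_id _)))

/-- The components of a pseudomorphism structure are invertible. -/
def appIso (T : FreeMon κ X.toCat) : (evalAfter κ (CAT.functor f)).obj T ≅
    (CAT.functor f).obj ((FreeMon.lift (𝟭 X.toCat)).obj T) where
  hom := P.app T
  inv := (CAT.natTrans P.iso.inv).app T
  hom_inv_id := congrArg (fun t => (CAT.natTrans t).app T) P.iso.hom_inv_id
  inv_hom_id := congrArg (fun t => (CAT.natTrans t).app T) P.iso.inv_hom_id

/-- The comparison of the unit objects. -/
def unitMap : 𝟙_ Y.toCat ⟶ (CAT.functor f).obj (𝟙_ X.toCat) := P.app .unit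

/-- The comparison of the tensor products. -/
def mulMap (x y : X.toCat) : (CAT.functor f).obj x ⊗ (CAT.functor f).obj y ⟶
    (CAT.functor f).obj (x ⊗ y) := P.app (.tensor (.of x) (.of y))

instance : IsIso P.unitMap := (P.appIso .unit).isIso_hom
instance (x y : X.toCat) : IsIso (P.mulMap x y) := (P.appIso (.tensor (.of x) (.of y))).isIso_hom

lemma naturality {T U : FreeMon κ X.toCat} (φ : T ⟶ U) :
    (evalAfter κ (CAT.functor f)).map φ ≫ P.app U =
      P.app T ≫ (CAT.functor f).map ((FreeMon.lift (𝟭 X.toCat)).map φ) :=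
  (CAT.natTrans P.iso.hom).naturality φ

lemma app_tensor (T U : FreeMon κ X.toCat) : P.app (.tensor T U) =
    (P.app T ⊗ₘ P.app U) ≫ P.mulMap _ _ := P.tensor_app T U

/-- The strong monoidal functor given by a pseudomorphism. -/
noncomputable def core : (CAT.functor f).CoreMonoidal where
  εIso := asIso P.unitMap
  μIso x y := asIso (P.mulMap x y)
  μIso_hom_natural_left g y := by
    rw [← tensorHom_id, ← tensorHom_id]
    exact P.naturality (tensorMap ((incl κ _).map g) (𝟙 (of y)))
  μIso_hom_natural_right x g := by
    rw [← id_tensorHom, ← id_tensorHom]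
    exact P.naturality (tensorMap (𝟙 (of x)) ((incl κ _).map g))
  associativity x y z := by
    -- Each coherence axiom is naturality of the structure cell at the corresponding formal
    -- constraint, with both components expanded by `app_tensor`.
    have h := P.naturality (α_ (of x) (of y) (of z)).hom
    have h1 : P.app (.tensor (.of x) (.tensor (.of y) (.of z))) = _ ◁ P.mulMap y z ≫
        P.mulMap x (y ⊗ z) := by
      rw [P.app_tensor, P.of_app, ← id_tensorHom]; rfl
    have h2 : P.app (.tensor (.tensor (.of x) (.of y)) (.of z)) = P.mulMap x y ▷ _ ≫
        P.mulMap (x ⊗ y) z := by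
      rw [P.app_tensor, P.of_app, ← tensorHom_id]; rfl
    have h' := (congrArg (_ ≫ ·) h1.symm).trans (h.trans (congrArg (· ≫ _) h2))
    exact ((Category.assoc _ _ _).symm.trans h'.symm)
  left_unitality x := by
    have h := P.naturality (λ_ (of x)).hom
    have h2 : P.app (.tensor .unit (.of x)) = P.unitMap ▷ _ ≫ P.mulMap (𝟙_ _) x := by
      rw [P.app_tensor, P.of_app, ← tensorHom_id]; rfl
    have h1 : P.app (.of x) = 𝟙 _ := P.of_app x
    have h' := (congrArg (_ ≫ ·) h1.symm).trans (h.trans (congrArg (· ≫ _) h2))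
    exact (Category.comp_id _).symm.trans (h'.trans (Category.assoc _ _ _))
  right_unitality x := by
    have h := P.naturality (ρ_ (of x)).hom
    have h2 : P.app (.tensor (.of x) .unit) = _ ◁ P.unitMap ≫ P.mulMap x (𝟙_ _) := by
      rw [P.app_tensor, P.of_app, ← id_tensorHom]; rfl
    have h1 : P.app (.of x) = 𝟙 _ := P.of_app x
    have h' := (congrArg (_ ≫ ·) h1.symm).trans (h.trans (congrArg (· ≫ _) h2))
    exact (Category.comp_id _).symm.trans (h'.trans (Category.assoc _ _ _))

lemma preservesBraiding : PreservesBraiding κ P.core := fun h x y =>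
  (P.naturality (FreeMon.braiding h (of x) (of y)).hom).symm

variable {P} in
/-- A 2-cell is an algebra 2-cell as soon as it is compatible with the unit objects and with the
binary tensor products. -/
lemma isAlg2Cell_iff {g : X ⟶ Y} {Q : PsMorStr (algOf M) (algOf N) g} {τ : f ⟶ g} :
    IsAlg2Cell P Q τ ↔ P.unitMap ≫ (CAT.natTrans τ).app (𝟙_ X.toCat) = Q.unitMap ∧
      ∀ x y, P.mulMap x y ≫ (CAT.natTrans τ).app (x ⊗ y) =
        ((CAT.natTrans τ).app x ⊗ₘ (CAT.natTrans τ).app y) ≫ Q.mulMap x y := by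
  have key : IsAlg2Cell P Q τ ↔ ∀ T : FreeMon κ X.toCat,
      (FreeMon.lift (𝟭 Y.toCat)).map ((mapNat κ (CAT.natTrans τ)).app T) ≫ Q.app T =
        P.app T ≫ (CAT.natTrans τ).app ((FreeMon.lift (𝟭 X.toCat)).obj T) :=
    ⟨fun h T => congrArg (fun t => (CAT.natTrans t).app T) h, fun h => CAT.cell_ext h⟩
  rw [key]
  constructor
  · intro h
    exact ⟨(h .unit).symm.trans (Category.id_comp _), fun x y => (h (.tensor (.of x) (.of y))).symm⟩
  · rintro ⟨h1, h2⟩ T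
    -- A component at a formal tensor is made of the components at the factors and of `mulMap`, so
    -- the binary condition propagates to all formal objects.
    induction T with
    | of x =>
      rw [P.of_app, Q.of_app]
      exact (Category.comp_id _).trans (Category.id_comp _).symm
    | unit => exact (Category.id_comp _).trans h1.symm
    | tensor T U ihT ihU =>
      have hm : (FreeMon.lift (𝟭 Y.toCat)).map ((mapNat κ (CAT.natTrans τ)).app (T.tensor U)) =
        _ ⊗ₘ _ :=
        lift_map_tensorMap (𝟭 Y.toCat) ((mapNat κ (CAT.natTrans τ)).app T)
          ((mapNat κ (CAT.natTrans τ)).app U)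
      rw [hm, P.app_tensor, Q.app_tensor]
      refine (tensorHom_comp_tensorHom_assoc _ _ (Q.app T) (Q.app U) (Q.mulMap _ _)).trans ?_
      refine congr(($ihT ⊗ₘ $ihU) ≫ Q.mulMap _ _).trans ?_
      refine (tensorHom_comp_tensorHom_assoc (P.app T) (P.app U) _ _ (Q.mulMap _ _)).symm.trans ?_
      exact (congrArg (_ ≫ ·) (h2 _ _).symm).trans (Category.assoc _ _ _).symm

section OfCore

variable (c : (CAT.functor f).CoreMonoidal) (hc : PreservesBraiding κ c)

@[simp]
lemma ofCore_unitMap : (ofCore (M := M) (N := N) c hc).unitMap = c.εIso.hom := rfl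

@[simp]
lemma ofCore_mulMap (x y : X.toCat) : (ofCore (M := M) (N := N) c hc).mulMap x y = (c.μIso x y).hom :=
  (congrArg (· ≫ _) (id_tensorHom_id _ _)).trans (Category.id_comp _)

end OfCore

section Comp

variable {Z : CAT.{u}} {O : VMonoidal κ Z.toCat} {g : Y ⟶ Z}
  (Q : PsMorStr (algOf N) (algOf O) g)

lemma comp_unitMap : (P.comp Q).unitMap = Q.unitMap ≫ (CAT.functor g).map P.unitMap := by
  have h : (CAT.natTrans (eqToHom (by rw [(freeMonad κ).map_comp, Strict.assoc] :
      (freeMonad κ).map (f ≫ g) ≫ (algOf O).str =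
        (freeMonad κ).map f ≫ (freeMonad κ).map g ≫ (algOf O).str))).app FreeMon.unit = 𝟙 _ :=
    CAT.natTrans_eqToHom _ _
  exact (congrArg (· ≫ _) h).trans ((Category.id_comp _).trans
    (congrArg (_ ≫ ·) ((Category.id_comp _).trans (Category.comp_id _))))

lemma comp_mulMap (x y : X.toCat) : (P.comp Q).mulMap x y =
    Q.mulMap _ _ ≫ (CAT.functor g).map (P.mulMap x y) := by
  have h : (CAT.natTrans (eqToHom (by rw [(freeMonad κ).map_comp, Strict.assoc] :
      (freeMonad κ).map (f ≫ g) ≫ (algOf O).str =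
        (freeMonad κ).map f ≫ (freeMonad κ).map g ≫ (algOf O).str))).app
          (FreeMon.tensor (of x) (of y)) = 𝟙 _ :=
    CAT.natTrans_eqToHom _ _
  exact (congrArg (· ≫ _) h).trans ((Category.id_comp _).trans
    (congrArg (_ ≫ ·) ((Category.id_comp _).trans (Category.comp_id _))))

end Comp
end PsMorStr
end Pseudomorphisms

/-! ### Functors bijective on morphisms out of an object -/

section HomBij

universe v₁ u₁ v₂ u₂ v₃ u₃

variable {𝓔 : Type u₁} [Category.{v₁} 𝓔] {𝓔' : Type u₂} [Category.{v₂} 𝓔']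
  {𝓔'' : Type u₃} [Category.{v₃} 𝓔'']

/-- The functor `R` is bijective on morphisms with source `X`. -/
def HomBij (R : 𝓔 ⥤ 𝓔') (X : 𝓔) : Prop :=
  ∀ Y : 𝓔, Function.Bijective (fun f : X ⟶ Y => R.map f)

lemma HomBij.comp {R : 𝓔 ⥤ 𝓔'} {R' : 𝓔' ⥤ 𝓔''} {X : 𝓔} (h : HomBij R X)
    (h' : HomBij R' (R.obj X)) : HomBij (R ⋙ R') X := fun Y =>
  (h' (R.obj Y)).comp (h Y)

/-- Both directions of the isomorphism lift, and injectivity makes the lifts mutually inverse. With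
`R` a restriction functor, this is how associators, unitors, symmetries and tensorators are
extended. -/
lemma HomBij.exists_iso {R : 𝓔 ⥤ 𝓔'} {X Y : 𝓔} (hX : HomBij R X) (hY : HomBij R Y)
    (e : R.obj X ≅ R.obj Y) : ∃ i : X ≅ Y, R.map i.hom = e.hom := by
  obtain ⟨f, hf⟩ := (hX Y).2 e.hom
  obtain ⟨g, hg⟩ := (hY X).2 e.inv
  dsimp only at hf hg
  exact ⟨⟨f, g, (hX X).1 (by simp [hf, hg]), (hY Y).1 (by simp [hf, hg])⟩, hf⟩

/-- Components lift one at a time; injectivity of `R` forces the lifts to be natural. -/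
lemma HomBij.whiskeringRight {B : Type*} [Category* B] {R : 𝓔 ⥤ 𝓔'} {T : B ⥤ 𝓔}
    (h : ∀ b, HomBij R (T.obj b)) : HomBij ((Functor.whiskeringRight B 𝓔 𝓔').obj R) T := by
  refine fun T' => ⟨fun f g hfg => ?_, fun f => ?_⟩
  · ext b
    exact (h b _).1 (NatTrans.congr_app hfg b)
  · choose g hg using fun b => (h b (T'.obj b)).2 (f.app b)
    dsimp only at hg
    refine ⟨{ app := g, naturality := fun b b' k => (h b _).1 ?_ }, ?_⟩
    · simp only [R.map_comp, hg]
      exact f.naturality k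
    · ext b
      exact hg b

end HomBij

/-! ### Dense functors and restriction of cocontinuous functors -/

section DenseFunctors

open Limits Opposite

universe w v₁ u₁ v₂ u₂ v₃ u₃

variable {A : Type u₁} [Category.{v₁} A] {D : Type u₂} [Category.{v₂} D]
  {E : Type u₃} [Category.{v₃} E]

/-- A dense functor all of whose comma categories are essentially small. -/
structure SmallDense (y : A ⥤ D) : Prop where
  dense : Nonempty (Functor.LeftExtension.mk (𝟭 D) y.rightUnitor.inv).IsPointwiseLeftKanExtension
  small (d : D) : EssentiallySmall.{w} (CostructuredArrow y d)

namespace SmallDense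

variable {y : A ⥤ D} (hy : SmallDense.{w} y) (G : D ⥤ E) [PreservesColimitsOfSize.{w, w} G]
include hy

/-- Density presents `p` as a colimit over its comma category. This category is equivalent to a
small one, so the colimit is among those that `G` preserves. -/
lemma nonempty_isColimit (p : D) : Nonempty (IsColimit (G.mapCocone
    ((Functor.LeftExtension.mk (𝟭 D) y.rightUnitor.inv).coconeAt p))) := by
  have := hy.small p
  have := preservesColimitsOfShape_of_equiv
      (equivSmallModel.{w} (CostructuredArrow y p)).symm G
  exact ⟨isColimitOfPreserves G (hy.dense.some p)⟩

/-- Morphisms out of the value of a cocontinuous functor are determined by their restrictions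
to the values at the objects of a dense subcategory. -/
lemma hom_ext {p : D} {e : E} {φ ψ : G.obj p ⟶ e}
    (h : ∀ (a : A) (s : y.obj a ⟶ p), G.map s ≫ φ = G.map s ≫ ψ) : φ = ψ :=
  (hy.nonempty_isColimit G p).some.hom_ext fun j => by
    -- The identity is the component of the unitor that occurs in the legs of the canonical cocone.
    have h' : G.map (𝟙 _ ≫ j.hom) ≫ φ = G.map (𝟙 _ ≫ j.hom) ≫ ψ := by
      rw [Category.id_comp]; exact h j.left j.hom
    exact h'

lemma exists_desc {p : D} {e : E} (φ : ∀ a, (y.obj a ⟶ p) → (G.obj (y.obj a) ⟶ e))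
    (hφ : ∀ {a b} (f : a ⟶ b) (s : y.obj b ⟶ p),
      G.map (y.map f) ≫ φ b s = φ a (y.map f ≫ s)) :
    ∃ ψ : G.obj p ⟶ e, ∀ a s, G.map s ≫ ψ = φ a s := by
  let c : Cocone ((CostructuredArrow.proj y p ⋙ y) ⋙ G) :=
    { pt := e
      ι :=
        { app := fun j => φ j.left j.hom
          naturality := fun i j f => by
            have := hφ f.left j.hom
            rw [CostructuredArrow.w f] at this
            exact this.trans (Category.comp_id _).symm } }
  let hc := (hy.nonempty_isColimit G p).some
  refine ⟨hc.desc c, fun a s => ?_⟩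
  have h : G.map (𝟙 _ ≫ s) ≫ hc.desc c = φ a s := hc.fac c (CostructuredArrow.mk s)
  rwa [Category.id_comp] at h

/-- In other words, a cocontinuous functor is the left Kan extension of its restriction along a
dense functor: a transformation is prescribed on the canonical colimit presenting each object. -/
lemma homBij : HomBij ((Functor.whiskeringLeft A D E).obj y) G := by
  refine fun K => ⟨fun f g hfg => ?_, fun f => ?_⟩
  · ext p
    refine hy.hom_ext G fun a s => ?_
    rw [f.naturality, g.naturality]
    exact congrArg (· ≫ _) (NatTrans.congr_app hfg a)
  · choose g hg using fun p : D => hy.exists_desc G (p := p) (e := K.obj p)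
      (fun a s => f.app a ≫ K.map s) (fun {a b} k s => by
        have := f.naturality k
        simp only [Functor.whiskeringLeft_obj_obj, Functor.comp_map] at this
        rw [reassoc_of% this, K.map_comp])
    refine ⟨{ app := g, naturality := fun p q k => hy.hom_ext G fun a s => ?_ }, ?_⟩
    · rw [← G.map_comp_assoc, hg, reassoc_of% hg, K.map_comp]
    · ext a
      have := hg (y.obj a) a (𝟙 _)
      simpa using this

end SmallDense

variable (E) in
/-- Restriction of bifunctors along `y` in both variables. -/
abbrev restrict₂ (y : A ⥤ D) : (D ⥤ D ⥤ E) ⥤ (A ⥤ A ⥤ E) :=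
  (Functor.whiskeringRight D _ _).obj ((Functor.whiskeringLeft A D E).obj y) ⋙
    (Functor.whiskeringLeft A D _).obj y

variable (E) in
/-- Restriction of trifunctors along `y` in all variables. -/
abbrev restrict₃ (y : A ⥤ D) : (D ⥤ D ⥤ D ⥤ E) ⥤ (A ⥤ A ⥤ A ⥤ E) :=
  (Functor.whiskeringRight D _ _).obj (restrict₂ E y) ⋙ (Functor.whiskeringLeft A D _).obj y

namespace SmallDense

variable {y : A ⥤ D} (hy : SmallDense.{w} y)
include hy

/-- The second variable is restricted first, for each value of the first one. After that, `T` is a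
functor into `A ⥤ E`, cocontinuous because colimits there are detected by evaluation, and `homBij`
applies again. For three variables the argument is iterated. -/
lemma homBij₂ [HasColimitsOfSize.{w, w} E] (T : D ⥤ D ⥤ E)
    (h₁ : ∀ d, PreservesColimitsOfSize.{w, w} (T.flip.obj d))
    (h₂ : ∀ d, PreservesColimitsOfSize.{w, w} (T.obj d)) : HomBij (restrict₂ E y) T := by
  refine (HomBij.whiskeringRight fun d => ?_).comp ?_
  · exact hy.homBij (T.obj d)
  · have : PreservesColimitsOfSize.{w, w} (((Functor.whiskeringRight D _ _).obj
        ((Functor.whiskeringLeft A D E).obj y)).obj T) :=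
      preservesColimits_of_evaluation _ fun a => h₁ (y.obj a)
    exact hy.homBij _

lemma homBij₃ [HasColimitsOfSize.{w, w} E] (T : D ⥤ D ⥤ D ⥤ E)
    (h₁ : ∀ d d', PreservesColimitsOfSize.{w, w} ((T.flip.obj d).flip.obj d'))
    (h₂ : ∀ d d', PreservesColimitsOfSize.{w, w} ((T.obj d).flip.obj d'))
    (h₃ : ∀ d d', PreservesColimitsOfSize.{w, w} ((T.obj d).obj d')) :
    HomBij (restrict₃ E y) T := by
  refine (HomBij.whiskeringRight fun d => ?_).comp ?_
  · exact hy.homBij₂ (T.obj d) (h₂ d) (h₃ d)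
  · have : PreservesColimitsOfSize.{w, w} (((Functor.whiskeringRight D _ _).obj
        (restrict₂ E y)).obj T) :=
      preservesColimits_of_evaluation _ fun a => preservesColimits_of_evaluation _ fun a' =>
        h₁ (y.obj a) (y.obj a')
    exact hy.homBij _

end SmallDense

end DenseFunctors

/-! ### Extending the tensor product and its constraints along a dense functor -/

section ExtensionOfTensor

open MonoidalCategory Limits

universe w v₁ u₁ v₂ u₂

variable {κ : Variant} {A : Type u₁} [Category.{v₁} A] {D : Type u₂} [Category.{v₂} D]

/-- The action of a bifunctor on a pair of morphisms. -/
def bimap (T : D ⥤ D ⥤ D) {p p' q q' : D} (f : p ⟶ p') (g : q ⟶ q') :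
    (T.obj p).obj q ⟶ (T.obj p').obj q' := (T.map f).app q ≫ (T.obj p').map g

@[simp]
lemma bimap_id_left (T : D ⥤ D ⥤ D) (p : D) {q q' : D} (g : q ⟶ q') :
    bimap T (𝟙 p) g = (T.obj p).map g := by
  simp [bimap]

@[simp]
lemma bimap_id_right (T : D ⥤ D ⥤ D) {p p' : D} (f : p ⟶ p') (q : D) :
    bimap T f (𝟙 q) = (T.map f).app q := by
  simp [bimap]

lemma bimap_comp_bimap (T : D ⥤ D ⥤ D) {p p' p'' q q' q'' : D} (f : p ⟶ p') (g : q ⟶ q')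
    (f' : p' ⟶ p'') (g' : q' ⟶ q'') :
    bimap T f g ≫ bimap T f' g' = bimap T (f ≫ f') (g ≫ g') := by
  simp [bimap]

lemma bimap_comp_bimap_assoc (T : D ⥤ D ⥤ D) {p p' p'' q q' q'' e : D} (f : p ⟶ p')
    (g : q ⟶ q') (f' : p' ⟶ p'') (g' : q' ⟶ q'') (k : (T.obj p'').obj q'' ⟶ e) :
    bimap T f g ≫ bimap T f' g' ≫ k = bimap T (f ≫ f') (g ≫ g') ≫ k := by
  rw [← Category.assoc, bimap_comp_bimap]

/-- A separately cocontinuous bifunctor that extends the tensor product of `A` along `y`. -/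
structure TensorExtension [MonoidalCategory A] (y : A ⥤ D) (T : D ⥤ D ⥤ D) where
  left (d : D) : PreservesColimitsOfSize.{w, w} (T.flip.obj d)
  right (d : D) : PreservesColimitsOfSize.{w, w} (T.obj d)
  iso : (restrict₂ D y).obj T ≅ curriedTensor A ⋙ (Functor.whiskeringRight A A D).obj y

namespace TensorExtension

section

variable [MonoidalCategory A] {y : A ⥤ D} {T : D ⥤ D ⥤ D} (h : TensorExtension.{w} y T)

/-- The comparison on a pair of objects in the image of `y`. -/
def comparison (a b : A) : (T.obj (y.obj a)).obj (y.obj b) ≅ y.obj (a ⊗ b) :=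
  (h.iso.app a).app b

lemma comparison_natural {a a' b b' : A} (f : a ⟶ a') (g : b ⟶ b') :
    bimap T (y.map f) (y.map g) ≫ (h.comparison a' b').hom =
      (h.comparison a b).hom ≫ y.map (f ⊗ₘ g) := by
  have h1 := NatTrans.congr_app (h.iso.hom.naturality f) b
  have h2 := (h.iso.hom.app a').naturality g
  dsimp at h1 h2
  rw [bimap, Category.assoc, MonoidalCategory.tensorHom_def, y.map_comp]
  exact (congrArg (_ ≫ ·) h2).trans (((reassoc_of% h1) _).trans rfl)

lemma comparison_inv_natural {a a' b b' : A} (f : a ⟶ a') (g : b ⟶ b') :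
    (h.comparison a b).inv ≫ bimap T (y.map f) (y.map g) =
      y.map (f ⊗ₘ g) ≫ (h.comparison a' b').inv := by
  rw [Iso.inv_comp_eq, ← Category.assoc, Iso.eq_comp_inv, h.comparison_natural]

/-- The associator on triples of objects in the image of `y`. -/
def assocIso (a b c : A) : (T.obj ((T.obj (y.obj a)).obj (y.obj b))).obj (y.obj c) ≅
    (T.obj (y.obj a)).obj ((T.obj (y.obj b)).obj (y.obj c)) :=
  (T.mapIso (h.comparison a b)).app (y.obj c) ≪≫ h.comparison (a ⊗ b) c ≪≫
    y.mapIso (α_ a b c) ≪≫ (h.comparison a (b ⊗ c)).symm ≪≫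
      (T.obj (y.obj a)).mapIso (h.comparison b c).symm

lemma assocIso_hom (a b c : A) : (h.assocIso a b c).hom =
    bimap T (h.comparison a b).hom (𝟙 _) ≫ (h.comparison (a ⊗ b) c).hom ≫ y.map (α_ a b c).hom ≫
      (h.comparison a (b ⊗ c)).inv ≫ bimap T (𝟙 _) (h.comparison b c).inv := by
  simp [assocIso]

lemma assocIso_natural {a a' b b' c c' : A} (f : a ⟶ a') (g : b ⟶ b') (k : c ⟶ c') :
    bimap T (bimap T (y.map f) (y.map g)) (y.map k) ≫ (h.assocIso a' b' c').hom =
      (h.assocIso a b c).hom ≫ bimap T (y.map f) (bimap T (y.map g) (y.map k)) := by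
  rw [assocIso_hom, assocIso_hom, bimap_comp_bimap_assoc, Category.comp_id,
    h.comparison_natural]
  simp only [Category.assoc]
  rw [bimap_comp_bimap, Category.id_comp, comparison_inv_natural,
    ← Category.comp_id (y.map f), ← bimap_comp_bimap,
    reassoc_of% h.comparison_inv_natural f (g ⊗ₘ k), ← y.map_comp_assoc,
    ← associator_naturality, y.map_comp_assoc, ← reassoc_of% h.comparison_natural (f ⊗ₘ g) k,
    bimap_comp_bimap_assoc, Category.id_comp]

/-- The associator restricted along `y`. -/
def assocNatIso : (restrict₃ D y).obj (bifunctorComp₁₂ T T) ≅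
    (restrict₃ D y).obj (bifunctorComp₂₃ T T) :=
  NatIso.ofComponents (fun a => NatIso.ofComponents (fun b => NatIso.ofComponents
    (fun c => h.assocIso a b c) (fun {c c'} k => by
      have := h.assocIso_natural (𝟙 a) (𝟙 b) k
      simp only [CategoryTheory.Functor.map_id, bimap_id_left, bimap_id_right, NatTrans.id_app] at this
      exact this))
    (fun {b b'} g => by
      ext c
      have := h.assocIso_natural (𝟙 a) g (𝟙 c)
      simp only [CategoryTheory.Functor.map_id, bimap_id_left, bimap_id_right] at this
      exact this))
    (fun {a a'} f => by
      ext b c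
      have := h.assocIso_natural f (𝟙 b) (𝟙 c)
      simp only [CategoryTheory.Functor.map_id, bimap_id_right, NatTrans.id_app] at this
      exact this)

end

end TensorExtension

variable [MonoidalCategory A] {y : A ⥤ D} {T : D ⥤ D ⥤ D}

/-- Constraints of a monoidal structure with tensor product `T` and unit `y 𝟙_` which correspond to
the ones of `A`. -/
structure TensorConstraints (h : TensorExtension.{w} y T) where
  assoc (p q r : D) : (T.obj ((T.obj p).obj q)).obj r ≅ (T.obj p).obj ((T.obj q).obj r)
  assoc_natural {p p' q q' r r' : D} (f : p ⟶ p') (g : q ⟶ q') (k : r ⟶ r') :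
    bimap T (bimap T f g) k ≫ (assoc p' q' r').hom = (assoc p q r).hom ≫ bimap T f (bimap T g k)
  assoc_rep (a b c : A) : (assoc (y.obj a) (y.obj b) (y.obj c)).hom = (h.assocIso a b c).hom
  left (p : D) : (T.obj (y.obj (𝟙_ A))).obj p ≅ p
  left_natural {p p' : D} (f : p ⟶ p') :
    bimap T (𝟙 _) f ≫ (left p').hom = (left p).hom ≫ f
  left_rep (a : A) : (left (y.obj a)).hom = (h.comparison (𝟙_ A) a).hom ≫ y.map (λ_ a).hom
  right (p : D) : (T.obj p).obj (y.obj (𝟙_ A)) ≅ p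
  right_natural {p p' : D} (f : p ⟶ p') :
    bimap T f (𝟙 _) ≫ (right p').hom = (right p).hom ≫ f
  right_rep (a : A) : (right (y.obj a)).hom = (h.comparison a (𝟙_ A)).hom ≫ y.map (ρ_ a).hom

/-- The two threefold products are cocontinuous in each variable, and their restrictions to `A` are
isomorphic through the associator of `A`; `homBij₃` lifts this isomorphism. The unitors come in the
same way from functors of one variable, compared with the identity functor. -/
lemma TensorExtension.nonempty_constraints (hy : SmallDense.{w} y) [HasColimitsOfSize.{w, w} D]
    (h : TensorExtension.{w} y T) : Nonempty (TensorConstraints h) := by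
  have hl := h.left
  have hr := h.right
  have comp {F G : D ⥤ D} (_ : PreservesColimitsOfSize.{w, w} F)
    (_ : PreservesColimitsOfSize.{w, w} G) : PreservesColimitsOfSize.{w, w} (F ⋙ G) := inferInstance
  -- A transformation of curried trifunctors gives naturality in each variable separately; joint
  -- naturality is assembled at the end.
  obtain ⟨α, h1, h2, h3, hα⟩ : ∃ α : ∀ p q r,
      (T.obj ((T.obj p).obj q)).obj r ≅ (T.obj p).obj ((T.obj q).obj r),
      (∀ {p p' : D} (f : p ⟶ p') (q r), bimap T (bimap T f (𝟙 q)) (𝟙 r) ≫ (α p' q r).hom =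
        (α p q r).hom ≫ bimap T f (𝟙 _)) ∧
      (∀ (p) {q q' : D} (g : q ⟶ q') (r), bimap T (bimap T (𝟙 p) g) (𝟙 r) ≫ (α p q' r).hom =
        (α p q r).hom ≫ bimap T (𝟙 p) (bimap T g (𝟙 r))) ∧
      (∀ (p q) {r r' : D} (k : r ⟶ r'), bimap T (𝟙 _) k ≫ (α p q r').hom =
        (α p q r).hom ≫ bimap T (𝟙 p) (bimap T (𝟙 q) k)) ∧
      ∀ a b c, (α (y.obj a) (y.obj b) (y.obj c)).hom = (h.assocIso a b c).hom := by
    obtain ⟨α, hα⟩ := (hy.homBij₃ (bifunctorComp₁₂ T T)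
      (fun d d' => comp (hl d) (hl d')) (fun d d' => comp (hr d) (hl d'))
      (fun d d' => hr _)).exists_iso (hy.homBij₃ (bifunctorComp₂₃ T T)
      (fun d d' => hl _) (fun d d' => comp (hl d') (hr d)) (fun d d' => comp (hr d') (hr d)))
      h.assocNatIso
    refine ⟨fun p q r => ((α.app p).app q).app r, fun {p p'} f q r => ?_, fun p {q q'} g r => ?_,
      fun p q {r r'} k => ?_, fun a b c =>
        NatTrans.congr_app (NatTrans.congr_app (NatTrans.congr_app hα a) b) c⟩
    all_goals simp only [bimap_id_left, bimap_id_right]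
    · exact NatTrans.congr_app (NatTrans.congr_app (α.hom.naturality f) q) r
    · exact NatTrans.congr_app ((α.hom.app p).naturality g) r
    · exact ((α.hom.app p).app q).naturality k
  obtain ⟨l, hl'⟩ := (hy.homBij (T.obj (y.obj (𝟙_ A)))).exists_iso (hy.homBij (𝟭 D))
    (NatIso.ofComponents (fun a => h.comparison (𝟙_ A) a ≪≫ y.mapIso (λ_ a)) (fun {a b} f => by
      have := h.comparison_natural (𝟙 (𝟙_ A)) f
      simp only [CategoryTheory.Functor.map_id, bimap_id_left] at this
      dsimp
      rw [reassoc_of% this, Category.assoc, ← y.map_comp, ← y.map_comp, id_tensorHom,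
        leftUnitor_naturality]))
  obtain ⟨r, hr'⟩ := (hy.homBij (T.flip.obj (y.obj (𝟙_ A)))).exists_iso (hy.homBij (𝟭 D))
    (NatIso.ofComponents (fun a => h.comparison a (𝟙_ A) ≪≫ y.mapIso (ρ_ a)) (fun {a b} f => by
      have := h.comparison_natural f (𝟙 (𝟙_ A))
      simp only [CategoryTheory.Functor.map_id, bimap_id_right] at this
      dsimp
      rw [reassoc_of% this, Category.assoc, ← y.map_comp, ← y.map_comp, tensorHom_id,
        rightUnitor_naturality]))
  refine ⟨{ assoc := α
            assoc_natural {p p' q q' r r'} f g k := ?_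
            assoc_rep := hα
            left p := l.app p
            left_natural f := by simp
            left_rep a := NatTrans.congr_app hl' a
            right p := r.app p
            right_natural f := by
              have := r.hom.naturality f
              simpa using this
            right_rep a := NatTrans.congr_app hr' a }⟩
  -- A triple of morphisms is factored into three that each move a single variable.
  have e1 : bimap T (bimap T f g) k = bimap T (bimap T f (𝟙 q)) (𝟙 r) ≫
      bimap T (bimap T (𝟙 p') g) (𝟙 r) ≫ bimap T (𝟙 _) k := by
    simp only [bimap_comp_bimap, Category.comp_id, Category.id_comp]
  have e2 : bimap T f (bimap T g k) = bimap T f (𝟙 _) ≫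
      bimap T (𝟙 p') (bimap T g (𝟙 r)) ≫ bimap T (𝟙 p') (bimap T (𝟙 q') k) := by
    simp only [bimap_comp_bimap, Category.comp_id, Category.id_comp]
  simp only [e1, e2, Category.assoc, h3, reassoc_of% h2, reassoc_of% h1]

namespace TensorConstraints

variable {h : TensorExtension.{w} y T} (c : TensorConstraints h)

/-- The tensor product, the unit object and the constraints. -/
abbrev monoidalStruct : MonoidalCategoryStruct D where
  tensorObj p q := (T.obj p).obj q
  whiskerLeft p _ _ f := (T.obj p).map f
  whiskerRight f q := (T.map f).app q
  tensorHom f g := bimap T f g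
  tensorUnit := y.obj (𝟙_ A)
  associator := c.assoc
  leftUnitor := c.left
  rightUnitor := c.right

-- Density is used one variable at a time: each variable is replaced by an object in the image of
-- `y` while the product stays cocontinuous in the remaining ones. The versions with three and four
-- factors serve the hexagon and the pentagon.
include h in
lemma hom_ext₂ (hy : SmallDense.{w} y) {p q e : D} {φ ψ : (T.obj p).obj q ⟶ e}
    (H : ∀ (a b : A) (s : y.obj a ⟶ p) (t : y.obj b ⟶ q),
      bimap T s t ≫ φ = bimap T s t ≫ ψ) : φ = ψ := by
  have := h.left
  have := h.right
  refine hy.hom_ext (T.flip.obj q) fun a s => hy.hom_ext (T.obj (y.obj a)) fun b t => ?_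
  simpa [← bimap_id_left T, ← bimap_id_right T, bimap_comp_bimap_assoc,
    bimap_comp_bimap, -bimap_id_left, -bimap_id_right] using H a b s t

include h in
lemma hom_ext₃ (hy : SmallDense.{w} y) {p q r e : D}
    {φ ψ : (T.obj ((T.obj p).obj q)).obj r ⟶ e}
    (H : ∀ (a b c : A) (s : y.obj a ⟶ p) (t : y.obj b ⟶ q) (k : y.obj c ⟶ r),
      bimap T (bimap T s t) k ≫ φ = bimap T (bimap T s t) k ≫ ψ) : φ = ψ := by
  have := h.left
  have := h.right
  refine hy.hom_ext (T.flip.obj q ⋙ T.flip.obj r) fun a s =>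
    hy.hom_ext (T.obj (y.obj a) ⋙ T.flip.obj r) fun b t =>
    hy.hom_ext (T.obj ((T.obj (y.obj a)).obj (y.obj b))) fun c k => ?_
  simpa [← bimap_id_left T, ← bimap_id_right T, bimap_comp_bimap_assoc,
    bimap_comp_bimap, -bimap_id_left, -bimap_id_right] using H a b c s t k

include h in
lemma hom_ext₄ (hy : SmallDense.{w} y) {p q r s e : D}
    {φ ψ : (T.obj ((T.obj ((T.obj p).obj q)).obj r)).obj s ⟶ e}
    (H : ∀ (a b c d : A) (i : y.obj a ⟶ p) (j : y.obj b ⟶ q) (k : y.obj c ⟶ r)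
      (l : y.obj d ⟶ s), bimap T (bimap T (bimap T i j) k) l ≫ φ =
        bimap T (bimap T (bimap T i j) k) l ≫ ψ) : φ = ψ := by
  have := h.left
  have := h.right
  refine hy.hom_ext (T.flip.obj q ⋙ T.flip.obj r ⋙ T.flip.obj s) fun a i =>
    hy.hom_ext (T.obj (y.obj a) ⋙ T.flip.obj r ⋙ T.flip.obj s) fun b j =>
    hy.hom_ext (T.obj ((T.obj (y.obj a)).obj (y.obj b)) ⋙ T.flip.obj s) fun c k =>
    hy.hom_ext (T.obj ((T.obj ((T.obj (y.obj a)).obj (y.obj b))).obj (y.obj c))) fun d l => ?_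
  simpa [← bimap_id_left T, ← bimap_id_right T, bimap_comp_bimap_assoc,
    bimap_comp_bimap, -bimap_id_left, -bimap_id_right] using H a b c d i j k l

end TensorConstraints

end ExtensionOfTensor

/-! ### The pentagon and triangle axioms of the extended tensor product -/

section ExtensionOfTensor

open MonoidalCategory Limits

universe w v₁ u₁ v₂ u₂

variable {A : Type u₁} [Category.{v₁} A] {D : Type u₂} [Category.{v₂} D]
  [MonoidalCategory A] {y : A ⥤ D} {T : D ⥤ D ⥤ D}

namespace TensorConstraints

variable {h : TensorExtension.{w} y T} (c : TensorConstraints h)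

/-- This is the associativity axiom for `y` as a strong monoidal functor with tensorator
`comparison`. It replaces associators of `D` by images of associators of `A`. -/
lemma assoc_comparison (a₁ a₂ a₃ : A) : (c.assoc (y.obj a₁) (y.obj a₂) (y.obj a₃)).hom ≫
    bimap T (𝟙 _) (h.comparison a₂ a₃).hom ≫ (h.comparison a₁ (a₂ ⊗ a₃)).hom =
      bimap T (h.comparison a₁ a₂).hom (𝟙 _) ≫ (h.comparison (a₁ ⊗ a₂) a₃).hom ≫
        y.map (α_ a₁ a₂ a₃).hom := by
  rw [c.assoc_rep, h.assocIso_hom]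
  simp only [Category.assoc, bimap_comp_bimap_assoc, Category.comp_id, Iso.inv_hom_id]
  simp

lemma bimap_comparison {a₁ a₂ a₁' a₂' : A} {p q : D} (s : p ⟶ y.obj a₁) (t : q ⟶ y.obj a₂)
    (f : a₁ ⟶ a₁') (g : a₂ ⟶ a₂') :
    bimap T (s ≫ y.map f) (t ≫ y.map g) ≫ (h.comparison a₁' a₂').hom =
      bimap T s t ≫ (h.comparison a₁ a₂).hom ≫ y.map (f ⊗ₘ g) := by
  rw [← bimap_comp_bimap, Category.assoc, h.comparison_natural]

instance (p : D) {q q' : D} (f : q ⟶ q') [IsIso f] : IsIso (bimap T (𝟙 p) f) := by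
  rw [bimap_id_left]; infer_instance

instance (p : D) {q q' : D} (f : q ⟶ q') [IsIso f] : IsIso (bimap T f (𝟙 p)) := by
  rw [bimap_id_right]; infer_instance

lemma pentagon_rep (a₁ a₂ a₃ a₄ : A) :
    bimap T (c.assoc (y.obj a₁) (y.obj a₂) (y.obj a₃)).hom (𝟙 (y.obj a₄)) ≫
      (c.assoc (y.obj a₁) ((T.obj (y.obj a₂)).obj (y.obj a₃)) (y.obj a₄)).hom ≫
        bimap T (𝟙 (y.obj a₁)) (c.assoc (y.obj a₂) (y.obj a₃) (y.obj a₄)).hom =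
      (c.assoc ((T.obj (y.obj a₁)).obj (y.obj a₂)) (y.obj a₃) (y.obj a₄)).hom ≫
        (c.assoc (y.obj a₁) (y.obj a₂) ((T.obj (y.obj a₃)).obj (y.obj a₄))).hom := by
  -- Both sides are compared after the isomorphism onto `y` of the right-bracketed product, where
  -- they become the images of the two sides of the pentagon in `A`.
  rw [← cancel_mono (bimap T (𝟙 (y.obj a₁)) (bimap T (𝟙 (y.obj a₂)) (h.comparison a₃ a₄).hom ≫
    (h.comparison a₂ (a₃ ⊗ a₄)).hom) ≫ (h.comparison a₁ (a₂ ⊗ a₃ ⊗ a₄)).hom)]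
  have n1 := c.assoc_natural (𝟙 (y.obj a₁)) (h.comparison a₂ a₃).hom (𝟙 (y.obj a₄))
  have n2 := c.assoc_natural (𝟙 (y.obj a₁)) (𝟙 (y.obj a₂)) (h.comparison a₃ a₄).hom
  have n3 := c.assoc_natural (h.comparison a₁ a₂).hom (𝟙 (y.obj a₃)) (𝟙 (y.obj a₄))
  have e1 := bimap_comparison (h := h) (𝟙 (y.obj a₁)) (bimap T (h.comparison a₂ a₃).hom (𝟙 _) ≫
    (h.comparison (a₂ ⊗ a₃) a₄).hom) (𝟙 a₁) (α_ a₂ a₃ a₄).hom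
  have e2 := bimap_comparison (h := h) (bimap T (h.comparison a₁ a₂).hom (𝟙 _) ≫
    (h.comparison (a₁ ⊗ a₂) a₃).hom) (𝟙 (y.obj a₄)) (α_ a₁ a₂ a₃).hom (𝟙 a₄)
  have i2 : bimap T (𝟙 (y.obj a₁)) (𝟙 (y.obj a₂)) = 𝟙 _ := by simp
  have i3 : bimap T (𝟙 (y.obj a₃)) (𝟙 (y.obj a₄)) = 𝟙 _ := by simp
  simp only [Category.assoc, y.map_id, Category.comp_id] at e1 e2
  rw [i2] at n2
  rw [i3] at n3
  calc _ = bimap T (c.assoc (y.obj a₁) (y.obj a₂) (y.obj a₃)).hom (𝟙 (y.obj a₄)) ≫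
      (c.assoc (y.obj a₁) ((T.obj (y.obj a₂)).obj (y.obj a₃)) (y.obj a₄)).hom ≫
        bimap T (𝟙 (y.obj a₁)) ((c.assoc (y.obj a₂) (y.obj a₃) (y.obj a₄)).hom ≫
          bimap T (𝟙 (y.obj a₂)) (h.comparison a₃ a₄).hom ≫ (h.comparison a₂ (a₃ ⊗ a₄)).hom) ≫
            (h.comparison a₁ (a₂ ⊗ a₃ ⊗ a₄)).hom := by
        simp only [Category.assoc, bimap_comp_bimap_assoc, Category.comp_id]
    _ = bimap T (c.assoc (y.obj a₁) (y.obj a₂) (y.obj a₃)).hom (𝟙 (y.obj a₄)) ≫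
        bimap T (bimap T (𝟙 (y.obj a₁)) (h.comparison a₂ a₃).hom) (𝟙 (y.obj a₄)) ≫
        (bimap T (h.comparison a₁ (a₂ ⊗ a₃)).hom (𝟙 (y.obj a₄)) ≫
          (h.comparison (a₁ ⊗ a₂ ⊗ a₃) a₄).hom ≫ y.map (α_ a₁ (a₂ ⊗ a₃) a₄).hom) ≫
          y.map (𝟙 a₁ ⊗ₘ (α_ a₂ a₃ a₄).hom) := by
        rw [c.assoc_comparison, e1, ← c.assoc_comparison]
        simp only [Category.assoc]
        rw [reassoc_of% n1, bimap_comp_bimap_assoc, Category.comp_id]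
    _ = bimap T ((c.assoc (y.obj a₁) (y.obj a₂) (y.obj a₃)).hom ≫
        bimap T (𝟙 (y.obj a₁)) (h.comparison a₂ a₃).hom ≫ (h.comparison a₁ (a₂ ⊗ a₃)).hom)
          (𝟙 (y.obj a₄)) ≫ (h.comparison (a₁ ⊗ a₂ ⊗ a₃) a₄).hom ≫
            y.map (α_ a₁ (a₂ ⊗ a₃) a₄).hom ≫ y.map (𝟙 a₁ ⊗ₘ (α_ a₂ a₃ a₄).hom) := by
        simp only [Category.assoc, bimap_comp_bimap_assoc, Category.comp_id]
    _ = bimap T (bimap T (h.comparison a₁ a₂).hom (𝟙 _) ≫ (h.comparison (a₁ ⊗ a₂) a₃).hom)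
        (𝟙 (y.obj a₄)) ≫ (h.comparison ((a₁ ⊗ a₂) ⊗ a₃) a₄).hom ≫ y.map (((α_ a₁ a₂ a₃).hom ⊗ₘ
          𝟙 a₄) ≫ (α_ a₁ (a₂ ⊗ a₃) a₄).hom ≫ (𝟙 a₁ ⊗ₘ (α_ a₂ a₃ a₄).hom)) := by
        rw [c.assoc_comparison, reassoc_of% e2, y.map_comp, y.map_comp]
    _ = bimap T (bimap T (h.comparison a₁ a₂).hom (𝟙 _)) (𝟙 _) ≫
        (bimap T (h.comparison (a₁ ⊗ a₂) a₃).hom (𝟙 (y.obj a₄)) ≫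
        (h.comparison ((a₁ ⊗ a₂) ⊗ a₃) a₄).hom ≫ y.map (α_ (a₁ ⊗ a₂) a₃ a₄).hom) ≫
          y.map (α_ a₁ a₂ (a₃ ⊗ a₄)).hom := by
        rw [tensorHom_id, id_tensorHom, MonoidalCategory.pentagon, y.map_comp]
        simp only [Category.assoc, bimap_comp_bimap_assoc, Category.comp_id]
    _ = (c.assoc ((T.obj (y.obj a₁)).obj (y.obj a₂)) (y.obj a₃) (y.obj a₄)).hom ≫
        bimap T (𝟙 _) (h.comparison a₃ a₄).hom ≫ bimap T (h.comparison a₁ a₂).hom (𝟙 _) ≫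
          (h.comparison (a₁ ⊗ a₂) (a₃ ⊗ a₄)).hom ≫ y.map (α_ a₁ a₂ (a₃ ⊗ a₄)).hom := by
        rw [← c.assoc_comparison]
        simp only [Category.assoc]
        rw [reassoc_of% n3]
        simp only [bimap_comp_bimap_assoc, Category.comp_id, Category.id_comp]
    _ = _ := by
        rw [← c.assoc_comparison, reassoc_of% n2, bimap_comp_bimap_assoc, Category.comp_id]
        simp only [Category.assoc]

lemma triangle_rep (a b : A) :
    (c.assoc (y.obj a) (y.obj (𝟙_ A)) (y.obj b)).hom ≫
      bimap T (𝟙 (y.obj a)) (c.left (y.obj b)).hom = bimap T (c.right (y.obj a)).hom (𝟙 _) := by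
  rw [← cancel_mono (h.comparison a b).hom, c.left_rep, c.right_rep]
  have e1 := bimap_comparison (h := h) (𝟙 (y.obj a)) (h.comparison (𝟙_ A) b).hom (𝟙 a) (λ_ b).hom
  have e2 := bimap_comparison (h := h) (h.comparison a (𝟙_ A)).hom (𝟙 (y.obj b)) (ρ_ a).hom (𝟙 b)
  simp only [y.map_id, Category.comp_id] at e1 e2
  rw [e2, Category.assoc, e1, reassoc_of% c.assoc_comparison, ← y.map_comp, id_tensorHom,
    tensorHom_id, MonoidalCategory.triangle]

variable (hy : SmallDense.{w} y)
include hy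

/-- By density it suffices to precompose with maps from objects in the image of `y`. Naturality
moves these maps past the associators, and `pentagon_rep` remains. -/
lemma pentagon (p q r s : D) :
    bimap T (c.assoc p q r).hom (𝟙 s) ≫ (c.assoc p ((T.obj q).obj r) s).hom ≫
        bimap T (𝟙 p) (c.assoc q r s).hom =
      (c.assoc ((T.obj p).obj q) r s).hom ≫ (c.assoc p q ((T.obj r).obj s)).hom := by
  refine hom_ext₄ (h := h) hy fun a₁ a₂ a₃ a₄ i j k l => ?_
  rw [bimap_comp_bimap_assoc, c.assoc_natural, reassoc_of% c.assoc_natural (bimap T i j) k l,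
    c.assoc_natural i j (bimap T k l), ← reassoc_of% c.pentagon_rep, Category.comp_id,
    ← Category.id_comp l, ← bimap_comp_bimap, Category.assoc,
    reassoc_of% c.assoc_natural i (bimap T j k),
    bimap_comp_bimap, Category.comp_id, c.assoc_natural, bimap_comp_bimap, Category.id_comp,
    Category.id_comp]

lemma triangle (p q : D) :
    (c.assoc p (y.obj (𝟙_ A)) q).hom ≫ bimap T (𝟙 p) (c.left q).hom =
      bimap T (c.right p).hom (𝟙 q) := by
  have := h.left
  have := h.right
  -- Only the two outer variables have to be reduced, since the middle one is already `y.obj (𝟙_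
  -- A)`.
  refine hy.hom_ext (T.flip.obj _ ⋙ T.flip.obj q) fun a s =>
    hy.hom_ext (T.obj ((T.obj (y.obj a)).obj (y.obj (𝟙_ A)))) fun b t => ?_
  have e := c.assoc_natural s (𝟙 (y.obj (𝟙_ A))) t
  have e1 : (T.flip.obj (y.obj (𝟙_ A)) ⋙ T.flip.obj q).map s =
    bimap T (bimap T s (𝟙 _)) (𝟙 _) := by simp
  rw [e1, ← bimap_id_left, bimap_comp_bimap_assoc, bimap_comp_bimap_assoc, Category.id_comp,
    Category.comp_id, reassoc_of% e, bimap_comp_bimap, c.left_natural, bimap_comp_bimap,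
    c.right_natural, Category.comp_id, Category.comp_id, ← Category.id_comp s,
    ← bimap_comp_bimap, reassoc_of% c.triangle_rep, Category.id_comp, bimap_comp_bimap,
    Category.id_comp]

/-- The monoidal structure. -/
abbrev monoidal : MonoidalCategory D :=
  letI := c.monoidalStruct
  MonoidalCategory.ofTensorHom
    (id_tensorHom_id := fun p q => (bimap_id_left T p (𝟙 q)).trans (by simp; rfl))
    (id_tensorHom := fun p _ _ f => bimap_id_left T p f)
    (tensorHom_id := fun f q => bimap_id_right T f q)
    (tensorHom_comp_tensorHom := fun f₁ f₂ g₁ g₂ => bimap_comp_bimap T f₁ f₂ g₁ g₂)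
    (associator_naturality := c.assoc_natural)
    (leftUnitor_naturality := c.left_natural)
    (rightUnitor_naturality := c.right_natural)
    (pentagon := c.pentagon hy)
    (triangle := c.triangle hy)

end TensorConstraints

end ExtensionOfTensor

/-! ### Symmetry and terminal unit of the extended tensor product -/

section ExtensionOfTensor

open MonoidalCategory Limits

universe w v₁ u₁ v₂ u₂

variable {A : Type u₁} [Category.{v₁} A] {D : Type u₂} [Category.{v₂} D]
  {y : A ⥤ D} {T : D ⥤ D ⥤ D}

section Braiding

variable [MonoidalCategory A] [SymmetricCategory A]

/-- A symmetry of the tensor product `T` which corresponds to the one of `A`. -/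
structure TensorBraiding (h : TensorExtension.{w} y T) where
  braid (p q : D) : (T.obj p).obj q ≅ (T.obj q).obj p
  natural {p p' q q' : D} (f : p ⟶ p') (g : q ⟶ q') :
    bimap T f g ≫ (braid p' q').hom = (braid p q).hom ≫ bimap T g f
  rep (a b : A) : (braid (y.obj a) (y.obj b)).hom ≫ (h.comparison b a).hom =
    (h.comparison a b).hom ≫ y.map (β_ a b).hom

/-- The symmetry of `A`, conjugated by the comparison, is an isomorphism between the restrictions of
`T` and `T.flip`. Both bifunctors are separately cocontinuous, so it lifts by `homBij₂`. -/
lemma TensorExtension.nonempty_braiding (hy : SmallDense.{w} y) [HasColimitsOfSize.{w, w} D]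
    (h : TensorExtension.{w} y T) : Nonempty (TensorBraiding h) := by
  have nat {a a' b b' : A} (f : a ⟶ a') (g : b ⟶ b') : bimap T (y.map f) (y.map g) ≫
      (h.comparison a' b').hom ≫ y.map (β_ a' b').hom ≫ (h.comparison b' a').inv =
        ((h.comparison a b).hom ≫ y.map (β_ a b).hom ≫ (h.comparison b a).inv) ≫
          bimap T (y.map g) (y.map f) := by
    simp only [Category.assoc]
    rw [h.comparison_inv_natural, reassoc_of% h.comparison_natural f g, ← y.map_comp_assoc,
      BraidedCategory.braiding_naturality, y.map_comp_assoc]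
  obtain ⟨β, hβ⟩ := (hy.homBij₂ T h.left h.right).exists_iso (hy.homBij₂ T.flip h.right h.left)
    (NatIso.ofComponents (fun a => NatIso.ofComponents (fun b =>
      h.comparison a b ≪≫ y.mapIso (β_ a b) ≪≫ (h.comparison b a).symm)
      (fun {b b'} g => by
        have := nat (𝟙 a) g
        simp only [CategoryTheory.Functor.map_id, bimap_id_left, bimap_id_right] at this
        exact this))
      (fun {a a'} f => by
        ext b
        have := nat f (𝟙 b)
        simp only [CategoryTheory.Functor.map_id, bimap_id_left, bimap_id_right] at this
        exact this))
  refine ⟨⟨fun p q => (β.app p).app q, fun {p p' q q'} f g => ?_, fun a b => ?_⟩⟩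
  · have h1 := NatTrans.congr_app (β.hom.naturality f) q
    have h2 := (β.hom.app p').naturality g
    dsimp at h1 h2
    simp only [bimap, Category.assoc]
    refine (congrArg (_ ≫ ·) h2).trans (((reassoc_of% h1) _).trans (congrArg (_ ≫ ·) ?_))
    exact ((T.map g).naturality f)
  · rw [← Iso.eq_comp_inv, Category.assoc]
    exact NatTrans.congr_app (NatTrans.congr_app hβ a) b

namespace TensorBraiding

variable {h : TensorExtension.{w} y T} (s : TensorBraiding h) (c : TensorConstraints h)

omit [SymmetricCategory A] in
lemma comparison_hom_ext {a b e : A} {p : D}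
    {φ ψ : p ⟶ (T.obj (y.obj a)).obj ((T.obj (y.obj b)).obj (y.obj e))}
    (H : φ ≫ bimap T (𝟙 _) (h.comparison b e).hom ≫ (h.comparison a (b ⊗ e)).hom =
      ψ ≫ bimap T (𝟙 _) (h.comparison b e).hom ≫ (h.comparison a (b ⊗ e)).hom) : φ = ψ := by
  rwa [cancel_mono] at H

/-- After the comparison onto `y.obj (b ⊗ e ⊗ a)` or its analogue for the other ordering of factors,
every constraint becomes the image under `y` of a constraint of `A`, and the hexagon of `A` applies.
-/
lemma hexagon_rep (a b e : A) :
    (c.assoc (y.obj a) (y.obj b) (y.obj e)).hom ≫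
      (s.braid (y.obj a) ((T.obj (y.obj b)).obj (y.obj e))).hom ≫
        (c.assoc (y.obj b) (y.obj e) (y.obj a)).hom =
      bimap T (s.braid (y.obj a) (y.obj b)).hom (𝟙 (y.obj e)) ≫
        (c.assoc (y.obj b) (y.obj a) (y.obj e)).hom ≫
          bimap T (𝟙 (y.obj b)) (s.braid (y.obj a) (y.obj e)).hom := by
  refine comparison_hom_ext (h := h) ?_
  have e1 := TensorConstraints.bimap_comparison (h := h) (𝟙 (y.obj b)) (h.comparison a e).hom
    (𝟙 b) (β_ a e).hom
  have e2 := TensorConstraints.bimap_comparison (h := h) (h.comparison a b).hom (𝟙 (y.obj e))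
    (β_ a b).hom (𝟙 e)
  simp only [y.map_id, Category.comp_id] at e1 e2
  simp only [Category.assoc]
  rw [c.assoc_comparison, ← reassoc_of% s.natural (𝟙 (y.obj a)) (h.comparison b e).hom,
    reassoc_of% s.rep, reassoc_of% c.assoc_comparison, bimap_comp_bimap_assoc, Category.comp_id,
    s.rep, e1, reassoc_of% c.assoc_comparison, bimap_comp_bimap_assoc, Category.comp_id, s.rep,
    reassoc_of% e2, ← y.map_comp, ← y.map_comp, ← y.map_comp, ← y.map_comp,
    BraidedCategory.hexagon_forward, id_tensorHom, tensorHom_id]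

variable (hy : SmallDense.{w} y)
include hy

lemma hexagon (p q r : D) :
    (c.assoc p q r).hom ≫ (s.braid p ((T.obj q).obj r)).hom ≫ (c.assoc q r p).hom =
      bimap T (s.braid p q).hom (𝟙 r) ≫ (c.assoc q p r).hom ≫
        bimap T (𝟙 q) (s.braid p r).hom := by
  refine TensorConstraints.hom_ext₃ (h := h) hy fun a₁ a₂ a₃ i j k => ?_
  rw [reassoc_of% c.assoc_natural i j k, reassoc_of% s.natural i (bimap T j k), c.assoc_natural,
    reassoc_of% s.hexagon_rep c, bimap_comp_bimap_assoc, s.natural, Category.comp_id,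
    ← Category.id_comp k, ← bimap_comp_bimap, Category.assoc, reassoc_of% c.assoc_natural j i k,
    bimap_comp_bimap, bimap_comp_bimap, s.natural, Category.comp_id, Category.id_comp,
    Category.id_comp]

lemma symmetry (p q : D) : (s.braid p q).hom ≫ (s.braid q p).hom = 𝟙 _ := by
  refine TensorConstraints.hom_ext₂ (h := h) hy fun a b i j => ?_
  have : (s.braid (y.obj a) (y.obj b)).hom ≫ (s.braid (y.obj b) (y.obj a)).hom = 𝟙 _ := by
    rw [← cancel_mono (h.comparison a b).hom, Category.assoc, s.rep, reassoc_of% s.rep,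
      ← y.map_comp, SymmetricCategory.symmetry]
    simp
  rw [reassoc_of% s.natural, s.natural, reassoc_of% this, Category.comp_id]

/-- The symmetric monoidal structure. -/
abbrev symmetricCategory :
    letI := c.monoidal hy
    SymmetricCategory D :=
  letI := c.monoidal hy
  { braiding := s.braid
    braiding_naturality_right := fun p _ _ f => by
      have := s.natural (𝟙 p) f
      rw [bimap_id_left, bimap_id_right] at this
      exact this
    braiding_naturality_left := fun f p => by
      have := s.natural f (𝟙 p)
      rw [bimap_id_left, bimap_id_right] at this
      exact this
    hexagon_forward := fun p q r => by
      have := s.hexagon c hy p q r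
      rw [bimap_id_left, bimap_id_right] at this
      exact this
    hexagon_reverse := fun p q r => by
      -- Because the symmetry is its own inverse, the reverse hexagon is the inverse of a forward
      -- one.
      have symm (p q : D) : (s.braid p q).inv = (s.braid q p).hom := by
        exact ((Iso.hom_comp_eq_id _).1 (s.symmetry hy p q)).symm
      have key : α_ r p q ≪≫ s.braid r (p ⊗ q) ≪≫ α_ p q r =
          whiskerRightIso (s.braid r p) q ≪≫ α_ p r q ≪≫ whiskerLeftIso p (s.braid r q) := by
        ext
        have := s.hexagon c hy r p q
        rw [bimap_id_left, bimap_id_right] at this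
        exact this
      have h1 := congrArg Iso.inv key
      simp only [Iso.trans_inv, Category.assoc, whiskerRightIso_inv, whiskerLeftIso_inv, symm] at h1
      exact h1
    symmetry := s.symmetry hy }

end TensorBraiding

end Braiding

/-- A monoidal structure extends along a fully faithful dense functor, if its tensor product
extends to a separately cocontinuous bifunctor. -/
theorem TensorExtension.exists_vmonoidal {κ : Variant} [VMonoidal κ A] (hy : SmallDense.{w} y)
    [y.Full] [y.Faithful] [HasColimitsOfSize.{w, w} D] (h : TensorExtension.{w} y T) :
    ∃ (_ : VMonoidal κ D) (c : y.CoreMonoidal), PreservesBraiding κ c ∧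
      (∀ d : D, PreservesColimitsOfSize.{w, w} (tensorLeft d)) ∧
        ∀ d : D, PreservesColimitsOfSize.{w, w} (tensorRight d) := by
  obtain ⟨c⟩ := h.nonempty_constraints hy
  have s (hκ : κ.symmetric = true) :=
    letI := VMonoidal.symm (D := A) hκ
    (h.nonempty_braiding hy).some
  -- Fullness makes `y.obj (𝟙_ A)` receive exactly one map from each `y.obj a`; the density
  -- presentation of `p` extends this to `p`.
  have t (hκ : κ.terminalUnit = true) (p : D) : ∃ f : p ⟶ y.obj (𝟙_ A), ∀ g, g = f := by
    have H := VMonoidal.term (D := A) hκ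
    obtain ⟨f, hf⟩ := hy.exists_desc (𝟭 D) (p := p) (fun a _ => y.map (H.from a))
      (fun {a b} f s => by
        simp only [Functor.id_map, ← y.map_comp]
        rw [H.hom_ext (f ≫ H.from b) (H.from a)])
    refine ⟨f, fun g => hy.hom_ext (𝟭 D) fun a s => ?_⟩
    rw [hf, ← y.map_preimage ((𝟭 D).map s ≫ g)]
    exact congrArg y.map (H.hom_ext _ _)
  choose t ht using t
  let N : VMonoidal κ D :=
    { c.monoidal hy with
      symm := fun hκ =>
        letI := VMonoidal.symm (D := A) hκ
        (s hκ).symmetricCategory c hy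
      term := fun hκ => IsTerminal.ofUniqueHom (t hκ) fun _ g => ht hκ _ g }
  refine ⟨N,
    { εIso := Iso.refl _
      μIso := h.comparison
      μIso_hom_natural_left := fun {a a'} f b => ?_
      μIso_hom_natural_right := fun {b b'} a f => ?_
      associativity := fun a b e => ?_
      left_unitality := fun a => ?_
      right_unitality := fun a => ?_ }, fun hκ a b => ?_, h.right, h.left⟩
  · have := h.comparison_natural f (𝟙 b)
    rw [y.map_id, bimap_id_right, tensorHom_id] at this
    exact this
  · have := h.comparison_natural (𝟙 a) f
    rw [y.map_id, bimap_id_left, id_tensorHom] at this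
    exact this
  · have := c.assoc_comparison a b e
    rw [bimap_id_left, bimap_id_right] at this
    exact this.symm
  · refine (c.left_rep a).trans ((Category.id_comp _).symm.trans (congrArg (· ≫ _) ?_))
    exact (id_whiskerRight _ _).symm
  · refine (c.right_rep a).trans ((Category.id_comp _).symm.trans (congrArg (· ≫ _) ?_))
    exact (whiskerLeft_id _ _).symm
  · let := VMonoidal.symm (D := A) hκ
    exact ((s hκ).rep a b).symm

end ExtensionOfTensor

/-! ### Extending strong monoidal structures to cocontinuous functors -/

section ExtensionOfStrongFunctors

open MonoidalCategory Limits

universe w v₁ u₁ v₂ u₂ v₃ u₃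

variable {A : Type u₁} [Category.{v₁} A] {D : Type u₂} [Category.{v₂} D]
  {E : Type u₃} [Category.{v₃} E] {y : A ⥤ D} (hy : SmallDense.{w} y)
  (G : D ⥤ E) [PreservesColimitsOfSize.{w, w} G]

section HomExt

variable [MonoidalCategory E] [∀ e : E, PreservesColimitsOfSize.{w, w} (tensorLeft e)]
  [∀ e : E, PreservesColimitsOfSize.{w, w} (tensorRight e)]
include hy

/-- `G` followed by tensoring with a fixed object, on either side, is again cocontinuous, so
`hom_ext` can be applied in one variable after the other. -/
lemma SmallDense.tensor_hom_ext₂ {p q : D} {e : E} {φ ψ : G.obj p ⊗ G.obj q ⟶ e}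
    (H : ∀ (a b : A) (s : y.obj a ⟶ p) (t : y.obj b ⟶ q),
      (G.map s ⊗ₘ G.map t) ≫ φ = (G.map s ⊗ₘ G.map t) ≫ ψ) : φ = ψ := by
  refine hy.hom_ext (G ⋙ tensorRight (G.obj q)) fun a s =>
    hy.hom_ext (G ⋙ tensorLeft (G.obj (y.obj a))) fun b t => ?_
  have := H a b s t
  rw [tensorHom_def'] at this
  simpa using this

lemma SmallDense.tensor_hom_ext₃ {p q r : D} {e : E}
    {φ ψ : (G.obj p ⊗ G.obj q) ⊗ G.obj r ⟶ e}
    (H : ∀ (a b c : A) (s : y.obj a ⟶ p) (t : y.obj b ⟶ q) (k : y.obj c ⟶ r),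
      ((G.map s ⊗ₘ G.map t) ⊗ₘ G.map k) ≫ φ = ((G.map s ⊗ₘ G.map t) ⊗ₘ G.map k) ≫ ψ) :
    φ = ψ := by
  refine hy.hom_ext (G ⋙ tensorRight (G.obj q) ⋙ tensorRight (G.obj r)) fun a s =>
    hy.hom_ext (G ⋙ tensorLeft (G.obj (y.obj a)) ⋙ tensorRight (G.obj r)) fun b t =>
    hy.hom_ext (G ⋙ tensorLeft (G.obj (y.obj a) ⊗ G.obj (y.obj b))) fun c k => ?_
  have := H a b c s t k
  rw [tensorHom_def', tensorHom_def'] at this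
  simpa using this

end HomExt

section CoreMonoidal

variable [MonoidalCategory A] [MonoidalCategory D] {F : A ⥤ D} (c : F.CoreMonoidal)

lemma coreMonoidal_natural {a a' b b' : A} (f : a ⟶ a') (g : b ⟶ b') :
    (F.map f ⊗ₘ F.map g) ≫ (c.μIso a' b').hom = (c.μIso a b).hom ≫ F.map (f ⊗ₘ g) := by
  rw [MonoidalCategory.tensorHom_def, MonoidalCategory.tensorHom_def, Category.assoc,
    c.μIso_hom_natural_right, c.μIso_hom_natural_left_assoc, F.map_comp]

lemma coreMonoidal_inv_natural {a a' b b' : A} (f : a ⟶ a') (g : b ⟶ b') :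
    (c.μIso a b).inv ≫ (F.map f ⊗ₘ F.map g) = F.map (f ⊗ₘ g) ≫ (c.μIso a' b').inv := by
  rw [Iso.inv_comp_eq, ← Category.assoc, Iso.eq_comp_inv, coreMonoidal_natural]

end CoreMonoidal

variable [MonoidalCategory A] [MonoidalCategory D] [MonoidalCategory E]
  [∀ e : E, PreservesColimitsOfSize.{w, w} (tensorLeft e)]
  [∀ e : E, PreservesColimitsOfSize.{w, w} (tensorRight e)]

section Tensorator

variable [∀ d : D, PreservesColimitsOfSize.{w, w} (tensorLeft d)]
  [∀ d : D, PreservesColimitsOfSize.{w, w} (tensorRight d)]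
  [HasColimitsOfSize.{w, w} E] (cU : y.CoreMonoidal) (cF : (y ⋙ G).CoreMonoidal)

-- Both `G p ⊗ G q` and `G (p ⊗ q)` are cocontinuous in each variable. On the image of `y` they are
-- identified by the tensorator of `y ⋙ G` and the inverse of that of `y`, and `homBij₂` extends
-- this identification.
include hy in
lemma SmallDense.exists_tensorator : ∃ m : ∀ p q : D, G.obj p ⊗ G.obj q ≅ G.obj (p ⊗ q),
    (∀ {p p' q q' : D} (s : p ⟶ p') (t : q ⟶ q'),
      (G.map s ⊗ₘ G.map t) ≫ (m p' q').hom = (m p q).hom ≫ G.map (s ⊗ₘ t)) ∧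
    ∀ a b : A, (m (y.obj a) (y.obj b)).hom ≫ G.map (cU.μIso a b).hom = (cF.μIso a b).hom := by
  let T₁ : D ⥤ D ⥤ E := (G ⋙ curriedTensor E) ⋙ (Functor.whiskeringLeft D E E).obj G
  let T₂ : D ⥤ D ⥤ E := curriedTensor D ⋙ (Functor.whiskeringRight D D E).obj G
  have nat {a a' b b' : A} (f : a ⟶ a') (g : b ⟶ b') :
      (G.map (y.map f) ⊗ₘ G.map (y.map g)) ≫ (cF.μIso a' b').hom ≫ G.map (cU.μIso a' b').inv =
        ((cF.μIso a b).hom ≫ G.map (cU.μIso a b).inv) ≫ G.map (y.map f ⊗ₘ y.map g) := by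
    rw [Category.assoc, ← G.map_comp, coreMonoidal_inv_natural, G.map_comp]
    exact (reassoc_of% coreMonoidal_natural cF f g) _
  obtain ⟨m, hm⟩ := (hy.homBij₂ T₁
    (fun d => (inferInstance : PreservesColimitsOfSize.{w, w} (G ⋙ tensorRight (G.obj d))))
    (fun d => (inferInstance : PreservesColimitsOfSize.{w, w}
      (G ⋙ tensorLeft (G.obj d))))).exists_iso (hy.homBij₂ T₂
    (fun d => (inferInstance : PreservesColimitsOfSize.{w, w} (tensorRight d ⋙ G)))
    (fun d => (inferInstance : PreservesColimitsOfSize.{w, w} (tensorLeft d ⋙ G))))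
    (NatIso.ofComponents (fun a => NatIso.ofComponents
      (fun b => cF.μIso a b ≪≫ (G.mapIso (cU.μIso a b)).symm)
      (fun {b b'} g => by
        have := nat (𝟙 a) g
        simp only [CategoryTheory.Functor.map_id, id_tensorHom] at this
        exact this))
      (fun {a a'} f => by
        ext b
        have := nat f (𝟙 b)
        simp only [CategoryTheory.Functor.map_id, tensorHom_id] at this
        exact this))
  refine ⟨fun p q => (m.app p).app q, fun {p p' q q'} s t => ?_, fun a b => ?_⟩
  · have h1 : G.map s ▷ G.obj q ≫ ((m.app p').app q).hom = ((m.app p).app q).hom ≫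
      G.map (s ▷ q) := NatTrans.congr_app (m.hom.naturality s) q
    have h2 : G.obj p' ◁ G.map t ≫ ((m.app p').app q').hom = ((m.app p').app q).hom ≫
      G.map (p' ◁ t) := (m.hom.app p').naturality t
    rw [MonoidalCategory.tensorHom_def, MonoidalCategory.tensorHom_def, G.map_comp]
    exact (Category.assoc _ _ _).trans ((congrArg (_ ≫ ·) h2).trans ((reassoc_of% h1) _))
  · have : ((m.app (y.obj a)).app (y.obj b)).hom =
      (cF.μIso a b).hom ≫ (G.mapIso (cU.μIso a b)).inv :=
        NatTrans.congr_app (NatTrans.congr_app hm a) b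
    rw [this, Category.assoc, Functor.mapIso_inv, ← G.map_comp, Iso.inv_hom_id, G.map_id]
    exact Category.comp_id _

/-- A cocontinuous functor `G` is strong monoidal as soon as its restriction along a strong
monoidal dense functor is. -/
theorem SmallDense.exists_coreMonoidal (hy : SmallDense.{w} y) : ∃ c : G.CoreMonoidal,
    c.εIso.hom ≫ G.map cU.εIso.hom = cF.εIso.hom ∧
    ∀ a b : A, (c.μIso (y.obj a) (y.obj b)).hom ≫ G.map (cU.μIso a b).hom =
      (cF.μIso a b).hom := by
  obtain ⟨m, nat, rep⟩ := hy.exists_tensorator G cU cF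
  have natl {p p' : D} (s : p ⟶ p') (q : D) :
      G.map s ▷ G.obj q ≫ (m p' q).hom = (m p q).hom ≫ G.map (s ▷ q) := by
    simpa using nat s (𝟙 q)
  have natr (p : D) {q q' : D} (t : q ⟶ q') :
      G.obj p ◁ G.map t ≫ (m p q').hom = (m p q).hom ≫ G.map (p ◁ t) := by
    simpa using nat (𝟙 p) t
  have assoc_rep (a b e : A) : (m (y.obj a) (y.obj b)).hom ▷ G.obj (y.obj e) ≫
      (m (y.obj a ⊗ y.obj b) (y.obj e)).hom ≫ G.map (α_ (y.obj a) (y.obj b) (y.obj e)).hom =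
      (α_ _ _ _).hom ≫ G.obj (y.obj a) ◁ (m (y.obj b) (y.obj e)).hom ≫
        (m (y.obj a) (y.obj b ⊗ y.obj e)).hom := by
    -- Cancelling the image of the tensorators of `y` reduces the claim to the associativity axioms
    -- of `y ⋙ G` and of `y`.
    rw [← cancel_mono (G.map (y.obj a ◁ (cU.μIso b e).hom ≫ (cU.μIso a (b ⊗ e)).hom))]
    have hF := cF.associativity a b e
    have hU := cU.associativity a b e
    simp only [Functor.comp_obj, Functor.comp_map, ← rep, comp_whiskerRight,
      MonoidalCategory.whiskerLeft_comp, Category.assoc] at hF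
    simp only [Category.assoc, ← G.map_comp]
    rw [← hU]
    simp only [G.map_comp]
    rw [← reassoc_of% natl, ← reassoc_of% natr]
    exact hF
  -- This unit comparison is forced by the requirement that the composite structure on `y ⋙ G` be
  -- `cF`.
  refine ⟨{ εIso := cF.εIso ≪≫ (G.mapIso cU.εIso).symm
            μIso := m
            μIso_hom_natural_left := natl
            μIso_hom_natural_right := fun p t => natr p t
            associativity := fun p q r => ?_
            left_unitality := fun p => ?_
            right_unitality := fun p => ?_ }, ?_, rep⟩
  · refine hy.tensor_hom_ext₃ G fun a b e s t k => ?_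
    have e1 : ((G.map s ⊗ₘ G.map t) ⊗ₘ G.map k) ≫ (m p q).hom ▷ G.obj r =
        (m _ _).hom ▷ G.obj (y.obj e) ≫ (G.map (s ⊗ₘ t) ⊗ₘ G.map k) := by
      rw [← tensorHom_id, ← tensorHom_id, tensorHom_comp_tensorHom, tensorHom_comp_tensorHom, nat,
        Category.comp_id, Category.id_comp]
    have e2 : (G.map s ⊗ₘ G.map t ⊗ₘ G.map k) ≫ G.obj p ◁ (m q r).hom =
        G.obj (y.obj a) ◁ (m _ _).hom ≫ (G.map s ⊗ₘ G.map (t ⊗ₘ k)) := by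
      rw [← id_tensorHom, ← id_tensorHom, tensorHom_comp_tensorHom, tensorHom_comp_tensorHom, nat,
        Category.comp_id, Category.id_comp]
    rw [reassoc_of% e1, reassoc_of% nat (s ⊗ₘ t) k, ← G.map_comp, associator_naturality,
      G.map_comp, reassoc_of% assoc_rep, associator_naturality_assoc, reassoc_of% e2, nat]
  -- The unit axiom involves one variable, so it is tested on the objects `y.obj a`, where it
  -- follows from the unit axioms of `y` and of `y ⋙ G`.
  · refine hy.hom_ext (G ⋙ tensorLeft (𝟙_ E)) fun a s => ?_
    have h1 := cF.left_unitality a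
    simp only [Functor.comp_obj, Functor.comp_map, ← rep, Category.assoc] at h1
    have h2 : (λ_ (G.obj (y.obj a))).hom = (cF.εIso.hom ≫ G.map cU.εIso.inv) ▷ G.obj (y.obj a) ≫
        (m _ _).hom ≫ G.map (λ_ (y.obj a)).hom := by
      rw [cU.left_unitality a, comp_whiskerRight, Category.assoc]
      simp only [G.map_comp]
      rw [← reassoc_of% natl, ← comp_whiskerRight_assoc (G.map _), ← G.map_comp, Iso.inv_hom_id,
        G.map_id, id_whiskerRight, Category.id_comp]
      exact h1
    change 𝟙_ E ◁ G.map s ≫ (λ_ (G.obj p)).hom = 𝟙_ E ◁ G.map s ≫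
      (cF.εIso.hom ≫ G.map cU.εIso.inv) ▷ G.obj p ≫ (m _ _).hom ≫ G.map (λ_ p).hom
    rw [leftUnitor_naturality, h2, whisker_exchange_assoc, reassoc_of% natr, ← G.map_comp,
      leftUnitor_naturality]
    simp only [G.map_comp, Category.assoc]
  · refine hy.hom_ext (G ⋙ tensorRight (𝟙_ E)) fun a s => ?_
    have h1 := cF.right_unitality a
    simp only [Functor.comp_obj, Functor.comp_map, ← rep, Category.assoc] at h1
    have h2 : (ρ_ (G.obj (y.obj a))).hom = G.obj (y.obj a) ◁ (cF.εIso.hom ≫ G.map cU.εIso.inv) ≫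
        (m _ _).hom ≫ G.map (ρ_ (y.obj a)).hom := by
      rw [cU.right_unitality a, MonoidalCategory.whiskerLeft_comp, Category.assoc]
      simp only [G.map_comp]
      rw [← reassoc_of% natr, ← whiskerLeft_comp_assoc _ (G.map _), ← G.map_comp, Iso.inv_hom_id,
        G.map_id, MonoidalCategory.whiskerLeft_id, Category.id_comp]
      exact h1
    change G.map s ▷ 𝟙_ E ≫ (ρ_ (G.obj p)).hom = G.map s ▷ 𝟙_ E ≫
      G.obj p ◁ (cF.εIso.hom ≫ G.map cU.εIso.inv) ≫ (m _ _).hom ≫ G.map (ρ_ p).hom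
    rw [rightUnitor_naturality, h2, ← whisker_exchange_assoc, reassoc_of% natl, ← G.map_comp,
      rightUnitor_naturality]
    simp only [G.map_comp, Category.assoc]
  · simp [← G.map_comp]

end Tensorator

end ExtensionOfStrongFunctors

/-! ### Extending pseudomorphisms and algebra 2-cells -/

section TransportOfBraiding

open MonoidalCategory

variable {κ : Variant} {C E : Type*} [Category* C] [Category* E] [VMonoidal κ C] [VMonoidal κ E]
  {F G : C ⥤ E}

lemma PreservesBraiding.transport {c : F.CoreMonoidal} (hc : PreservesBraiding κ c) (i : F ≅ G) :
    let := c.toMonoidal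
    PreservesBraiding κ (Functor.Monoidal.coreMonoidalTransport i) := by
  intro _ hκ a b
  let := VMonoidal.symm (D := C) hκ
  let := VMonoidal.symm (D := E) hκ
  have h1 : (c.μIso a b).hom ≫ F.map (β_ a b).hom =
    (β_ (F.obj a) (F.obj b)).hom ≫ (c.μIso b a).hom := hc hκ a b
  have h2 : (i.inv.app a ⊗ₘ i.inv.app b) ≫ (β_ _ _).hom =
    (β_ _ _).hom ≫ (i.inv.app b ⊗ₘ i.inv.app a) := BraidedCategory.braiding_naturality _ _
  change ((i.inv.app a ⊗ₘ i.inv.app b) ≫ (c.μIso a b).hom ≫ i.hom.app (a ⊗ b)) ≫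
    G.map (β_ a b).hom = (β_ (G.obj a) (G.obj b)).hom ≫ (i.inv.app b ⊗ₘ i.inv.app a) ≫
      (c.μIso b a).hom ≫ i.hom.app (b ⊗ a)
  rw [← reassoc_of% h2, ← reassoc_of% h1, i.hom.naturality]
  simp only [Category.assoc]

end TransportOfBraiding

section ExtensionOfPseudomorphisms

open MonoidalCategory Limits Bicategory

variable {κ : Variant} {X Y Z : CAT.{u}} {M : VMonoidal κ X.toCat} {N : VMonoidal κ Y.toCat}
  {O : VMonoidal κ Z.toCat} {u' : X ⟶ Y} {U : PsMorStr (algOf M) (algOf N) u'}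

lemma PsMorStr.mulMap_natural {f : X ⟶ Y} (P : PsMorStr (algOf M) (algOf N) f) {a a' b b' : X.toCat}
    (s : a ⟶ a') (t : b ⟶ b') :
    ((CAT.functor f).map s ⊗ₘ (CAT.functor f).map t) ≫ P.mulMap a' b' =
      P.mulMap a b ≫ (CAT.functor f).map (s ⊗ₘ t) :=
  coreMonoidal_natural P.core s t

variable (hu : SmallDense.{u} (CAT.functor u'))
  [∀ e : Z.toCat, PreservesColimitsOfSize.{u, u} (tensorLeft e)]
  [∀ e : Z.toCat, PreservesColimitsOfSize.{u, u} (tensorRight e)]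
include hu

/-- A 2-cell out of a cocontinuous pseudomorphism is an algebra 2-cell if its restriction along a
dense pseudomorphism is one. -/
theorem isAlg2Cell_of_whiskerLeft {g g' : Y ⟶ Z} {G : PsMorStr (algOf N) (algOf O) g}
    {G' : PsMorStr (algOf N) (algOf O) g'} [PreservesColimitsOfSize.{u, u} (CAT.functor g)]
    {τ : g ⟶ g'} (h : IsAlg2Cell (U.comp G) (U.comp G') (u' ◁ τ)) : IsAlg2Cell G G' τ := by
  rw [PsMorStr.isAlg2Cell_iff] at h ⊢
  obtain ⟨h1, h2⟩ := h
  simp only [PsMorStr.comp_unitMap, PsMorStr.comp_mulMap, Category.assoc] at h1 h2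
  constructor
  · rw [← cancel_mono ((CAT.functor g').map U.unitMap), ← h1, Category.assoc]
    exact congrArg (_ ≫ ·) ((CAT.natTrans τ).naturality _).symm
  · intro p q
    refine hu.tensor_hom_ext₂ (CAT.functor g) fun a b s t => ?_
    have h3 := h2 a b
    -- The binary condition on the image of `u'`: it is the hypothesis on the composites, after
    -- cancelling the invertible image of the tensorator of `u'`.
    have h4 : G.mulMap _ _ ≫ (CAT.natTrans τ).app ((CAT.functor u').obj a ⊗ (CAT.functor u').obj b) =
        ((CAT.natTrans τ).app _ ⊗ₘ (CAT.natTrans τ).app _) ≫ G'.mulMap _ _ := by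
      rw [← cancel_mono ((CAT.functor g').map (U.mulMap a b)), Category.assoc, Category.assoc,
        ← (CAT.natTrans τ).naturality]
      exact h3
    rw [← Category.assoc, PsMorStr.mulMap_natural, Category.assoc, (CAT.natTrans τ).naturality,
      reassoc_of% h4, ← PsMorStr.mulMap_natural, tensorHom_comp_tensorHom_assoc,
      tensorHom_comp_tensorHom_assoc, (CAT.natTrans τ).naturality, (CAT.natTrans τ).naturality]

/-- A cocontinuous functor has a pseudomorphism structure as soon as its restriction along a dense
pseudomorphism has one. -/
theorem exists_isAlg2Cell [HasColimitsOfSize.{u, u} Z.toCat]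
    [∀ e : Y.toCat, PreservesColimitsOfSize.{u, u} (tensorLeft e)]
    [∀ e : Y.toCat, PreservesColimitsOfSize.{u, u} (tensorRight e)] {f : X ⟶ Z} {g : Y ⟶ Z}
    [PreservesColimitsOfSize.{u, u} (CAT.functor g)] (F : PsMorStr (algOf M) (algOf O) f)
    (η : f ≅ u' ≫ g) : ∃ G : PsMorStr (algOf N) (algOf O) g, IsAlg2Cell F (U.comp G) η.hom := by
  let i : CAT.functor f ≅ CAT.functor u' ⋙ CAT.functor g :=
    { hom := CAT.natTrans η.hom
      inv := CAT.natTrans η.inv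
      hom_inv_id := congrArg CAT.natTrans η.hom_inv_id
      inv_hom_id := congrArg CAT.natTrans η.inv_hom_id }
  let := F.core.toMonoidal
  -- The monoidal structure of `f` is transported along `η` to the restriction of `g`, so that `η`
  -- is monoidal by construction. The structure on `g` is then an extension of `cF`.
  let cF := Functor.Monoidal.coreMonoidalTransport i
  obtain ⟨c, hc₁, hc₂⟩ := hu.exists_coreMonoidal (CAT.functor g) U.core cF
  have hc : PreservesBraiding κ c := by
    intro hκ p q
    let := VMonoidal.symm (D := X.toCat) hκ
    let := VMonoidal.symm (D := Y.toCat) hκ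
    let := VMonoidal.symm (D := Z.toCat) hκ
    have hF : PreservesBraiding κ cF := F.preservesBraiding.transport i
    -- Naturality of both symmetries reduces compatibility to objects in the image of `u'`, where it
    -- holds because `cF` and `U` preserve the symmetries.
    refine hu.tensor_hom_ext₂ (CAT.functor g) fun a b s t => ?_
    change _ ≫ _ ≫ (CAT.functor g).map (β_ p q).hom = _ ≫ (β_ _ _).hom ≫ _
    rw [← Category.assoc, coreMonoidal_natural, Category.assoc, ← Functor.map_comp,
      BraidedCategory.braiding_naturality, BraidedCategory.braiding_naturality_assoc,
      coreMonoidal_natural, Functor.map_comp]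
    have key : (c.μIso _ _).hom ≫ (CAT.functor g).map (β_ ((CAT.functor u').obj a)
        ((CAT.functor u').obj b)).hom = (β_ _ _).hom ≫ (c.μIso _ _).hom := by
      rw [← cancel_mono ((CAT.functor g).map (U.core.μIso b a).hom), Category.assoc,
        Category.assoc, hc₂, ← Functor.map_comp]
      have hU : (U.core.μIso a b).hom ≫ (CAT.functor u').map (β_ a b).hom =
        (β_ _ _).hom ≫ (U.core.μIso b a).hom := U.preservesBraiding hκ a b
      rw [← hU, Functor.map_comp, reassoc_of% hc₂]
      exact hF hκ a b
    rw [reassoc_of% key]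
  refine ⟨PsMorStr.ofCore c hc, PsMorStr.isAlg2Cell_iff.2 ⟨?_, fun a b => ?_⟩⟩
  · rw [PsMorStr.comp_unitMap, PsMorStr.ofCore_unitMap]
    exact hc₁.symm
  · rw [PsMorStr.comp_mulMap, PsMorStr.ofCore_mulMap]
    refine Eq.trans ?_ (congrArg (_ ≫ ·) (hc₂ a b).symm)
    change F.mulMap a b ≫ i.hom.app _ = (i.hom.app a ⊗ₘ i.hom.app b) ≫ (i.inv.app a ⊗ₘ i.inv.app b) ≫
      F.mulMap a b ≫ i.hom.app _
    rw [tensorHom_comp_tensorHom_assoc]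
    simp

end ExtensionOfPseudomorphisms

/-! ### Existence of the Day convolution bifunctor -/

section PresheafTensor

open MonoidalCategory Limits Opposite

universe v₁ u₁ v₂ u₂

variable (X : Type u₁) [Category.{v₁} X] [LocallySmall.{u} X] [Small.{u} X]

lemma yo_smallDense : SmallDense.{u} (yo X) where
  dense := ⟨yoDense⟩
  small _ := by
    have := essentiallySmall_of_small_of_locallySmall.{u} X
    infer_instance

variable {X} {E : Type u₂} [Category.{v₂} E] [HasColimitsOfSize.{u, u} E]

/-- By uniqueness of left Kan extensions, `(yo X).lan.obj F` is isomorphic to the pointwise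
extension `yoExt F`, which is a left adjoint. -/
instance preservesColimits_lan_obj [LocallySmall.{u} E] (F : X ⥤ E) :
    PreservesColimitsOfSize.{u, u} ((yo X).lan.obj F) := by
  have : (yoExt F).IsLeftKanExtension (yoExtUnit F) := (yoExtIsPointwise F).isLeftKanExtension
  have : PreservesColimitsOfSize.{u, u} (yoExt F) :=
    (Adjunction.ofIsLeftAdjoint (yoExt F)).leftAdjoint_preservesColimits
  exact preservesColimits_of_natIso
    (Functor.leftKanExtensionUnique _ (yoExtUnit F) _ ((yo X).lanUnit.app F))

variable [MonoidalCategory X]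

/-- The bifunctor of Day convolution exists. -/
theorem exists_tensorExtension :
    ∃ T : (Xᵒᵖ ⥤ Type u) ⥤ (Xᵒᵖ ⥤ Type u) ⥤ Xᵒᵖ ⥤ Type u,
      Nonempty (TensorExtension.{u} (yo X) T) := by
  let L : (X ⥤ Xᵒᵖ ⥤ Type u) ⥤ (Xᵒᵖ ⥤ Type u) ⥤ Xᵒᵖ ⥤ Type u := (yo X).lan
  have hL : PreservesColimitsOfSize.{u, u} L :=
    ((yo X).lanAdjunction (Xᵒᵖ ⥤ Type u)).leftAdjoint_preservesColimits
  have hL' (F : X ⥤ Xᵒᵖ ⥤ Type u) : PreservesColimitsOfSize.{u, u} (L.obj F) :=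
    preservesColimits_lan_obj F
  let F : X ⥤ X ⥤ Xᵒᵖ ⥤ Type u :=
    curriedTensor X ⋙ (Functor.whiskeringRight X X (Xᵒᵖ ⥤ Type u)).obj (yo X)
  -- The tensor product is extended in one variable at a time: `F ⋙ L` extends the second variable,
  -- and applying `L` after the flip extends the first.
  let K : (Xᵒᵖ ⥤ Type u) ⥤ X ⥤ Xᵒᵖ ⥤ Type u := (F ⋙ L).flip
  have hK : PreservesColimitsOfSize.{u, u} K :=
    preservesColimits_of_evaluation _ fun x => hL' (F.obj x)
  -- The unit is invertible because the Yoneda embedding is fully faithful. Using it once for each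
  -- variable gives the comparison on representables.
  let i : 𝟭 _ ≅ L ⋙ (Functor.whiskeringLeft _ _ _).obj (yo X) := asIso (yo X).lanUnit
  refine ⟨(K ⋙ L).flip, ⟨⟨fun d => ?_, fun d => ?_, ?_⟩⟩⟩
  · exact hL' (K.obj d)
  · exact (inferInstance : PreservesColimitsOfSize.{u, u} ((K ⋙ L) ⋙ (evaluation _ _).obj d))
  · refine Iso.symm (NatIso.ofComponents (fun a => NatIso.ofComponents
      (fun b => (i.app (F.obj a)).app b ≪≫ (i.app (K.obj ((yo X).obj b))).app a)
      (fun {b b'} g => ?_)) (fun {a a'} f => ?_))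
    · have h1 := (i.hom.app (F.obj a)).naturality g
      have h2 := NatTrans.congr_app (i.hom.naturality (K.map ((yo X).map g))) a
      exact ((reassoc_of% h1) _).trans ((congrArg (_ ≫ ·) h2).trans (Category.assoc _ _ _).symm)
    · ext1
      ext1 b
      have h1 := NatTrans.congr_app (i.hom.naturality (F.map f)) b
      have h2 := (i.hom.app (K.obj ((yo X).obj b))).naturality f
      exact ((reassoc_of% h1) _).trans ((congrArg (_ ≫ ·) h2).trans (Category.assoc _ _ _).symm)

end PresheafTensor

/-! ### Monoidal cocompleteness in terms of the tensor product -/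

section Algebras

open MonoidalCategory Limits

variable {κ : Variant} {X : CAT.{u}} (M : VMonoidal κ X.toCat)

/-- The tensor product of the algebra given by a monoidal category. -/
def algOfTensorFunctorIso : (algOf M).tensorFunctor ≅ curriedTensor X.toCat :=
  NatIso.ofComponents (fun x => NatIso.ofComponents (fun _ => Iso.refl _) (fun {y y'} g =>
      (Category.comp_id _).trans ((id_tensorHom x g).trans (Category.id_comp _).symm)))
    (fun {x x'} f => by
      ext1
      ext1 y
      exact (Category.comp_id _).trans ((tensorHom_id f y).trans (Category.id_comp _).symm))

lemma monoidallyCocomplete_algOf_iff : (algOf M).MonoidallyCocomplete ↔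
    HasColimitsOfSize.{u, u} X.toCat ∧
      (∀ d : X.toCat, PreservesColimitsOfSize.{u, u} (tensorLeft d)) ∧
        ∀ d : X.toCat, PreservesColimitsOfSize.{u, u} (tensorRight d) := by
  let l (d : X.toCat) : (algOf M).tensorFunctor.obj d ≅ tensorLeft d :=
    (algOfTensorFunctorIso M).app d
  let r (d : X.toCat) : (algOf M).tensorFunctor.flip.obj d ≅ tensorRight d :=
    ((flipFunctor _ _ _).mapIso (algOfTensorFunctorIso M)).app d
  constructor
  · rintro ⟨h1, h2, h3⟩
    exact ⟨h1, fun d => preservesColimits_of_natIso (l d),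
      fun d => preservesColimits_of_natIso (r d)⟩
  · rintro ⟨h1, h2, h3⟩
    exact ⟨h1, fun d => preservesColimits_of_natIso (l d).symm,
      fun d => preservesColimits_of_natIso (r d).symm⟩

end Algebras

/-! ### Maps out of a tensor product and Day convolution -/

section Descent

open MonoidalCategory Limits

universe w v₁ u₁ v₂ u₂

variable {A : Type u₁} [Category.{v₁} A] {D : Type u₂} [Category.{v₂} D] [MonoidalCategory D]
  {y : A ⥤ D} (hy : SmallDense.{w} y) [∀ e : D, PreservesColimitsOfSize.{w, w} (tensorLeft e)]
  [∀ e : D, PreservesColimitsOfSize.{w, w} (tensorRight e)]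

-- The existence counterpart of `tensor_hom_ext₂` for the identity functor: the family is first
-- glued over `t` with `s` fixed, and the resulting maps are then glued over `s`.
include hy in
lemma SmallDense.exists_tensor_desc {p q e : D}
    (φ : ∀ a b, (y.obj a ⟶ p) → (y.obj b ⟶ q) → (y.obj a ⊗ y.obj b ⟶ e))
    (hφ : ∀ {a a' b b'} (f : a ⟶ a') (g : b ⟶ b') (s : y.obj a' ⟶ p) (t : y.obj b' ⟶ q),
      (y.map f ⊗ₘ y.map g) ≫ φ a' b' s t = φ a b (y.map f ≫ s) (y.map g ≫ t)) :
    ∃ ψ : p ⊗ q ⟶ e, ∀ a b s t, (s ⊗ₘ t) ≫ ψ = φ a b s t := by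
  choose χ hχ using fun (a : A) (s : y.obj a ⟶ p) =>
    hy.exists_desc (tensorLeft (y.obj a)) (p := q) (e := e) (fun b t => φ a b s t)
      (fun {b b'} g t => by simpa using hφ (𝟙 a) g s t)
  -- That the maps `χ` are compatible in the first variable is checked after restriction along each
  -- `t`, by uniqueness in the second variable.
  obtain ⟨ψ, hψ⟩ := hy.exists_desc (tensorRight q) (p := p) (e := e) χ (fun {a a'} f s =>
    hy.hom_ext (tensorLeft (y.obj a)) fun b t => by
      have h1 := hχ a' s b t
      dsimp at h1
      rw [hχ]
      dsimp
      rw [whisker_exchange_assoc, h1]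
      simpa using hφ f (𝟙 b) s t)
  refine ⟨ψ, fun a b s t => ?_⟩
  have h1 := hψ a s
  have h2 := hχ a s b t
  dsimp at h1 h2
  rw [tensorHom_def', Category.assoc, h1, h2]

end Descent

section Day

open MonoidalCategory Limits Opposite

section

variable {X : CatS.{u}} {x x' : (inclusion.obj X).toCat} {F G : (psh X).toCat}

/-- A morphism in the opposite category. -/
def opHom (f : x' ⟶ x) : (op x : X.toCAT.toCatᵒᵖ) ⟶ op x' := Quiver.Hom.op (V := X.toCAT.toCat) f

/-- The elements of a presheaf. -/
def Elt (F : (psh X).toCat) (x : (inclusion.obj X).toCat) : Type u :=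
  (F : X.toCAT.toCatᵒᵖ ⥤ Type u).obj (op x)

/-- The action of a morphism on the elements of a presheaf. -/
def Elt.restrict (s : Elt F x) (f : x' ⟶ x) : Elt F x' :=
  (F : X.toCAT.toCatᵒᵖ ⥤ Type u).map (opHom f) s

/-- The image of an element under a transformation. -/
def Elt.image (s : Elt F x) (β : F ⟶ G) : Elt G x :=
  NatTrans.app (C := X.toCAT.toCatᵒᵖ) (D := Type u) β (op x) s

/-- The Yoneda lemma. -/
noncomputable def elt : ((CAT.functor (yoMor X)).obj x ⟶ F) ≃ Elt F x :=
  shrinkYonedaEquiv (C := X.toCAT.toCat) (P := F)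

lemma elt_comp (α : (CAT.functor (yoMor X)).obj x ⟶ F) (β : F ⟶ G) :
    elt (α ≫ β) = (elt α).image β :=
  shrinkYonedaEquiv_comp (C := X.toCAT.toCat) (Q := G) α β

lemma elt_symm_image (β : F ⟶ G) (s : Elt F x) :
    elt.symm (s.image β) = elt.symm s ≫ β := by
  rw [Equiv.symm_apply_eq, elt_comp, Equiv.apply_symm_apply]

lemma elt_map_comp (α : (CAT.functor (yoMor X)).obj x ⟶ F) (f : x' ⟶ x) :
    elt ((CAT.functor (yoMor X)).map f ≫ α) = (elt α).restrict f :=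
  (shrinkYonedaEquiv_naturality (C := X.toCAT.toCat) (P := F) α f).symm

lemma elt_symm_restrict (s : Elt F x) (f : x' ⟶ x) :
    elt.symm (s.restrict f) = (CAT.functor (yoMor X)).map f ≫ elt.symm s := by
  rw [Equiv.symm_apply_eq, elt_map_comp, Equiv.apply_symm_apply]

end

variable {κ : Variant} {X : CatS.{u}} {M : VMonoidal κ (inclusion.obj X).toCat}
  {N : VMonoidal κ (psh X).toCat}

lemma tensorOp_map {x x' y y' : (inclusion.obj X).toCat} (h : x' ⟶ x) (k : y' ⟶ y) :
    (algOf M).tensorOp.map (X := ((op x, op y) : X.toCAT.toCatᵒᵖ × X.toCAT.toCatᵒᵖ))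
      (Y := (op x', op y')) (opHom h, opHom k) = opHom (h ⊗ₘ k) := by
  refine congrArg opHom ?_
  refine (tensorHom_comp_tensorHom h (𝟙 _) (𝟙 _) k).trans ?_
  rw [Category.comp_id, Category.id_comp]

lemma pshTensor_map {p q : (psh X).toCat × (psh X).toCat} (f : p ⟶ q) :
    (algOf N).pshTensor.map f = f.1 ⊗ₘ f.2 := by
  refine (tensorHom_comp_tensorHom f.1 (𝟙 _) (𝟙 _) f.2).trans ?_
  rw [Category.comp_id, Category.id_comp]

variable (U : PsMorStr (algOf M) (algOf N) (yoMor X))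

/-- Elements of presheaves `F` and `G` give an element of their tensor product. -/
noncomputable def dayPairing {F G : (psh X).toCat} {x y : (inclusion.obj X).toCat}
    (s : Elt F x) (t : Elt G y) : Elt (F ⊗ G) (x ⊗ y) :=
  elt ((U.core.μIso x y).inv ≫ (elt.symm s ⊗ₘ elt.symm t))

lemma dayPairing_restrict {F G : (psh X).toCat} {x x' y y' : (inclusion.obj X).toCat}
    (f : x' ⟶ x) (g : y' ⟶ y) (s : Elt F x) (t : Elt G y) :
    (dayPairing U s t).restrict (f ⊗ₘ g) = dayPairing U (s.restrict f) (t.restrict g) := by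
  rw [dayPairing, dayPairing, ← elt_map_comp, elt_symm_restrict, elt_symm_restrict,
    ← tensorHom_comp_tensorHom, ← Category.assoc, ← Category.assoc, coreMonoidal_inv_natural]

lemma dayPairing_image {F F' G G' : (psh X).toCat} {x y : (inclusion.obj X).toCat}
    (α : F ⟶ F') (β : G ⟶ G') (s : Elt F x) (t : Elt G y) :
    (dayPairing U s t).image (α ⊗ₘ β) = dayPairing U (s.image α) (t.image β) := by
  rw [dayPairing, dayPairing, ← elt_comp, elt_symm_image, elt_symm_image,
    ← tensorHom_comp_tensorHom, Category.assoc]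

/-- The transformations which exhibit the tensor product as Day convolution. -/
noncomputable def dayTransformation :
    externalProductBifunctor X.toCAT.toCatᵒᵖ X.toCAT.toCatᵒᵖ (Type u) ⟶
      (algOf N).pshTensor ⋙ (Functor.whiskeringLeft _ _ _).obj (algOf M).tensorOp where
  app p :=
    { app z := ↾fun st => dayPairing (F := p.1) (G := p.2) (x := z.1.unop) (y := z.2.unop) U
        st.1 st.2
      naturality z z' f := by
        ext ⟨s, t⟩
        have := dayPairing_restrict (F := p.1) (G := p.2) U f.1.unop f.2.unop s t
        exact this.symm.trans (congrArg (fun u => (ConcreteCategory.hom (CategoryTheory.Functor.map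
          (C := X.toCAT.toCatᵒᵖ) (D := Type u) ((algOf N).pshTensor.obj p) u))
          (dayPairing (F := p.1) (G := p.2) U s t)) (tensorOp_map f.1.unop f.2.unop).symm) }
  naturality p q α := by
    ext z ⟨s, t⟩
    have := dayPairing_image (x := z.1.unop) (y := z.2.unop) U α.1 α.2 s t
    exact this.symm.trans (congrArg (fun u => Elt.image (dayPairing U s t) u)
      (pshTensor_map α).symm)

/-- The dictionary between maps out of `y x ⊗ y y` and elements at `x ⊗ y`, through which the
density statements become statements about pairings. -/
lemma elt_inv_comp {F G H : (psh X).toCat} {x y : (inclusion.obj X).toCat}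
    (s : (CAT.functor (yoMor X)).obj x ⟶ F) (t : (CAT.functor (yoMor X)).obj y ⟶ G)
    (τ : F ⊗ G ⟶ H) :
    elt ((U.core.μIso x y).inv ≫ (s ⊗ₘ t) ≫ τ) = (dayPairing U (elt s) (elt t)).image τ := by
  rw [dayPairing, Equiv.symm_apply_apply, Equiv.symm_apply_apply, ← elt_comp, Category.assoc]

variable [∀ e : (psh X).toCat, PreservesColimitsOfSize.{u, u} (tensorLeft e)]
  [∀ e : (psh X).toCat, PreservesColimitsOfSize.{u, u} (tensorRight e)]

/-- By the Yoneda lemma this is `tensor_hom_ext₂` for the identity functor: pairs of elements are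
pairs of maps from representables. -/
lemma dayPairing_hom_ext {F G H : (psh X).toCat} {τ τ' : F ⊗ G ⟶ H}
    (h : ∀ (x y : (inclusion.obj X).toCat) (s : Elt F x) (t : Elt G y),
      (dayPairing U s t).image τ = (dayPairing U s t).image τ') : τ = τ' := by
  have hy : SmallDense.{u} (CAT.functor (yoMor X)) := yo_smallDense X.toCAT.toCat
  refine hy.tensor_hom_ext₂ (𝟭 (psh X).toCat) fun a b s t => ?_
  rw [← cancel_epi (U.core.μIso a b).inv]
  refine elt.injective ?_
  exact (elt_inv_comp U s t τ).trans ((h _ _ _ _).trans (elt_inv_comp U s t τ').symm)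

lemma exists_dayPairing_desc {F G H : (psh X).toCat}
    (σ : ∀ {x y : (inclusion.obj X).toCat}, Elt F x → Elt G y → Elt H (x ⊗ y))
    (hσ : ∀ {x x' y y' : (inclusion.obj X).toCat} (f : x' ⟶ x) (g : y' ⟶ y) (s : Elt F x)
      (t : Elt G y), (σ s t).restrict (f ⊗ₘ g) = σ (s.restrict f) (t.restrict g)) :
    ∃ τ : F ⊗ G ⟶ H, ∀ {x y : (inclusion.obj X).toCat} (s : Elt F x) (t : Elt G y),
      (dayPairing U s t).image τ = σ s t := by
  have hy : SmallDense.{u} (CAT.functor (yoMor X)) := yo_smallDense X.toCAT.toCat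
  obtain ⟨τ, hτ⟩ := hy.exists_tensor_desc (p := F) (q := G) (e := H)
    (fun a b s t => (U.core.μIso a b).hom ≫ elt.symm (σ (elt s) (elt t)))
    (fun {a a' b b'} f g s t => by
      rw [elt_map_comp, elt_map_comp, ← hσ, elt_symm_restrict, ← Category.assoc,
        coreMonoidal_natural, Category.assoc])
  refine ⟨τ, fun s t => ?_⟩
  rw [dayPairing, ← elt_comp, Category.assoc, hτ, Iso.inv_hom_id_assoc, Equiv.apply_symm_apply,
    Equiv.apply_symm_apply, Equiv.apply_symm_apply]

/-- The action of a transformation out of an external product on elements. -/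
def externalElt {F G H : (psh X).toCat} (σ : (externalProductBifunctor X.toCAT.toCatᵒᵖ
    X.toCAT.toCatᵒᵖ (Type u)).obj (F, G) ⟶ (algOf M).tensorOp ⋙ H)
    {x y : (inclusion.obj X).toCat} (s : Elt F x) (t : Elt G y) : Elt H (x ⊗ y) :=
  σ.app (op x, op y) (s, t)

omit [∀ e : (psh X).toCat, PreservesColimitsOfSize.{u, u} (tensorLeft e)]
  [∀ e : (psh X).toCat, PreservesColimitsOfSize.{u, u} (tensorRight e)] in
lemma externalElt_restrict {F G H : (psh X).toCat} (σ : (externalProductBifunctor X.toCAT.toCatᵒᵖ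
    X.toCAT.toCatᵒᵖ (Type u)).obj (F, G) ⟶ (algOf M).tensorOp ⋙ H)
    {x x' y y' : (inclusion.obj X).toCat} (f : x' ⟶ x) (g : y' ⟶ y) (s : Elt F x) (t : Elt G y) :
    (externalElt σ s t).restrict (f ⊗ₘ g) = externalElt σ (s.restrict f) (t.restrict g) := by
  have := NatTrans.naturality_apply σ (X := (op x, op y)) (Y := (op x', op y'))
    (opHom f, opHom g) ((s, t) : Elt F x × Elt G y)
  refine Eq.trans ?_ this.symm
  exact congrArg (fun u => (ConcreteCategory.hom (CategoryTheory.Functor.map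
    (C := X.toCAT.toCatᵒᵖ) (D := Type u) H u)) (externalElt σ s t)) (tensorOp_map f g).symm

-- A left extension with vertex `H` is a compatible family of maps from `F x × G y` to `H (x ⊗ y)`.
-- By the Yoneda lemma and the tensorator of `y`, it is a compatible family of maps from `y x ⊗ y y`
-- to `H`, indexed by pairs of elements of `F` and `G`. Density in both variables identifies such
-- families with maps from `F ⊗ G` to `H`.
include U in
theorem isDayConvolution_algOf : IsDayConvolution (algOf M) (algOf N) := by
  refine ⟨dayTransformation U, fun F G => ⟨⟨?_⟩⟩⟩
  have H (K : Functor.LeftExtension (algOf M).tensorOp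
      ((externalProductBifunctor _ _ _).obj (F, G))) :
      ∃ τ : (algOf N).pshTensor.obj (F, G) ⟶ K.right,
        ∀ {x y : (inclusion.obj X).toCat} (s : Elt F x) (t : Elt G y),
          (dayPairing U s t).image τ = externalElt K.hom s t :=
    exists_dayPairing_desc U (externalElt K.hom) (externalElt_restrict K.hom)
  choose τ hτ using H
  refine Limits.IsInitial.ofUniqueHom (fun K => StructuredArrow.homMk (τ K) ?_) fun K m => ?_
  · ext z ⟨s, t⟩
    exact hτ K (x := z.1.unop) (y := z.2.unop) s t
  · ext1
    refine dayPairing_hom_ext U fun x y s t => ?_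
    refine Eq.trans ?_ (hτ K s t).symm
    have h := StructuredArrow.w m
    exact congrArg (fun u => externalElt u s t) h

end Day

/-! ### The lifting and its universal property -/

section Lifting

open Bicategory Limits

/-- The properties of Day convolution: `U` is a pseudomorphism structure on the Yoneda embedding,
along which pseudomorphisms and algebra 2-cells extend. -/
structure IsDayAlgebra {κ : Variant} {X : CatS.{u}} {A : StrictAlg (freeMonad κ) (inclusion.obj X)}
    {P : StrictAlg (freeMonad κ) (psh X)} (U : PsMorStr A P (yoMor X)) : Prop where
  monoidallyCocomplete : P.MonoidallyCocomplete
  isDayConvolution : IsDayConvolution A P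
  exists_ext {Z : CAT.{u}} {B : StrictAlg (freeMonad κ) Z} (hB : B.MonoidallyCocomplete)
    {f : inclusion.obj X ⟶ Z} {g : psh X ⟶ Z}
    (hg : PreservesColimitsOfSize.{u, u} (CAT.functor g)) (F : PsMorStr A B f)
    (η : f ≅ yoMor X ≫ g) : ∃ G : PsMorStr P B g, IsAlg2Cell F (U.comp G) η.hom
  isAlg2Cell {Z : CAT.{u}} {B : StrictAlg (freeMonad κ) Z} (hB : B.MonoidallyCocomplete)
    {g g' : psh X ⟶ Z} (hg : PreservesColimitsOfSize.{u, u} (CAT.functor g))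
    {G : PsMorStr P B g} {G' : PsMorStr P B g'} {τ : g ⟶ g'}
    (h : IsAlg2Cell (U.comp G) (U.comp G') (yoMor X ◁ τ)) : IsAlg2Cell G G' τ

/-- Both the given algebra and every target algebra are rewritten as monoidal categories, after
which the extension theorems for dense functors apply to the Yoneda embedding. -/
theorem exists_isDayAlgebra {κ : Variant} {X : CatS.{u}}
    (A : StrictAlg (freeMonad κ) (inclusion.obj X)) :
    ∃ (P : StrictAlg (freeMonad κ) (psh X)) (U : PsMorStr A P (yoMor X)), IsDayAlgebra U := by
  obtain ⟨M, rfl⟩ := exists_eq_algOf A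
  have hy : SmallDense.{u} (CAT.functor (yoMor X)) := yo_smallDense X.toCAT.toCat
  have hc : HasColimitsOfSize.{u, u} (psh X).toCat :=
    (inferInstance : HasColimitsOfSize.{u, u} (X.toCAT.toCatᵒᵖ ⥤ Type u))
  have : (CAT.functor (yoMor X)).Full := (inferInstance : (yo X.toCAT.toCat).Full)
  have : (CAT.functor (yoMor X)).Faithful := (inferInstance : (yo X.toCAT.toCat).Faithful)
  let : MonoidalCategory X.toCAT.toCat := M.toMonoidalCategory
  obtain ⟨T, ⟨h⟩⟩ := exists_tensorExtension (X := X.toCAT.toCat)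
  obtain ⟨N, c, hβ, hl, hr⟩ := TensorExtension.exists_vmonoidal (κ := κ)
    (A := (inclusion.obj X).toCat) (D := (psh X).toCat) hy h
  let U : PsMorStr (algOf M) (algOf N) (yoMor X) := PsMorStr.ofCore c hβ
  refine ⟨algOf N, U, (monoidallyCocomplete_algOf_iff N).2 ⟨hc, hl, hr⟩, isDayConvolution_algOf U,
    fun {Z B} hB f g hg F η => ?_, fun {Z B} hB g g' hg G G' τ h => ?_⟩
  · obtain ⟨O, rfl⟩ := exists_eq_algOf B
    obtain ⟨h1, h2, h3⟩ := (monoidallyCocomplete_algOf_iff O).1 hB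
    exact exists_isAlg2Cell hy F η
  · obtain ⟨O, rfl⟩ := exists_eq_algOf B
    obtain ⟨h1, h2, h3⟩ := (monoidallyCocomplete_algOf_iff O).1 hB
    exact isAlg2Cell_of_whiskerLeft hy h

variable (κ : Variant)

/-- The algebra of presheaves. -/
noncomputable def dayAlg {X : CatS.{u}} (A : StrictAlg (freeMonad κ) (inclusion.obj X)) :
    StrictAlg (freeMonad κ) (psh X) := (exists_isDayAlgebra A).choose

variable {κ}

/-- The pseudomorphism structure on the Yoneda embedding. -/
noncomputable def dayUnit {X : CatS.{u}} (A : StrictAlg (freeMonad κ) (inclusion.obj X)) :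
    PsMorStr A (dayAlg κ A) (yoMor X) := (exists_isDayAlgebra A).choose_spec.choose

lemma dayUnit_isDayAlgebra {X : CatS.{u}} (A : StrictAlg (freeMonad κ) (inclusion.obj X)) :
    IsDayAlgebra (dayUnit A) := (exists_isDayAlgebra A).choose_spec.choose_spec

instance preservesColimits_extMor {X Y : CatS.{u}} (f : inclusion.obj X ⟶ psh Y) :
    PreservesColimitsOfSize.{u, u} (CAT.functor (extMor f)) :=
  (Adjunction.ofIsLeftAdjoint (yoExt (E := Y.toCAT.toCatᵒᵖ ⥤ Type u)
    (pshFunctor f))).leftAdjoint_preservesColimits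

section

variable {X Y Z : CatS.{u}} {A : StrictAlg (freeMonad κ) (inclusion.obj X)}
  {B : StrictAlg (freeMonad κ) (inclusion.obj Y)} {E : StrictAlg (freeMonad κ) (inclusion.obj Z)}
  {f f' : inclusion.obj X ⟶ psh Y}

lemma exists_dayExt (F : PsMorStr A (dayAlg κ B) f) :
    ∃ G : PsMorStr (dayAlg κ A) (dayAlg κ B) (extMor f),
      IsAlg2Cell F ((dayUnit A).comp G) (etaMor f).hom :=
  (dayUnit_isDayAlgebra A).exists_ext (dayUnit_isDayAlgebra B).monoidallyCocomplete
    (preservesColimits_extMor f) F (etaMor f)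

/-- The pseudomorphism structure on the left Kan extension of a pseudomorphism. -/
noncomputable def dayExt (F : PsMorStr A (dayAlg κ B) f) :
    PsMorStr (dayAlg κ A) (dayAlg κ B) (extMor f) := (exists_dayExt F).choose

lemma dayExt_eta (F : PsMorStr A (dayAlg κ B) f) :
    IsAlg2Cell F ((dayUnit A).comp (dayExt F)) (etaMor f).hom := (exists_dayExt F).choose_spec

/-- The inverse of `η_f` is an algebra 2-cell, so it can be cancelled, and density of the Yoneda
embedding removes the whiskering. The remaining cells of the pseudomonad are defined by their
composites with `η`, so this lemma applies to each of them. -/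
lemma isAlg2Cell_of_eta {F : PsMorStr A (dayAlg κ B) f} {g : psh X ⟶ psh Y}
    {G : PsMorStr (dayAlg κ A) (dayAlg κ B) g} {τ : extMor f ⟶ g}
    (h : IsAlg2Cell F ((dayUnit A).comp G) ((etaMor f).hom ≫ yoMor X ◁ τ)) :
    IsAlg2Cell (dayExt F) G τ := by
  refine (dayUnit_isDayAlgebra A).isAlg2Cell (dayUnit_isDayAlgebra B).monoidallyCocomplete
    (preservesColimits_extMor f) ?_
  have := (dayExt_eta F).inv.comp h
  rwa [Iso.inv_hom_id_assoc] at this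

end

variable (κ) in
/-- The lifting of the relative pseudomonad of presheaves given by Day convolution. -/
noncomputable def dayLifting : Lifting presheafPseudomonad.{u} (freeMonad.{u} κ) where
  alg A := dayAlg κ A
  extStr F := dayExt F
  unitStr A := dayUnit A
  extStr_map {X Y A B f f'} F F' α hα := by
    refine isAlg2Cell_of_eta ?_
    -- By naturality of `η`, the composite that defines `α^*` is `α` followed by `η_{f'}`.
    have := hα.comp (dayExt_eta F')
    exact (presheafData.eta_natural α) ▸ this
  mu_cell {X Y Z A B E f g} F G := by
    refine isAlg2Cell_of_eta ?_
    -- The composite that defines `μ` is `η_f` whiskered with `g^*`, up to the associator.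
    have := ((dayExt_eta F).whiskerRight (dayExt G)).comp
      (IsAlg2Cell.associator (dayUnit A) (dayExt F) (dayExt G))
    exact (presheafData.eta_mu f g) ▸ this
  eta_cell F := dayExt_eta F
  theta_cell {X} A := by
    refine isAlg2Cell_of_eta ?_
    -- The composite that defines `θ` is the inverse right unitor of the Yoneda embedding.
    exact (presheafData.eta_theta X) ▸ IsAlg2Cell.rightUnitor_inv (dayUnit A)

/-- Restriction is fully faithful because 2-cells out of a cocontinuous functor correspond to their
restrictions and being an algebra 2-cell is detected there. It is essentially surjective because the
left Kan extension of a pseudomorphism is cocontinuous and inherits a pseudomorphism structure for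
which its unit is an algebra isomorphism. -/
lemma IsDayAlgebra.isFreeMonoidalCocompletion {X : CatS.{u}}
    {A : StrictAlg (freeMonad κ) (inclusion.obj X)} {P : StrictAlg (freeMonad κ) (psh X)}
    {U : PsMorStr A P (yoMor X)} (hU : IsDayAlgebra U) :
    IsFreeMonoidalCocompletion (PsMor.mk (yoMor X) U) := by
  refine ⟨hU.monoidallyCocomplete, fun Z B hB => ?_⟩
  have hy : SmallDense.{u} (CAT.functor (yoMor X)) := yo_smallDense X.toCAT.toCat
  have hZ : HasColimitsOfSize.{u, u} Z.toCat := hB.hasColimits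
  have bij (g g' : psh X ⟶ Z) (_ : PreservesColimitsOfSize.{u, u} (CAT.functor g)) :
      Function.Bijective fun τ : g ⟶ g' => yoMor X ◁ τ := by
    refine ⟨fun τ τ' h => ?_, fun σ => ?_⟩
    · exact CAT.cell_ext_iff.2 ((hy.homBij (CAT.functor g) (CAT.functor g')).1
        (CAT.cell_ext_iff.1 h))
    · obtain ⟨τ, hτ⟩ := (hy.homBij (CAT.functor g) (CAT.functor g')).2 (CAT.natTrans σ)
      exact ⟨CAT.cellOf τ, CAT.cell_ext_iff.2 hτ⟩
  refine { faithful := ⟨fun {G G' α β} h => ?_⟩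
           full := ⟨fun {G G'} γ => ?_⟩
           essSurj := ⟨fun F => ?_⟩ }
  · ext
    exact PsMor.Cell.ext ((bij _ _ G.property).1 (congrArg PsMor.Cell.cell h))
  · obtain ⟨τ, hτ⟩ := (bij G.obj.hom G'.obj.hom G.property).2 γ.cell
    refine ⟨ObjectProperty.homMk ⟨τ, hU.isAlg2Cell hB G.property ?_⟩, PsMor.Cell.ext hτ⟩
    have := γ.isCell
    rwa [← hτ] at this
  · let g : psh X ⟶ Z := CAT.homOf (X := psh X) (yoExt (X := X.toCAT.toCat) (CAT.functor F.hom))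
    have hg : PreservesColimitsOfSize.{u, u} (CAT.functor g) :=
      (Adjunction.ofIsLeftAdjoint (yoExt (X := X.toCAT.toCat)
        (CAT.functor F.hom))).leftAdjoint_preservesColimits
    let η : F.hom ≅ yoMor X ≫ g := InducedBicategory.isoMk
      (Cat.Hom.isoMk (yoExtIso (X := X.toCAT.toCat) (CAT.functor F.hom)))
    obtain ⟨G, hG⟩ := hU.exists_ext hB hg F.str η
    exact ⟨⟨⟨g, G⟩, hg⟩, ⟨{ hom := ⟨η.inv, hG.inv⟩
                            inv := ⟨η.hom, hG⟩
                            hom_inv_id := PsMor.Cell.ext η.inv_hom_id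
                            inv_hom_id := PsMor.Cell.ext η.hom_inv_id }⟩⟩

end Lifting
end PshLift

theorem theorem7p3 (κ : PshLift.Variant) :
    ∃ L : PshLift.Lifting PshLift.presheafPseudomonad.{u} (PshLift.freeMonad.{u} κ),
      ∀ (X : PshLift.CatS.{u})
        (A : PshLift.StrictAlg (PshLift.freeMonad κ) (PshLift.inclusion.obj X)),
        PshLift.IsDayConvolution A (L.alg A) ∧
        PshLift.IsFreeMonoidalCocompletion
          (PshLift.PsMor.mk (PshLift.presheafPseudomonad.unit X) (L.unitStr A)) :=
  ⟨PshLift.dayLifting κ, fun _ A => ⟨(PshLift.dayUnit_isDayAlgebra A).isDayConvolution,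
    (PshLift.dayUnit_isDayAlgebra A).isFreeMonoidalCocompletion⟩⟩
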